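/- **Setting.** Let $\widetilde{\mathcal H}$ be the hyperboloid model of $\widetilde{\mathrm{SL}_2\mathbf R}$: the universal cover of the set of all $(x^0;x^1;x^2;x^3)\in\mathbf R^4$, up to positive factors, with $-(x^0)^2-(x^1)^2+(x^2)^2+(x^3)^2<0$. Its points are the pairs $(\phi,w)$ with $\phi\in\mathbf R$, $w\in\mathbf C$, $|w|<1$, lying over $x^0+ix^1=e^{i\phi}$, $x^2+ix^3=we^{-i\phi}$. The fibres are the lines $w=\text{const}$, the fibre translation by $s$ is $(\phi,w)\mapsto(\phi+s,w)$, and $\phi=0$ is the base plane. Isometries are the lifts of the collineations $x\mapsto xa$ (row vectors) with $$a=\begin{pmatrix} a_0^0&a_0^1&a_0^2&a_0^3\\ \mp a_0^1&\pm a_0^0&\pm a_0^3&\mp a_0^2\\ a_2^0&a_2^1&a_2^2&a_2^3\\ \pm a_2^1&\mp a_2^0&\mp a_2^3&\pm a_2^2\end{pmatrix},$$ $-(a_0^0)^2-(a_0^1)^2+(a_0^2)^2+(a_0^3)^2=-1$, $-(a_2^0)^2-(a_2^1)^2+(a_2^2)^2+(a_2^3)^2=1$, and $-a_0^0a_2^0-a_0^1a_2^1+a_0^2a_2^2+a_0^3a_2^3=0=-a_0^0a_2^1+a_0^1a_2^0-a_0^2a_2^3+a_0^3a_2^2$.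 The rotation by $\omega$ about the fibre through the origin $(0,0)$ is $(\phi,w)\mapsto(\phi,e^{i\omega}w)$; the rotation by $\omega$ about the fibre through another point is its conjugate by the translation matching the two points. **Prisms.** Let $p\ge3$ and $0<\rho<1$, and let $A_k$ $(k\in\mathbf Z/p)$ be the points $w=\rho\,(\sin\frac{2\pi k}p+i\cos\frac{2\pi k}p)$ of the base plane, with fibres $f_k$. A regular base figure is the region around the origin, inside $|w|\le\rho$, bounded by $p$ side curves: arcs of circles (or segments) in the disc $|w|<1$ joining $A_k$ to $A_{k+1}$, which are taken into each other by the rotations by $2\pi/p$ about the origin and enclose a positive angle at each vertex. (The fibres over such arcs form pieces of one-sheeted hyperboloids.) The union of the fibres over a base figure is a *regular infinite $p$-gonal prism*; its side face $[f_k;f_{k+1}]$ is the union of the fibres over the side curve $A_kA_{k+1}$. The part of it between the base figure and the image of the base figure under the fibre translation by $t\neq0$ is a *regular bounded $p$-gonal prism* of height $|t|$. Its faces are its two cover faces, its $p$ side faces, its edges and its vertices. **Tilings.** A *tiling* is a family of closed sets that cover the space, any two distinct ones having disjoint interiors; it is *face-to-face* if any two distinct tiles are disjoint or meet in a common face. A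 *regular infinite prism tiling* $\mathcal T_p^i(q)$ is a tiling by the images of a regular infinite $p$-gonal prism under the group generated by the rotations $r_k$ by $2\pi/q$ about its side fibres $f_k$, where $r_{k+1}$ maps $[f_k;f_{k+1}]$ onto $[f_{k+1};f_{k+2}]$ for all $k$. *Cutting* it at height $t$ means: write each of its tiles as the image of that infinite prism under some element of the rotation group, and replace the tile by the images, under this element, of all the bounded prisms $\tau^n(\mathcal P)$, $n\in\mathbf Z$, where $\mathcal P$ is the bounded prism of height $t$ and $\tau$ is the fibre translation by $t$. **Theorem 2.3.** Let $p\ge3$ and let $q$ be an integer with $q>\frac{2p}{p-2}$. 1. There are infinitely many regular bounded $p$-gonal prism tilings $\mathcal T_p(q)$ of $\widetilde{\mathrm{SL}_2\mathbf R}$, all non-face-to-face. More precisely, there is a regular infinite prism tiling $\mathcal T_p^i(q)$ and, for every $t>0$, a family obtained from it by cutting at height $t$ which is a tiling by isometric copies of one regular bounded $p$-gonal prism of height $t$ and is not face-to-face; tilings of this collection that belong to different heights are not congruent under any isometry. 2. No regular $p$-gonal prism tiling is face-to-face: no tiling of $\widetilde{\mathrm{SL}_2\mathbf R}$ by isometric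 copies of one regular bounded $p$-gonal prism is face-to-face. In particular no $\mathcal T_p(q)$ is. -/

import Mathlib

/-- The hyperboloid model of the universal cover of `SL₂(ℝ)`, in fibre coordinates: the pair `(φ, w)`
consists of the fibre coordinate `φ` and the trace point `w = y + i z = tanh r · e^{iθ}` of the fibre
in the base plane `φ = 0` (an open unit disc). The covering map onto the interior of the one-sheeted
hyperboloid is `homCoord`. -/
abbrev SL2Cover : Type := ℝ × Metric.ball (0 : ℂ) 1

namespace SL2Cover

/-- Homogeneous coordinates `(x⁰; x¹; x²; x³)` (up to a positive factor) of the image of a point in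
the projective model: `x⁰ + i x¹ = e^{iφ}` and `x² + i x³ = w e^{-iφ}`. This is the hyperboloid
parametrization `(cosh r cos φ, cosh r sin φ, sinh r cos (θ - φ), sinh r sin (θ - φ))` divided by
`cosh r`. -/
noncomputable def homCoord (X : SL2Cover) : Fin 4 → ℝ :=
  ![Real.cos X.1, Real.sin X.1,
    (X.2 : ℂ).re * Real.cos X.1 + (X.2 : ℂ).im * Real.sin X.1,
    (X.2 : ℂ).im * Real.cos X.1 - (X.2 : ℂ).re * Real.sin X.1]

/-- `g` is a lift to the universal cover of the collineation with matrix `a`, acting on row vectors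
from the right; homogeneous coordinates are taken up to positive factors. -/
def Lifts (g : SL2Cover ≃ₜ SL2Cover) (a : Matrix (Fin 4) (Fin 4) ℝ) : Prop :=
  ∀ X, ∃ c : ℝ, 0 < c ∧ homCoord (g X) = c • Matrix.vecMul (homCoord X) a

/-- The matrices of the isometries of the geometry; `ε = 1` and `ε = -1` are the upper and the lower
choice of the signs (isometries preserving, resp. reversing, the direction of the fibres). -/
def IsIsometryMatrix (a : Matrix (Fin 4) (Fin 4) ℝ) : Prop :=
  (∃ ε : ℝ, (ε = 1 ∨ ε = -1) ∧
    a 1 0 = -ε * a 0 1 ∧ a 1 1 = ε * a 0 0 ∧ a 1 2 = ε * a 0 3 ∧ a 1 3 = -ε * a 0 2 ∧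
    a 3 0 = ε * a 2 1 ∧ a 3 1 = -ε * a 2 0 ∧ a 3 2 = -ε * a 2 3 ∧ a 3 3 = ε * a 2 2) ∧
  -(a 0 0) ^ 2 - (a 0 1) ^ 2 + (a 0 2) ^ 2 + (a 0 3) ^ 2 = -1 ∧
  -(a 2 0) ^ 2 - (a 2 1) ^ 2 + (a 2 2) ^ 2 + (a 2 3) ^ 2 = 1 ∧
  -(a 0 0) * a 2 0 - a 0 1 * a 2 1 + a 0 2 * a 2 2 + a 0 3 * a 2 3 = 0 ∧
  -(a 0 0) * a 2 1 + a 0 1 * a 2 0 - a 0 2 * a 2 3 + a 0 3 * a 2 2 = 0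

/-- The isometries of the geometry: the lifts of the collineations above. -/
def IsIsometry (g : SL2Cover ≃ₜ SL2Cover) : Prop :=
  ∃ a, IsIsometryMatrix a ∧ Lifts g a

/-- The translation matrix taking the origin `(1; 0; 0; 0)` to `x`. -/
def translationMatrix (x : Fin 4 → ℝ) : Matrix (Fin 4) (Fin 4) ℝ :=
  !![x 0, x 1, x 2, x 3;
     -x 1, x 0, x 3, -x 2;
     x 2, x 3, x 0, x 1;
     x 3, -x 2, -x 1, x 0]

/-- The inverse, up to a positive factor, of `translationMatrix x`. -/
def translationInvMatrix (x : Fin 4 → ℝ) : Matrix (Fin 4) (Fin 4) ℝ :=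
  !![x 0, -x 1, -x 2, -x 3;
     x 1, x 0, -x 3, x 2;
     -x 2, -x 3, x 0, -x 1;
     -x 3, x 2, x 1, x 0]

/-- The rotation by `ω` about the fibre through the origin. -/
noncomputable def originRotationMatrix (ω : ℝ) : Matrix (Fin 4) (Fin 4) ℝ :=
  !![1, 0, 0, 0;
     0, 1, 0, 0;
     0, 0, Real.cos ω, Real.sin ω;
     0, 0, -Real.sin ω, Real.cos ω]

/-- `g` is the rotation by the angle `ω` about the fibre through `X`: the lift, fixing `X`, of the
collineation `T⁻¹ R T`, where `T` is the translation taking the origin to `X`. -/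
def IsRotation (X : SL2Cover) (ω : ℝ) (g : SL2Cover ≃ₜ SL2Cover) : Prop :=
  Lifts g (translationInvMatrix (homCoord X) * originRotationMatrix ω *
    translationMatrix (homCoord X)) ∧ g X = X

/-- The fibre translation by `s`. -/
noncomputable def fibreTranslation (s : ℝ) : SL2Cover ≃ₜ SL2Cover :=
  (Homeomorph.addRight s).prodCongr (Homeomorph.refl _)

/-- The union of the segments `{(φ, w) | φ ∈ J}` of the fibres through the points `w ∈ B` of the
base plane. -/
def overBase (B : Set ℂ) (J : Set ℝ) : Set SL2Cover :=
  {X | (X.2 : ℂ) ∈ B ∧ X.1 ∈ J}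

/-- The data of a regular infinite `p`-gonal prism centred at the origin: the Euclidean radius `ρ`
in the disc at which the vertices lie, and a number `m` fixing the fibred hyperboloids that carry
the side surfaces. The hyperboloid carrying the side surface through the neighbouring vertices
`A_k`, `A_{k+1}` consists of the fibres over the circle (or line)
`m (|w|² - ρ²) + ⟨w, u_k⟩ = ρ cos (π / p)` through these vertices, `u_k` being the unit vector
bisecting the directions of `A_k` and `A_{k+1}`; all side surfaces have the same `m`, so they are
carried into each other by the rotations about the fibre through the origin.
The condition on `m` says that the angle of the base figure at its vertices is positive. -/
structure RegularShape (p : ℕ) where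
  ρ : ℝ
  m : ℝ
  ρ_pos : 0 < ρ
  ρ_lt_one : ρ < 1
  m_gt : -(Real.cos (Real.pi / p) / (2 * ρ)) < m

namespace RegularShape

variable {p : ℕ}

/-- The vertex `A_k` of the base figure as the point `y + i z` of the base plane (indices `k` are
taken modulo `p`; the homogeneous coordinates are `(1; 0; ρ sin (2πk/p); ρ cos (2πk/p))`). -/
noncomputable def vertex (S : RegularShape p) (k : ℤ) : ℂ :=
  ⟨S.ρ * Real.sin (2 * Real.pi * k / p), S.ρ * Real.cos (2 * Real.pi * k / p)⟩

theorem vertex_mem (S : RegularShape p) (k : ℤ) : S.vertex k ∈ Metric.ball (0 : ℂ) 1 := by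
  rw [mem_ball_zero_iff, ← sq_lt_one_iff₀ (norm_nonneg _), ← Complex.normSq_eq_norm_sq,
    Complex.normSq_apply]
  simp only [vertex]
  have h := Real.sin_sq_add_cos_sq (2 * Real.pi * k / p)
  have h1 := S.ρ_pos
  have h2 := S.ρ_lt_one
  have h3 : S.ρ * S.ρ < 1 := by nlinarith
  linear_combination h3 + S.ρ * S.ρ * h

/-- The vertex `A_k` as a point of the space. -/
noncomputable def vertexPoint (S : RegularShape p) (k : ℤ) : SL2Cover :=
  (0, ⟨S.vertex k, S.vertex_mem k⟩)

/-- The function cutting out the circle of the `k`-th side curve, negative at the origin. -/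
noncomputable def sideForm (S : RegularShape p) (k : ℤ) (w : ℂ) : ℝ :=
  S.m * (‖w‖ ^ 2 - S.ρ ^ 2) +
    (w.re * Real.sin (2 * Real.pi * (k + 1 / 2) / p) +
      w.im * Real.cos (2 * Real.pi * (k + 1 / 2) / p)) -
    S.ρ * Real.cos (Real.pi / p)

/-- The base figure, the region of the base plane around the origin that is bounded by the side
curves. It lies in the disc `|w| ≤ ρ` bounded by the circle through the vertices. -/
def baseFigure (S : RegularShape p) : Set ℂ :=
  {w | ‖w‖ ≤ S.ρ ∧ ∀ k : ℤ, S.sideForm k w ≤ 0}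

/-- The side curve of the base figure from `A_k` to `A_{k+1}`. -/
def sideCurve (S : RegularShape p) (k : ℤ) : Set ℂ :=
  {w | w ∈ S.baseFigure ∧ S.sideForm k w = 0}

/-- The infinite regular prism. -/
def infinitePrism (S : RegularShape p) : Set SL2Cover :=
  overBase S.baseFigure Set.univ

/-- The infinite side face `[f_k; f_{k+1}]` between the side fibres through `A_k` and `A_{k+1}`. -/
def infiniteSideFace (S : RegularShape p) (k : ℤ) : Set SL2Cover :=
  overBase (S.sideCurve k) Set.univ

/-- The bounded regular prism between the base figure and its image under the fibre translation
by `t`. -/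
noncomputable def prism (S : RegularShape p) (t : ℝ) : Set SL2Cover :=
  overBase S.baseFigure (Set.uIcc 0 t)

/-- The faces of the bounded prism. -/
inductive IsPrismFace (S : RegularShape p) (t : ℝ) : Set SL2Cover → Prop
  | bottomCover : IsPrismFace S t (overBase S.baseFigure {0})
  | topCover : IsPrismFace S t (overBase S.baseFigure {t})
  | side (k : ℤ) : IsPrismFace S t (overBase (S.sideCurve k) (Set.uIcc 0 t))
  | bottomEdge (k : ℤ) : IsPrismFace S t (overBase (S.sideCurve k) {0})
  | topEdge (k : ℤ) : IsPrismFace S t (overBase (S.sideCurve k) {t})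
  | sideEdge (k : ℤ) : IsPrismFace S t (overBase {S.vertex k} (Set.uIcc 0 t))
  | bottomVertex (k : ℤ) : IsPrismFace S t (overBase {S.vertex k} {0})
  | topVertex (k : ℤ) : IsPrismFace S t (overBase {S.vertex k} {t})

/-- The group generated by the rotations by `2π/q` about the side fibres of the prism. -/
noncomputable def rotationGroup (S : RegularShape p) (q : ℕ) : Subgroup (SL2Cover ≃ₜ SL2Cover) :=
  Subgroup.closure {g | ∃ k : ℤ, IsRotation (S.vertexPoint k) (2 * Real.pi / q) g}

/-- The images of the infinite prism under the rotation group. -/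
def infiniteTiles (S : RegularShape p) (q : ℕ) : Set (Set SL2Cover) :=
  {T | ∃ g ∈ S.rotationGroup q, T = g '' S.infinitePrism}

/-- The family `𝒯` arises by cutting every infinite tile by fibre translations: every infinite tile
is written as the image of the infinite prism under an element of the rotation group, and is
cut into the images of the prisms into which the powers of the fibre translation `τ` by `t` divide
the infinite prism. -/
def IsCutting (S : RegularShape p) (q : ℕ) (t : ℝ) (𝒯 : Set (Set SL2Cover)) : Prop :=
  ∃ sel : Set SL2Cover → (SL2Cover ≃ₜ SL2Cover),
    (∀ Q ∈ S.infiniteTiles q, sel Q ∈ S.rotationGroup q ∧ sel Q '' S.infinitePrism = Q) ∧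
    𝒯 = {T | ∃ Q ∈ S.infiniteTiles q, ∃ n : ℤ,
      T = sel Q '' ((fibreTranslation t ^ n : SL2Cover ≃ₜ SL2Cover) '' S.prism t)}

end RegularShape

/-- A tiling: a family of closed sets covering the space, any two distinct ones of which have
disjoint interiors. -/
def IsTiling (𝒯 : Set (Set SL2Cover)) : Prop :=
  (∀ T ∈ 𝒯, IsClosed T) ∧ ⋃₀ 𝒯 = Set.univ ∧
    ∀ T ∈ 𝒯, ∀ T' ∈ 𝒯, T ≠ T' → Disjoint (interior T) (interior T')

/-- `S` is the shape of a regular infinite prism tiling with parameters `(p, q)`: the rotation by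
`2π/q` about each side fibre takes one of the two side faces through it onto the other one, and the
images of the infinite prism under these rotations tile the space. -/
def IsRegularInfiniteTiling {p : ℕ} (S : RegularShape p) (q : ℕ) : Prop :=
  (∀ k : ℤ, ∃ r, IsRotation (S.vertexPoint (k + 1)) (2 * Real.pi / q) r ∧
    r '' S.infiniteSideFace k = S.infiniteSideFace (k + 1)) ∧
  IsTiling (S.infiniteTiles q)

/-- A tiling by prisms congruent to the bounded regular prism of shape `S` and height `t`. -/
def IsRegularPrismTiling {p : ℕ} (S : RegularShape p) (t : ℝ) (𝒯 : Set (Set SL2Cover)) : Prop :=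
  IsTiling 𝒯 ∧ ∀ T ∈ 𝒯, ∃ g, IsIsometry g ∧ T = g '' S.prism t

/-- `F` is a face (cover face, side face, edge or vertex) of the tile `T`, a copy of the prism of
shape `S` and height `t`. -/
def IsTileFace {p : ℕ} (S : RegularShape p) (t : ℝ) (T F : Set SL2Cover) : Prop :=
  ∃ g, IsIsometry g ∧ T = g '' S.prism t ∧ ∃ F₀, S.IsPrismFace t F₀ ∧ F = g '' F₀

/-- Face-to-face: any two distinct tiles are disjoint or meet in a common face. -/
def IsFaceToFace {p : ℕ} (S : RegularShape p) (t : ℝ) (𝒯 : Set (Set SL2Cover)) : Prop :=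
  ∀ T ∈ 𝒯, ∀ T' ∈ 𝒯, T ≠ T' →
    T ∩ T' = ∅ ∨ (IsTileFace S t T (T ∩ T') ∧ IsTileFace S t T' (T ∩ T'))

/-- Two families of sets are congruent if an isometry takes one onto the other. -/
def AreCongruent (𝒯 𝒯' : Set (Set SL2Cover)) : Prop :=
  ∃ g : SL2Cover ≃ₜ SL2Cover, IsIsometry g ∧ (fun T => g '' T) '' 𝒯 = 𝒯'

end SL2Cover

/-! ### Isometry invariants of pairs of points. -/

namespace SL2Cover

open ComplexConjugate

/-! The proof rests on two isometry invariants of a pair of points. In the complex coordinates `(x⁰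
+ i x¹, x² - i x³)` an isometry acts, up to positive factors, as a linear or antilinear map
preserving a Hermitian form of signature (1,1). The normalised modulus of the product of two points
is `sep`, a function of the hyperbolic distance of their trace points. Its argument, lifted to a
real number on the universal cover, is `phaseDiff`. An isometry preserves `sep` and multiplies
`phaseDiff` by a sign (`exists_preservesForm`). So it permutes the fibres, acts on each as `s ↦ ± s
+ const`, and is trivial if it preserves the fibre direction and fixes points of two different
fibres (`PreservesForm.eq_one`).

No tiling is face-to-face. The ends of a base edge lie at the same height, yet their phase
difference is not zero (`phaseDiff_sideEnd_ne_zero`), since the horizontal lift of a geodesic does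
not close up in the base plane. A direction-preserving isometry of a side face onto itself therefore
cannot swap its two fibres; it fixes both ends and is the identity. A direction-reversing one is the
half-turn `prismFlip`, a symmetry of the prism. Hence an isometry matching side faces of two copies
of the prism matches the copies themselves (`image_prism_of_image_side`), and two tiles with a
common side face coincide. But a face-to-face tiling would have such tiles: tilings are locally
finite, so finitely many other tiles cover the infinitely many mid-height points of a side face, one
of them contains two of these points, and then the common face can only be a side face.

Existence. The condition on `q` says `π/p + π/q < π/2`, so there is a regular hyperbolic `p`-gon
with angles `2π/q`. The rotations about its vertices act on the disc inside the group of the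
triangle with angles `π/p`, `π/2`, `π/q`. In the three Minkowski products with the wall normals this
is a linear reflection group. Tits' argument (`tits_dichotomy`) shows that its chambers do not
overlap, and minimising a proper linear height shows that they cover (`exists_nonneg`). The triangle
group is the dihedral group of the polygon times the group of the rotations
(`exists_mul_of_mem_gen`), so the images of the polygon tile the disc, and the infinite prisms over
them tile the space. Cutting along multiples of `t` gives the bounded tilings. Isometries preserve
lengths along fibres, so different heights are not congruent. -/

theorem normSq_lt_one (X : SL2Cover) : Complex.normSq (X.2 : ℂ) < 1 := by
  have h := X.2.2
  rw [mem_ball_zero_iff] at h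
  rw [Complex.normSq_eq_norm_sq]
  exact (sq_lt_one_iff₀ (norm_nonneg _)).2 h

/-- The Hermitian form of signature `(1, 1)` on which the isometries act, evaluated on the
representatives `(e^{iφ}, w̄ e^{iφ})` of two points. -/
noncomputable def herm (X Y : SL2Cover) : ℂ :=
  Complex.exp (((X.1 - Y.1 : ℝ) : ℂ) * Complex.I) * (1 - conj (X.2 : ℂ) * (Y.2 : ℂ))

theorem herm_re (X Y : SL2Cover) : (herm X Y).re =
    homCoord X 0 * homCoord Y 0 + homCoord X 1 * homCoord Y 1 - homCoord X 2 * homCoord Y 2 -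
      homCoord X 3 * homCoord Y 3 := by
  simp only [herm, homCoord, Complex.mul_re, Complex.exp_ofReal_mul_I_re,
    Complex.exp_ofReal_mul_I_im, Real.cos_sub, Real.sin_sub, Complex.sub_re, Complex.sub_im,
    Complex.mul_im, Complex.conj_re, Complex.conj_im, Complex.one_re, Complex.one_im]
  simp
  ring

theorem herm_im (X Y : SL2Cover) : (herm X Y).im =
    homCoord X 1 * homCoord Y 0 - homCoord X 0 * homCoord Y 1 + homCoord X 3 * homCoord Y 2 -
      homCoord X 2 * homCoord Y 3 := by
  simp only [herm, homCoord, Complex.mul_re, Complex.exp_ofReal_mul_I_re,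
    Complex.exp_ofReal_mul_I_im, Real.cos_sub, Real.sin_sub, Complex.sub_re, Complex.sub_im,
    Complex.mul_im, Complex.conj_re, Complex.conj_im, Complex.one_re, Complex.one_im]
  simp
  ring

theorem herm_self (X : SL2Cover) : herm X X = ((1 - Complex.normSq (X.2 : ℂ) : ℝ) : ℂ) := by
  simp only [herm, sub_self, Complex.ofReal_zero, zero_mul, Complex.exp_zero, one_mul]
  rw [← Complex.normSq_eq_conj_mul_self]
  push_cast
  ring

theorem normSq_herm (X Y : SL2Cover) :
    Complex.normSq (herm X Y) = Complex.normSq (1 - conj (X.2 : ℂ) * (Y.2 : ℂ)) := by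
  rw [herm, map_mul, Complex.normSq_eq_norm_sq, Complex.norm_exp_ofReal_mul_I]
  simp

/-- The difference of the fibre coordinates of two points, measured along the horizontal lift of
the geodesic of the base plane that joins their trace points. -/
noncomputable def phaseDiff (X Y : SL2Cover) : ℝ :=
  X.1 - Y.1 + Complex.arg (1 - conj (X.2 : ℂ) * (Y.2 : ℂ))

/-- The squared hyperbolic cosine of the distance of the trace points. -/
noncomputable def sep (X Y : SL2Cover) : ℝ :=
  Complex.normSq (1 - conj (X.2 : ℂ) * (Y.2 : ℂ)) /
    ((1 - Complex.normSq (X.2 : ℂ)) * (1 - Complex.normSq (Y.2 : ℂ)))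

/-- The form stays in the right half plane, where the principal argument is continuous and odd under
conjugation. This makes `phaseDiff` continuous on the whole cover, without branch jumps. -/
theorem re_one_sub_pos {z w : ℂ} (hz : ‖z‖ < 1) (hw : ‖w‖ < 1) : 0 < (1 - conj z * w).re := by
  have h1 : ‖conj z * w‖ < 1 := by
    rw [norm_mul, RCLike.norm_conj]
    nlinarith [norm_nonneg z, norm_nonneg w]
  have := (abs_le.1 (Complex.abs_re_le_norm (conj z * w))).2
  simp only [Complex.sub_re, Complex.one_re]
  linarith

theorem norm_lt_one (X : SL2Cover) : ‖(X.2 : ℂ)‖ < 1 := by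
  exact mem_ball_zero_iff.1 X.2.2

theorem re_form_pos (X Y : SL2Cover) : 0 < (1 - conj (X.2 : ℂ) * (Y.2 : ℂ)).re :=
  re_one_sub_pos X.norm_lt_one Y.norm_lt_one

theorem herm_eq_polar (X Y : SL2Cover) : herm X Y =
    ‖1 - conj (X.2 : ℂ) * (Y.2 : ℂ)‖ * Complex.exp ((phaseDiff X Y : ℝ) * Complex.I) := by
  rw [phaseDiff, herm]
  conv_lhs => rw [← Complex.norm_mul_exp_arg_mul_I (1 - conj (X.2 : ℂ) * (Y.2 : ℂ))]
  rw [Complex.ofReal_add, add_mul, Complex.exp_add]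
  ring

theorem continuous_form : Continuous fun Z : SL2Cover × SL2Cover =>
    (1 - conj (Z.1.2 : ℂ) * (Z.2.2 : ℂ)) := by
  fun_prop

theorem continuous_phaseDiff :
    Continuous fun Z : SL2Cover × SL2Cover => phaseDiff Z.1 Z.2 := by
  unfold phaseDiff
  refine Continuous.add (by fun_prop) ?_
  refine continuous_iff_continuousAt.2 fun Z => ?_
  exact (Complex.continuousAt_arg (Or.inl (re_form_pos Z.1 Z.2))).comp
    (f := fun Z : SL2Cover × SL2Cover => (1 - conj (Z.1.2 : ℂ) * (Z.2.2 : ℂ)))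
    continuous_form.continuousAt

theorem continuous_sep : Continuous fun Z : SL2Cover × SL2Cover => sep Z.1 Z.2 := by
  unfold sep
  refine Continuous.div (Complex.continuous_normSq.comp continuous_form) ?_ ?_
  · have h1 : Continuous fun Z : SL2Cover × SL2Cover => Complex.normSq (Z.1.2 : ℂ) :=
      Complex.continuous_normSq.comp (by fun_prop)
    have h2 : Continuous fun Z : SL2Cover × SL2Cover => Complex.normSq (Z.2.2 : ℂ) :=
      Complex.continuous_normSq.comp (by fun_prop)
    exact (continuous_const.sub h1).mul (continuous_const.sub h2)
  · intro Z
    have h1 := Z.1.normSq_lt_one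
    have h2 := Z.2.normSq_lt_one
    exact (mul_pos (by linarith) (by linarith)).ne'

theorem phaseDiff_self (X : SL2Cover) : phaseDiff X X = 0 := by
  have : (1 - conj (X.2 : ℂ) * (X.2 : ℂ)) = ((1 - Complex.normSq (X.2 : ℂ) : ℝ) : ℂ) := by
    rw [← Complex.normSq_eq_conj_mul_self]; push_cast; ring
  rw [phaseDiff, this, Complex.arg_ofReal_of_nonneg (by linarith [X.normSq_lt_one])]
  ring

theorem phaseDiff_swap (X Y : SL2Cover) : phaseDiff Y X = -phaseDiff X Y := by
  have h : (1 - conj (Y.2 : ℂ) * (X.2 : ℂ)) = conj (1 - conj (X.2 : ℂ) * (Y.2 : ℂ)) := by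
    simp [mul_comm]
  have h2 : Complex.arg (1 - conj (X.2 : ℂ) * (Y.2 : ℂ)) ≠ Real.pi := by
    intro h3
    have h4 := Complex.abs_arg_lt_pi_div_two_iff.2 (Or.inl (re_form_pos X Y))
    rw [h3, abs_of_pos Real.pi_pos] at h4
    linarith [Real.pi_pos]
  rw [phaseDiff, phaseDiff, h, Complex.arg_conj, if_neg h2]
  ring

theorem phaseDiff_of_snd_eq {X Y : SL2Cover} (h : X.2 = Y.2) : phaseDiff X Y = X.1 - Y.1 := by
  have h1 : phaseDiff X Y = X.1 - Y.1 + phaseDiff X X := by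
    simp only [phaseDiff, h]; ring
  rw [h1, phaseDiff_self, add_zero]

theorem normSq_form (z w : ℂ) : Complex.normSq (1 - conj z * w) =
    (1 - Complex.normSq z) * (1 - Complex.normSq w) + Complex.normSq (z - w) := by
  simp [Complex.normSq_apply]; ring

theorem sep_eq (X Y : SL2Cover) : sep X Y = 1 + Complex.normSq ((X.2 : ℂ) - Y.2) /
    ((1 - Complex.normSq (X.2 : ℂ)) * (1 - Complex.normSq (Y.2 : ℂ))) := by
  have h1 := X.normSq_lt_one
  have h2 := Y.normSq_lt_one
  have h3 : (1 - Complex.normSq (X.2 : ℂ)) * (1 - Complex.normSq (Y.2 : ℂ)) ≠ 0 :=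
    (mul_pos (by linarith) (by linarith)).ne'
  rw [sep, normSq_form, add_div, div_self h3]

/-- This lets `sep` detect fibres: a map that preserves it permutes them. -/
theorem sep_eq_one_iff {X Y : SL2Cover} : sep X Y = 1 ↔ X.2 = Y.2 := by
  have h1 := X.normSq_lt_one
  have h2 := Y.normSq_lt_one
  have h3 : (1 - Complex.normSq (X.2 : ℂ)) * (1 - Complex.normSq (Y.2 : ℂ)) ≠ 0 :=
    (mul_pos (by linarith) (by linarith)).ne'
  rw [sep_eq, add_eq_left, div_eq_zero_iff, or_iff_left h3, map_eq_zero, sub_eq_zero,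
    Subtype.ext_iff]

theorem sep_self (X : SL2Cover) : sep X X = 1 := sep_eq_one_iff.2 rfl

/-- A homeomorphism that preserves the distances of trace points and multiplies phase differences
by `ε`. -/
structure PreservesForm (ε : ℝ) (g : SL2Cover ≃ₜ SL2Cover) : Prop where
  phase : ∀ X Y, phaseDiff (g X) (g Y) = ε * phaseDiff X Y
  sep : ∀ X Y, sep (g X) (g Y) = sep X Y

/-- With `(x⁰ + i x¹, x² - i x³)` as coordinates, row 1 of the matrix is `±i` times row 0 and row 3
is `∓i` times row 2, so the map is linear or antilinear. The quadratic relations say that it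
preserves the Hermitian form, up to conjugation when `ε = -1`. The factors `c` come from the
homogeneous coordinates. -/
theorem exists_herm_smul {g : SL2Cover ≃ₜ SL2Cover} (hg : IsIsometry g) :
    ∃ ε : ℝ, (ε = 1 ∨ ε = -1) ∧ ∃ c : SL2Cover → ℝ, (∀ X, 0 < c X) ∧ ∀ X Y,
      (herm (g X) (g Y)).re = c X * c Y * (herm X Y).re ∧
      (herm (g X) (g Y)).im = ε * (c X * c Y * (herm X Y).im) := by
  obtain ⟨a, ⟨⟨ε, hε, h10, h11, h12, h13, h30, h31, h32, h33⟩, hn0, hn2, hr, hi⟩, hl⟩ := hg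
  choose c hc hcg using hl
  refine ⟨ε, hε, c, hc, fun X Y => ?_⟩
  have hε2 : ε ^ 2 = 1 := by rcases hε with rfl | rfl <;> norm_num
  have key : ∀ X j, homCoord (g X) j = c X * (homCoord X 0 * a 0 j + homCoord X 1 * a 1 j +
      homCoord X 2 * a 2 j + homCoord X 3 * a 3 j) := by
    intro X j
    rw [hcg X, Pi.smul_apply, smul_eq_mul, Matrix.vecMul, dotProduct, Fin.sum_univ_four]
  rw [herm_re, herm_re, herm_im, herm_im]
  simp only [key, h10, h11, h12, h13, h30, h31, h32, h33]
  generalize homCoord X 0 = x0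
  generalize homCoord X 1 = x1
  generalize homCoord X 2 = x2
  generalize homCoord X 3 = x3
  generalize homCoord Y 0 = y0
  generalize homCoord Y 1 = y1
  generalize homCoord Y 2 = y2
  generalize homCoord Y 3 = y3
  generalize c X = cx
  generalize c Y = cy
  generalize a 0 0 = a0 at *
  generalize a 0 1 = a1 at *
  generalize a 0 2 = a2 at *
  generalize a 0 3 = a3 at *
  generalize a 2 0 = b0 at *
  generalize a 2 1 = b1 at *
  generalize a 2 2 = b2 at *
  generalize a 2 3 = b3 at *
  clear key hcg h10 h11 h12 h13 h30 h31 h32 h33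
  rcases hε with rfl | rfl
  · constructor
    · linear_combination cx * cy * (-(x0*y0+x1*y1)*hn0 - (x2*y2+x3*y3)*hn2
        - (x0*y2+x2*y0 - x1*y3-x3*y1)*hr - (x0*y3+x3*y0+x1*y2+x2*y1)*hi)
    · linear_combination cx * cy * (-(x1*y0-x0*y1)*hn0 + (x3*y2-x2*y3)*hn2
        - (x1*y2-x2*y1+x0*y3-x3*y0)*hr - (x1*y3 - x3*y1-x0*y2+x2*y0)*hi)
  · constructor
    · linear_combination cx * cy * (-(x0*y0+x1*y1)*hn0 - (x2*y2+x3*y3)*hn2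
        - (x0*y2+x2*y0 - x1*y3-x3*y1)*hr + (x0*y3+x3*y0+x1*y2+x2*y1)*hi)
    · linear_combination -cx * cy * (-(x1*y0-x0*y1)*hn0 + (x3*y2-x2*y3)*hn2
        - (x1*y2-x2*y1+x0*y3-x3*y0)*hr + (x1*y3 - x3*y1-x0*y2+x2*y0)*hi)

end SL2Cover

/-! ### Isometries preserve the invariants; rigidity. -/

namespace SL2Cover

open ComplexConjugate

instance : PreconnectedSpace (Metric.ball (0 : ℂ) 1) :=
  Subtype.preconnectedSpace (convex_ball (0 : ℂ) 1).isPreconnected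

/-- Comparing moduli of the Hermitian products gives `sep`, comparing arguments gives `phaseDiff`
modulo `2π`, and connectedness removes the ambiguity. -/
theorem exists_preservesForm {g : SL2Cover ≃ₜ SL2Cover} (hg : IsIsometry g) :
    ∃ ε : ℝ, (ε = 1 ∨ ε = -1) ∧ PreservesForm ε g := by
  obtain ⟨ε, hε, c, hc, hcg⟩ := exists_herm_smul hg
  have hε2 : ε * ε = 1 := by rcases hε with rfl | rfl <;> norm_num
  have hnsq : ∀ X Y, Complex.normSq (herm (g X) (g Y)) =
      (c X * c Y) ^ 2 * Complex.normSq (herm X Y) := by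
    intro X Y
    rw [Complex.normSq_apply, Complex.normSq_apply, (hcg X Y).1, (hcg X Y).2]
    linear_combination (c X * c Y * (herm X Y).im) ^ 2 * hε2
  refine ⟨ε, hε, ?_, ?_⟩
  · have hexp : ∀ X Y, Complex.exp (((phaseDiff (g X) (g Y) - ε * phaseDiff X Y : ℝ) : ℂ) *
        Complex.I) = 1 := by
      intro X Y
      have hpos : ∀ X Y : SL2Cover, 0 < ‖1 - conj (X.2 : ℂ) * (Y.2 : ℂ)‖ := fun X Y =>
        norm_pos_iff.2 fun h => by
          have := re_form_pos X Y
          rw [h] at this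
          simp at this
      have hn : ‖1 - conj ((g X).2 : ℂ) * ((g Y).2 : ℂ)‖ =
          c X * c Y * ‖1 - conj (X.2 : ℂ) * (Y.2 : ℂ)‖ := by
        have h := hnsq X Y
        rw [normSq_herm, normSq_herm, Complex.normSq_eq_norm_sq, Complex.normSq_eq_norm_sq,
          ← mul_pow] at h
        exact (pow_left_inj₀ (norm_nonneg _)
          (mul_pos (mul_pos (hc X) (hc Y)) (hpos X Y)).le two_ne_zero).1 h
      have h1 : herm (g X) (g Y) = (c X * c Y * ‖1 - conj (X.2 : ℂ) * (Y.2 : ℂ)‖ : ℝ) *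
          Complex.exp ((ε * phaseDiff X Y : ℝ) * Complex.I) := by
        have h2 := herm_eq_polar X Y
        have hre := congrArg Complex.re h2
        have him := congrArg Complex.im h2
        rw [Complex.re_ofReal_mul, Complex.exp_ofReal_mul_I_re] at hre
        rw [Complex.im_ofReal_mul, Complex.exp_ofReal_mul_I_im] at him
        apply Complex.ext
        · rw [(hcg X Y).1, hre, Complex.re_ofReal_mul, Complex.exp_ofReal_mul_I_re]
          rcases hε with rfl | rfl
          · rw [one_mul]; ring
          · rw [neg_one_mul, Real.cos_neg]; ring
        · rw [(hcg X Y).2, him, Complex.im_ofReal_mul, Complex.exp_ofReal_mul_I_im]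
          rcases hε with rfl | rfl
          · rw [one_mul, one_mul]; ring
          · rw [neg_one_mul, neg_one_mul, Real.sin_neg]; ring
      rw [herm_eq_polar, hn] at h1
      have h3 := mul_left_cancel₀ (Complex.ofReal_ne_zero.2
        (mul_pos (mul_pos (hc X) (hc Y)) (hpos X Y)).ne') h1
      rw [Complex.ofReal_sub, sub_mul, Complex.exp_sub, h3, div_self (Complex.exp_ne_zero _)]
    -- `F` has values in `2πℤ` and vanishes on the diagonal. If it were nonzero somewhere,
    -- connectedness would make it take one of the values `±π`, where the exponential is `-1`.
    let F : SL2Cover × SL2Cover → ℝ := fun Z =>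
      phaseDiff (g Z.1) (g Z.2) - ε * phaseDiff Z.1 Z.2
    have hF : Continuous F := by
      refine Continuous.sub ?_ (continuous_const.mul continuous_phaseDiff)
      exact continuous_phaseDiff.comp (f := fun Z : SL2Cover × SL2Cover => (g Z.1, g Z.2))
        (by fun_prop)
    have hnot : ∀ Z y, F Z = y → Complex.exp ((y : ℂ) * Complex.I) = 1 := by
      rintro Z y rfl
      exact hexp Z.1 Z.2
    intro X Y
    have h0 : F (X, X) = 0 := by simp [F, phaseDiff_self]
    have hk : F (X, Y) = 0 := by
      obtain ⟨n, hn⟩ := Complex.exp_eq_one_iff.1 (hexp X Y)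
      have hn' : F (X, Y) = n * (2 * Real.pi) := by
        have : ((F (X, Y) : ℝ) : ℂ) * Complex.I = ((n * (2 * Real.pi) : ℝ) : ℂ) * Complex.I := by
          rw [hn]; push_cast; ring
        exact_mod_cast mul_right_cancel₀ Complex.I_ne_zero this
      by_contra hne
      have hn0 : n ≠ 0 := by
        rintro rfl
        exact hne (by simpa using hn')
      rcases lt_or_gt_of_ne hn0 with hlt | hgt
      · have h4 : (n : ℝ) ≤ -1 := by exact_mod_cast Int.le_sub_one_of_lt hlt
        obtain ⟨Z, hZ⟩ := mem_range_of_exists_le_of_exists_ge hF (c := -Real.pi)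
          ⟨(X, Y), by rw [hn']; nlinarith [Real.pi_pos]⟩
          ⟨(X, X), by rw [h0]; linarith [Real.pi_pos]⟩
        have h5 := hnot Z _ hZ
        rw [Complex.ofReal_neg, neg_mul, Complex.exp_neg, Complex.exp_pi_mul_I] at h5
        norm_num at h5
      · have h4 : (1 : ℝ) ≤ n := by exact_mod_cast hgt
        obtain ⟨Z, hZ⟩ := mem_range_of_exists_le_of_exists_ge hF (c := Real.pi)
          ⟨(X, X), by rw [h0]; linarith [Real.pi_pos]⟩
          ⟨(X, Y), by rw [hn']; nlinarith [Real.pi_pos]⟩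
        have h5 := hnot Z _ hZ
        rw [Complex.exp_pi_mul_I] at h5
        norm_num at h5
    exact sub_eq_zero.1 hk
  · intro X Y
    have hself : ∀ X, 1 - Complex.normSq ((g X).2 : ℂ) =
        c X * c X * (1 - Complex.normSq (X.2 : ℂ)) := by
      intro X
      have h := (hcg X X).1
      rwa [herm_self, herm_self, Complex.ofReal_re, Complex.ofReal_re] at h
    have h := hnsq X Y
    rw [normSq_herm, normSq_herm] at h
    rw [sep, sep, hself, hself, h]
    have hX := hc X
    have hY := hc Y
    have h1 : 1 - Complex.normSq (X.2 : ℂ) ≠ 0 := by linarith [X.normSq_lt_one]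
    have h2 : 1 - Complex.normSq (Y.2 : ℂ) ≠ 0 := by linarith [Y.normSq_lt_one]
    field_simp

namespace PreservesForm

variable {ε ε' : ℝ} {g h : SL2Cover ≃ₜ SL2Cover}

theorem mul (hg : PreservesForm ε g) (hh : PreservesForm ε' h) :
    PreservesForm (ε * ε') (g * h) where
  phase X Y := by
    rw [mul_assoc, ← hh.phase, ← hg.phase]; rfl
  sep X Y := (hg.sep (h X) (h Y)).trans (hh.sep X Y)

theorem inv (hg : PreservesForm ε g) (hε : ε * ε = 1) : PreservesForm ε g⁻¹ where
  phase X Y := by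
    have h1 := hg.phase (g⁻¹ X) (g⁻¹ Y)
    have h2 : ∀ X, g (g⁻¹ X) = X := g.apply_symm_apply
    rw [h2, h2] at h1
    rw [h1, ← mul_assoc, hε, one_mul]
  sep X Y := by
    have h1 := hg.sep (g⁻¹ X) (g⁻¹ Y)
    have h2 : ∀ X, g (g⁻¹ X) = X := g.apply_symm_apply
    rw [h2, h2] at h1
    exact h1.symm

theorem snd_eq_iff (hg : PreservesForm ε g) {X Y : SL2Cover} :
    (g X).2 = (g Y).2 ↔ X.2 = Y.2 := by
  rw [← sep_eq_one_iff, ← sep_eq_one_iff, hg.sep]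

theorem fst_sub (hg : PreservesForm ε g) {X Y : SL2Cover} (h : X.2 = Y.2) :
    (g X).1 - (g Y).1 = ε * (X.1 - Y.1) := by
  rw [← phaseDiff_of_snd_eq h, ← hg.phase, phaseDiff_of_snd_eq (hg.snd_eq_iff.2 h)]

/-- On a single fibre the phase difference is the difference of heights, so the action there is
affine with slope `ε`. -/
theorem apply_mk (hg : PreservesForm ε g) (s : ℝ) (w : Metric.ball (0 : ℂ) 1) :
    g (s, w) = (ε * s + (g (0, w)).1, (g (0, w)).2) := by
  have h1 := hg.fst_sub (X := (s, w)) (Y := (0, w)) rfl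
  have h2 := (hg.snd_eq_iff (X := (s, w)) (Y := (0, w))).2 rfl
  refine Prod.ext ?_ h2
  simp only at h1 ⊢
  linarith

/-- The phase difference fixes the argument of the Hermitian product and `sep` its modulus relative
to the self-products, whose ratio is `c ^ 2`. -/
theorem herm_smul {c : ℝ} {X Z Z' : SL2Cover} (hp : phaseDiff Z' X = phaseDiff Z X)
    (hs : SL2Cover.sep Z' X = SL2Cover.sep Z X) (hc : 0 < c)
    (hcs : c ^ 2 * (1 - Complex.normSq (Z.2 : ℂ)) = 1 - Complex.normSq (Z'.2 : ℂ)) :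
    herm Z' X = c * herm Z X := by
  have h1 : 0 < 1 - Complex.normSq (X.2 : ℂ) := by linarith [X.normSq_lt_one]
  have h2 : 0 < 1 - Complex.normSq (Z.2 : ℂ) := by linarith [Z.normSq_lt_one]
  have h3 : 0 < 1 - Complex.normSq (Z'.2 : ℂ) := by linarith [Z'.normSq_lt_one]
  rw [SL2Cover.sep, SL2Cover.sep, div_eq_div_iff (by positivity) (by positivity), ← hcs] at hs
  have h4 : Complex.normSq (1 - conj (Z'.2 : ℂ) * (X.2 : ℂ)) =
      c ^ 2 * Complex.normSq (1 - conj (Z.2 : ℂ) * (X.2 : ℂ)) := by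
    have h5 : (1 - Complex.normSq (Z.2 : ℂ)) * (1 - Complex.normSq (X.2 : ℂ)) ≠ 0 := by positivity
    apply mul_right_cancel₀ h5
    linear_combination hs
  rw [Complex.normSq_eq_norm_sq, Complex.normSq_eq_norm_sq, ← mul_pow] at h4
  have h6 := (pow_left_inj₀ (norm_nonneg _) (by positivity) two_ne_zero).1 h4
  rw [herm_eq_polar, herm_eq_polar, hp, h6]
  push_cast
  ring

/-- A fibre-direction preserving isometry that fixes two points of different fibres is trivial. -/
theorem eq_one (hg : PreservesForm 1 g) {X Y : SL2Cover} (hX : g X = X) (hY : g Y = Y)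
    (hXY : X.2 ≠ Y.2) : g = 1 := by
  ext1 Z
  change g Z = Z
  have hpX := hg.phase Z X
  have hpY := hg.phase Z Y
  have hsX := hg.sep Z X
  have hsY := hg.sep Z Y
  rw [hX, one_mul] at hpX
  rw [hY, one_mul] at hpY
  rw [hX] at hsX
  rw [hY] at hsY
  generalize g Z = Z' at *
  have h2 : 0 < 1 - Complex.normSq (Z.2 : ℂ) := by linarith [Z.normSq_lt_one]
  have h3 : 0 < 1 - Complex.normSq (Z'.2 : ℂ) := by linarith [Z'.normSq_lt_one]
  obtain ⟨c, hc, hcs⟩ : ∃ c : ℝ, 0 < c ∧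
      c ^ 2 * (1 - Complex.normSq (Z.2 : ℂ)) = 1 - Complex.normSq (Z'.2 : ℂ) := by
    refine ⟨√((1 - Complex.normSq (Z'.2 : ℂ)) / (1 - Complex.normSq (Z.2 : ℂ))),
      Real.sqrt_pos.2 (div_pos h3 h2), ?_⟩
    rw [Real.sq_sqrt (div_pos h3 h2).le]
    field_simp
  have eX := herm_smul hpX hsX hc hcs
  have eY := herm_smul hpY hsY hc hcs
  have hexp : ∀ U V : SL2Cover, herm U V = Complex.exp (((U.1 : ℝ) : ℂ) * Complex.I) *
      (1 - conj (U.2 : ℂ) * (V.2 : ℂ)) * Complex.exp (-(((V.1 : ℝ) : ℂ) * Complex.I)) := by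
    intro U V
    rw [herm, Complex.ofReal_sub, sub_mul, Complex.exp_sub, Complex.exp_neg]
    ring
  rw [hexp, hexp Z, ← mul_assoc] at eX eY
  replace eX := mul_right_cancel₀ (Complex.exp_ne_zero _) eX
  replace eY := mul_right_cancel₀ (Complex.exp_ne_zero _) eY
  have hE := Complex.exp_ne_zero (((Z'.1 : ℝ) : ℂ) * Complex.I)
  have hnE := Complex.norm_exp_ofReal_mul_I Z'.1
  have hnF := Complex.norm_exp_ofReal_mul_I Z.1
  generalize Complex.exp (((Z'.1 : ℝ) : ℂ) * Complex.I) = E at *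
  generalize Complex.exp (((Z.1 : ℝ) : ℂ) * Complex.I) = F at *
  have hxy : (X.2 : ℂ) - Y.2 ≠ 0 := sub_ne_zero.2 fun h => hXY (Subtype.ext h)
  -- `eX` and `eY` test the vectors of `Z'` and `Z` against those of `X` and `Y`, which span the
  -- plane because the trace points differ. So one vector is `c` times the other, and `c = 1` since
  -- the first entries are unimodular.
  have h4 : E * conj (Z'.2 : ℂ) = c * F * conj (Z.2 : ℂ) := by
    apply mul_right_cancel₀ hxy
    linear_combination eY - eX
  have h5 : E = c * F := by linear_combination eX + (X.2 : ℂ) * h4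
  have h6 : (c : ℝ) = 1 := by
    have := congrArg norm h5
    rw [norm_mul, hnE, hnF, mul_one, Complex.norm_real, Real.norm_of_nonneg hc.le] at this
    exact this.symm
  have h7 : Z'.2 = Z.2 := by
    rw [← h5] at h4
    exact Subtype.ext ((starRingEnd ℂ).injective (mul_left_cancel₀ hE h4))
  -- The exponentials give the height only modulo `2π`; the phase difference to `X` gives it
  -- exactly.
  refine Prod.ext ?_ h7
  rw [phaseDiff, phaseDiff, h7] at hpX
  linarith

end PreservesForm

end SL2Cover

/-! ### The side curves as graphs over the chord. -/

namespace SL2Cover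

open ComplexConjugate

theorem sin_pi_div_pos {p : ℕ} (hp : 3 ≤ p) : 0 < Real.sin (Real.pi / p) := by
  have h3 : (3 : ℝ) ≤ p := by exact_mod_cast hp
  apply Real.sin_pos_of_pos_of_lt_pi (by positivity)
  rw [div_lt_iff₀ (by linarith)]
  nlinarith [Real.pi_pos]

theorem cos_pi_div_pos {p : ℕ} (hp : 3 ≤ p) : 0 < Real.cos (Real.pi / p) := by
  have h3 : (3 : ℝ) ≤ p := by exact_mod_cast hp
  have : 0 < Real.pi / p := by positivity
  apply Real.cos_pos_of_mem_Ioo ⟨by linarith [Real.pi_pos], ?_⟩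
  rw [div_lt_div_iff₀ (by linarith) (by norm_num)]
  nlinarith [Real.pi_pos]

/-- Modulo `p` the index lies between `1` and `p - 1`, and on `[π/p, π - π/p]` the sine is smallest
at the ends. -/
theorem sin_pi_div_le_abs_sin {p : ℕ} (hp : 3 ≤ p) (k : ℤ)
    (hk : Real.sin (Real.pi * k / p) ≠ 0) :
    Real.sin (Real.pi / p) ≤ |Real.sin (Real.pi * k / p)| := by
  have hp0 : (0 : ℝ) < p := by exact_mod_cast (by omega : 0 < p)
  have hpz : (0 : ℤ) < p := by omega
  obtain ⟨r, n, hr0, hrp, hkr⟩ : ∃ r n : ℤ, 0 ≤ r ∧ r < p ∧ k = r + n * p :=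
    ⟨k % p, k / p, Int.emod_nonneg _ hpz.ne', Int.emod_lt_of_pos _ hpz, by
      rw [mul_comm]; exact (Int.emod_add_mul_ediv k p).symm⟩
  have h1 : Real.pi * k / p = Real.pi * r / p + n * Real.pi := by
    rw [hkr]; push_cast; field_simp
  rw [h1] at hk ⊢
  rw [Real.sin_add_int_mul_pi] at hk ⊢
  have hn : |((-1 : ℝ) ^ n)| = 1 := by rw [abs_zpow]; simp
  rw [abs_mul, hn, one_mul]
  have hr1 : 1 ≤ r := by
    rcases hr0.eq_or_lt with h | h
    · rw [← h] at hk; simp at hk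
    · omega
  have e1 : (1 : ℝ) ≤ r := by exact_mod_cast hr1
  have e2 : (r : ℝ) ≤ p - 1 := by
    have : r ≤ p - 1 := by omega
    exact_mod_cast this
  have hpi := Real.pi_pos
  refine le_trans ?_ (le_abs_self _)
  by_cases hh : (r : ℝ) ≤ p / 2
  · apply Real.sin_le_sin_of_le_of_le_pi_div_two
    · have : 0 < Real.pi / p := by positivity
      linarith
    · rw [div_le_div_iff₀ hp0 (by norm_num)]
      nlinarith
    · rw [div_le_div_iff_of_pos_right hp0]
      nlinarith
  · rw [← Real.sin_pi_sub (Real.pi * r / p)]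
    have h4 : Real.pi - Real.pi * r / p = Real.pi * (p - r) / p := by field_simp
    rw [h4]
    push Not at hh
    apply Real.sin_le_sin_of_le_of_le_pi_div_two
    · have : 0 < Real.pi / p := by positivity
      linarith
    · rw [div_le_div_iff₀ hp0 (by norm_num)]
      nlinarith
    · rw [div_le_div_iff_of_pos_right hp0]
      nlinarith

/-- The coordinate of `w` in the direction bisecting those of the vertices `A₀` and `A₁`. -/
noncomputable def radial (p : ℕ) (w : ℂ) : ℝ :=
  w.re * Real.sin (Real.pi / p) + w.im * Real.cos (Real.pi / p)

/-- The coordinate of `w` in the direction from the vertex `A₀` to the vertex `A₁`. -/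
noncomputable def tangential (p : ℕ) (w : ℂ) : ℝ :=
  w.re * Real.cos (Real.pi / p) - w.im * Real.sin (Real.pi / p)

/-- The point of the plane with given radial and tangential coordinates. -/
noncomputable def ofCoords (p : ℕ) (x s : ℝ) : ℂ :=
  ⟨x * Real.sin (Real.pi / p) + s * Real.cos (Real.pi / p),
    x * Real.cos (Real.pi / p) - s * Real.sin (Real.pi / p)⟩

variable {p : ℕ}

theorem radial_ofCoords (x s : ℝ) : radial p (ofCoords p x s) = x := by
  simp only [radial, ofCoords]
  linear_combination x * Real.sin_sq_add_cos_sq (Real.pi / p)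

theorem tangential_ofCoords (x s : ℝ) : tangential p (ofCoords p x s) = s := by
  simp only [tangential, ofCoords]
  linear_combination s * Real.sin_sq_add_cos_sq (Real.pi / p)

theorem ofCoords_radial_tangential (w : ℂ) :
    ofCoords p (radial p w) (tangential p w) = w := by
  apply Complex.ext
  · simp only [radial, tangential, ofCoords]
    linear_combination w.re * Real.sin_sq_add_cos_sq (Real.pi / p)
  · simp only [radial, tangential, ofCoords]
    linear_combination w.im * Real.sin_sq_add_cos_sq (Real.pi / p)

theorem normSq_eq_coords (p : ℕ) (w : ℂ) :
    Complex.normSq w = radial p w ^ 2 + tangential p w ^ 2 := by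
  simp only [radial, tangential, Complex.normSq_apply]
  linear_combination -(w.re ^ 2 + w.im ^ 2) * Real.sin_sq_add_cos_sq (Real.pi / p)

theorem coords_ext {w z : ℂ} (h1 : radial p w = radial p z) (h2 : tangential p w = tangential p z) :
    w = z := by
  rw [← ofCoords_radial_tangential (p := p) w, h1, h2, ofCoords_radial_tangential]

theorem continuous_radial : Continuous (radial p) := by
  unfold radial; fun_prop

theorem continuous_tangential : Continuous (tangential p) := by
  unfold tangential; fun_prop

/-- In the sector spanned by `A₀` and `A₁` the coordinate along the bisector of this sector is the
largest among those along all `p` bisectors. So inside the sector only the side form with index `0`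
needs checking. -/
theorem sector_dominant (hp : 3 ≤ p) {x s : ℝ}
    (h : |s| * Real.cos (Real.pi / p) ≤ x * Real.sin (Real.pi / p)) (k : ℤ) :
    x * Real.cos (2 * Real.pi * k / p) + s * Real.sin (2 * Real.pi * k / p) ≤ x := by
  have hs := sin_pi_div_pos hp
  have hc := cos_pi_div_pos hp
  have h2 : 2 * Real.pi * k / p = 2 * (Real.pi * k / p) := by ring
  rw [h2, Real.cos_two_mul, Real.sin_two_mul]
  have hle := sin_pi_div_le_abs_sin hp k
  generalize Real.pi * k / p = γ at *
  have hγ := Real.sin_sq_add_cos_sq γ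
  have hα := Real.sin_sq_add_cos_sq (Real.pi / p)
  generalize Real.sin (Real.pi / p) = sn at *
  generalize Real.cos (Real.pi / p) = c at *
  generalize Real.sin γ = S at *
  generalize Real.cos γ = C at *
  by_cases hS : S = 0
  · have : C ^ 2 = 1 := by rw [hS] at hγ; linarith
    rw [this, hS]
    linarith
  · have h3 := hle hS
    have hC : |C| ≤ c := by
      apply abs_le_of_sq_le_sq' _ hc.le |> abs_le.2
      have : sn ^ 2 ≤ S ^ 2 := by rw [← sq_abs S]; exact pow_le_pow_left₀ hs.le h3 2
      linarith
    have hx : 0 ≤ x := by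
      by_contra hx
      nlinarith [abs_nonneg s]
    have h4 : |s| * |C| ≤ x * |S| := by
      calc |s| * |C| ≤ |s| * c := by gcongr
        _ ≤ x * sn := h
        _ ≤ x * |S| := by gcongr
    have h5 : s * C * S ≤ x * S ^ 2 := by
      calc s * C * S ≤ |s * C * S| := le_abs_self _
        _ = |s| * |C| * |S| := by rw [abs_mul, abs_mul]
        _ ≤ x * |S| * |S| := by gcongr
        _ = x * S ^ 2 := by rw [mul_assoc, ← sq, sq_abs]
    nlinarith

namespace RegularShape

variable (S : RegularShape p)

theorem sideForm_eq (k : ℤ) (w : ℂ) : S.sideForm k w =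
    S.m * (Complex.normSq w - S.ρ ^ 2) + (radial p w * Real.cos (2 * Real.pi * k / p) +
      tangential p w * Real.sin (2 * Real.pi * k / p)) - S.ρ * Real.cos (Real.pi / p) := by
  have h : 2 * Real.pi * (k + 1 / 2) / p = Real.pi / p + 2 * Real.pi * k / p := by ring
  rw [sideForm, h, Real.sin_add, Real.cos_add, Complex.normSq_eq_norm_sq, radial, tangential]
  ring

theorem sideForm_zero_eq (w : ℂ) : S.sideForm 0 w =
    S.m * (Complex.normSq w - S.ρ ^ 2) + radial p w - S.ρ * Real.cos (Real.pi / p) := by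
  rw [sideForm_eq]; simp

theorem norm_le_iff (w : ℂ) : ‖w‖ ≤ S.ρ ↔ radial p w ^ 2 + tangential p w ^ 2 ≤ S.ρ ^ 2 := by
  rw [← normSq_eq_coords, Complex.normSq_eq_norm_sq]
  exact (pow_le_pow_iff_left₀ (norm_nonneg _) S.ρ_pos.le two_ne_zero).symm

theorem m_mul_gt : -Real.cos (Real.pi / p) < 2 * S.ρ * S.m := by
  have h := S.m_gt
  rw [← neg_div, div_lt_iff₀ (by linarith [S.ρ_pos])] at h
  linarith

theorem mem_baseFigure_of_sector (hp : 3 ≤ p) {w : ℂ} (hw : ‖w‖ ≤ S.ρ)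
    (h : |tangential p w| * Real.cos (Real.pi / p) ≤ radial p w * Real.sin (Real.pi / p))
    (h0 : S.sideForm 0 w ≤ 0) : w ∈ S.baseFigure := by
  refine ⟨hw, fun k => le_trans ?_ h0⟩
  rw [sideForm_eq, sideForm_zero_eq]
  linarith [sector_dominant hp h k]

/-- Where the form with index `0` vanishes, the inequalities for the neighbouring sides `±1` amount
to the sector condition; the converse is `sector_dominant`. -/
theorem mem_sideCurve_zero_iff (hp : 3 ≤ p) {w : ℂ} : w ∈ S.sideCurve 0 ↔ ‖w‖ ≤ S.ρ ∧
    |tangential p w| * Real.cos (Real.pi / p) ≤ radial p w * Real.sin (Real.pi / p) ∧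
    S.sideForm 0 w = 0 := by
  constructor
  · rintro ⟨⟨h1, h2⟩, h3⟩
    refine ⟨h1, ?_, h3⟩
    have hs := sin_pi_div_pos hp
    have ha := h2 1
    have hb := h2 (-1)
    rw [sideForm_zero_eq] at h3
    have e1 : 2 * Real.pi * ((1 : ℤ) : ℝ) / p = 2 * (Real.pi / p) := by push_cast; ring
    have e2 : 2 * Real.pi * ((-1 : ℤ) : ℝ) / p = -(2 * (Real.pi / p)) := by push_cast; ring
    rw [sideForm_eq, e1, Real.cos_two_mul, Real.sin_two_mul] at ha
    rw [sideForm_eq, e2, Real.cos_neg, Real.sin_neg, Real.cos_two_mul, Real.sin_two_mul] at hb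
    have hα := Real.sin_sq_add_cos_sq (Real.pi / p)
    have hc2 : 2 * Real.cos (Real.pi / p) ^ 2 - 1 = 1 - 2 * Real.sin (Real.pi / p) ^ 2 := by
      linarith
    rw [hc2] at ha hb
    have : |tangential p w * Real.cos (Real.pi / p)| ≤ radial p w * Real.sin (Real.pi / p) := by
      apply abs_le.2
      constructor
      · have : 0 ≤ Real.sin (Real.pi / p) * (radial p w * Real.sin (Real.pi / p) +
          tangential p w * Real.cos (Real.pi / p)) := by nlinarith
        have := nonneg_of_mul_nonneg_right this hs
        linarith
      · have : 0 ≤ Real.sin (Real.pi / p) * (radial p w * Real.sin (Real.pi / p) -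
          tangential p w * Real.cos (Real.pi / p)) := by nlinarith
        have := nonneg_of_mul_nonneg_right this hs
        linarith
    rwa [abs_mul, abs_of_pos (cos_pi_div_pos hp)] at this
  · rintro ⟨h1, h2, h3⟩
    exact ⟨S.mem_baseFigure_of_sector hp h1 h2 h3.le, h3⟩

theorem radial_nonneg_of_sector (hp : 3 ≤ p) {x s : ℝ}
    (h : |s| * Real.cos (Real.pi / p) ≤ x * Real.sin (Real.pi / p)) : 0 ≤ x := by
  have hs := sin_pi_div_pos hp
  have hc := cos_pi_div_pos hp
  by_contra hx
  nlinarith [abs_nonneg s]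

/-- The number is the difference quotient of the side form in the radial direction. Its positivity,
a consequence of `m_gt`, makes the side curve a graph over the tangential coordinate. -/
theorem one_add_m_mul_pos {x x' : ℝ} (hx : 0 ≤ x) (hx' : 0 ≤ x')
    (h : x ≤ S.ρ) (h' : x' ≤ S.ρ) : 0 < S.m * (x + x') + 1 := by
  have h1 := S.m_mul_gt
  have h2 := Real.cos_le_one (Real.pi / p)
  by_cases hm : 0 ≤ S.m
  · positivity
  · nlinarith

theorem radial_le {w : ℂ} (hw : ‖w‖ ≤ S.ρ) : radial p w ≤ S.ρ := by
  rw [norm_le_iff] at hw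
  exact abs_le_of_sq_le_sq' (by nlinarith [sq_nonneg (tangential p w)]) S.ρ_pos.le |>.2

theorem tangential_injOn (hp : 3 ≤ p) : Set.InjOn (tangential p) (S.sideCurve 0) := by
  intro w hw z hz h
  obtain ⟨a1, a2, a3⟩ := (S.mem_sideCurve_zero_iff hp).1 hw
  obtain ⟨b1, b2, b3⟩ := (S.mem_sideCurve_zero_iff hp).1 hz
  refine coords_ext (p := p) ?_ h
  have hpos := S.one_add_m_mul_pos (radial_nonneg_of_sector hp a2)
    (radial_nonneg_of_sector hp b2) (S.radial_le a1) (S.radial_le b1)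
  rw [sideForm_zero_eq, normSq_eq_coords p] at a3 b3
  have : (S.m * (radial p w + radial p z) + 1) * (radial p w - radial p z) = 0 := by
    rw [h] at a3
    linear_combination a3 - b3
  rcases mul_eq_zero.1 this with h | h <;> linarith

theorem tangential_mapsTo (hp : 3 ≤ p) : Set.MapsTo (tangential p) (S.sideCurve 0)
    (Set.Icc (-(S.ρ * Real.sin (Real.pi / p))) (S.ρ * Real.sin (Real.pi / p))) := by
  intro w hw
  obtain ⟨a1, a2, -⟩ := (S.mem_sideCurve_zero_iff hp).1 hw
  have hs := sin_pi_div_pos hp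
  have hc := cos_pi_div_pos hp
  have hα := Real.sin_sq_add_cos_sq (Real.pi / p)
  apply abs_le.1
  rw [norm_le_iff] at a1
  have hx := radial_nonneg_of_sector hp a2
  apply abs_le_of_sq_le_sq _ (mul_pos S.ρ_pos hs).le
  have h1 : (|tangential p w| * Real.cos (Real.pi / p)) ^ 2 ≤
      (radial p w * Real.sin (Real.pi / p)) ^ 2 := pow_le_pow_left₀ (by positivity) a2 2
  rw [mul_pow, mul_pow, sq_abs] at h1
  nlinarith [sq_nonneg (Real.sin (Real.pi / p))]

theorem tangential_surjOn (hp : 3 ≤ p) : Set.SurjOn (tangential p) (S.sideCurve 0)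
    (Set.Icc (-(S.ρ * Real.sin (Real.pi / p))) (S.ρ * Real.sin (Real.pi / p))) := by
  intro s hs
  have hsn := sin_pi_div_pos hp
  have hc := cos_pi_div_pos hp
  have hα := Real.sin_sq_add_cos_sq (Real.pi / p)
  have hρ := S.ρ_pos
  have hm := S.m_mul_gt
  have hs' := abs_le.2 hs
  set sn := Real.sin (Real.pi / p) with hsn_def
  set c := Real.cos (Real.pi / p) with hc_def
  -- At tangential coordinate `s`, the edge ray of the sector is at distance `r` from the origin and
  -- has radial coordinate `r * c`; the circle `|w| = ρ` has radial coordinate `X`. The side form is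
  -- nonpositive at the first point and nonnegative at the second, so it vanishes in between, inside
  -- sector and disc.
  set r := |s| / sn with hr
  have hr0 : 0 ≤ r := by positivity
  have hrs : |s| = r * sn := by rw [hr]; field_simp
  have hrρ : r ≤ S.ρ := by rw [hr, div_le_iff₀ hsn]; exact hs'
  have hs2 : s ^ 2 = r ^ 2 * sn ^ 2 := by rw [← sq_abs, hrs]; ring
  have hpos : 0 ≤ S.ρ ^ 2 - s ^ 2 := by rw [hs2]; nlinarith [sq_nonneg sn, sq_nonneg c]
  set X := √(S.ρ ^ 2 - s ^ 2) with hX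
  have hX2 : X ^ 2 = S.ρ ^ 2 - s ^ 2 := Real.sq_sqrt hpos
  have hX0 : 0 ≤ X := Real.sqrt_nonneg _
  have hle : r * c ≤ X := by
    apply Real.le_sqrt_of_sq_le
    rw [hs2]; nlinarith
  have hXc : S.ρ * c ≤ X := by
    apply Real.le_sqrt_of_sq_le
    have h1 : r ^ 2 * sn ^ 2 ≤ S.ρ ^ 2 * sn ^ 2 :=
      mul_le_mul_of_nonneg_right (pow_le_pow_left₀ hr0 hrρ 2) (sq_nonneg sn)
    rw [hs2]
    linear_combination h1 + S.ρ ^ 2 * hα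
  let f : ℝ → ℝ := fun x => S.m * (x ^ 2 + s ^ 2 - S.ρ ^ 2) + x - S.ρ * c
  have hf : ContinuousOn f (Set.Icc (r * c) X) := by fun_prop
  have hlow : f (r * c) ≤ 0 := by
    have : f (r * c) = (r - S.ρ) * (S.m * (r + S.ρ) + c) := by
      simp only [f]; rw [hs2]; linear_combination S.m * r ^ 2 * hα
    rw [this]
    apply mul_nonpos_of_nonpos_of_nonneg (by linarith)
    by_cases hmm : 0 ≤ S.m
    · positivity
    · nlinarith
  have hhigh : 0 ≤ f X := by
    simp only [f]; rw [hX2]; linarith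
  obtain ⟨x, ⟨hx1, hx2⟩, hx⟩ := intermediate_value_Icc hle hf ⟨hlow, hhigh⟩
  refine ⟨ofCoords p x s, ?_, tangential_ofCoords x s⟩
  rw [S.mem_sideCurve_zero_iff hp, norm_le_iff, sideForm_zero_eq, normSq_eq_coords p,
    radial_ofCoords, tangential_ofCoords]
  refine ⟨?_, ?_, hx⟩
  · have : 0 ≤ x := le_trans (by positivity) hx1
    nlinarith
  · rw [hrs]
    nlinarith

end RegularShape

end SL2Cover

/-! ### Symmetries of the prism and rigidity of its side faces. -/

namespace SL2Cover

open ComplexConjugate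

/-- The homeomorphism of the disc induced by a linear isometry. -/
noncomputable def ballIsometry (E : ℂ ≃ₗᵢ[ℝ] ℂ) :
    Metric.ball (0 : ℂ) 1 ≃ₜ Metric.ball (0 : ℂ) 1 where
  toFun z := ⟨E z, by rw [mem_ball_zero_iff, E.norm_map]; exact mem_ball_zero_iff.1 z.2⟩
  invFun z := ⟨E.symm z, by rw [mem_ball_zero_iff, E.symm.norm_map]; exact mem_ball_zero_iff.1 z.2⟩
  left_inv z := Subtype.ext (E.symm_apply_apply _)
  right_inv z := Subtype.ext (E.apply_symm_apply _)
  continuous_toFun := by fun_prop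
  continuous_invFun := by fun_prop

/-- The rotation of the plane that takes `A_j` to `A_{j+k}`. -/
noncomputable def planeRotation (p : ℕ) (k : ℤ) : ℂ ≃ₗᵢ[ℝ] ℂ :=
  rotation (Circle.exp (-(2 * Real.pi * k / p)))

/-- The reflection of the plane that interchanges `A₀` and `A₁`. -/
noncomputable def planeReflection (p : ℕ) : ℂ ≃ₗᵢ[ℝ] ℂ :=
  Complex.conjLIE.trans (rotation (Circle.exp (Real.pi - 2 * (Real.pi / p))))

/-- The rotation about the fibre through the origin that takes `A_j` to `A_{j+k}`. -/
noncomputable def prismRotation (p : ℕ) (k : ℤ) : SL2Cover ≃ₜ SL2Cover :=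
  (Homeomorph.refl ℝ).prodCongr (ballIsometry (planeRotation p k))

/-- The half-turn that interchanges `A₀` and `A₁` and the covers of a prism of height `t`. -/
noncomputable def prismFlip (p : ℕ) (t : ℝ) : SL2Cover ≃ₜ SL2Cover :=
  (Homeomorph.subLeft t).prodCongr (ballIsometry (planeReflection p))

variable {p : ℕ}

theorem radial_planeRotation (k : ℤ) (w : ℂ) : radial p (planeRotation p k w) =
    radial p w * Real.cos (2 * Real.pi * k / p) - tangential p w * Real.sin (2 * Real.pi * k / p) := by
  simp only [planeRotation, rotation_apply, Circle.coe_exp, radial, tangential, Complex.mul_re,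
    Complex.mul_im, Complex.exp_ofReal_mul_I_re, Complex.exp_ofReal_mul_I_im, Real.cos_neg,
    Real.sin_neg]
  ring

theorem tangential_planeRotation (k : ℤ) (w : ℂ) : tangential p (planeRotation p k w) =
    tangential p w * Real.cos (2 * Real.pi * k / p) + radial p w * Real.sin (2 * Real.pi * k / p) := by
  simp only [planeRotation, rotation_apply, Circle.coe_exp, radial, tangential, Complex.mul_re,
    Complex.mul_im, Complex.exp_ofReal_mul_I_re, Complex.exp_ofReal_mul_I_im, Real.cos_neg,
    Real.sin_neg]
  ring

theorem radial_planeReflection (w : ℂ) : radial p (planeReflection p w) = radial p w := by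
  simp only [planeReflection, LinearIsometryEquiv.trans_apply, Complex.conjLIE_apply,
    rotation_apply, Circle.coe_exp, radial, Complex.mul_re,
    Complex.mul_im, Complex.exp_ofReal_mul_I_re, Complex.exp_ofReal_mul_I_im, Real.cos_pi_sub,
    Real.sin_pi_sub, Complex.conj_re, Complex.conj_im, Real.cos_two_mul, Real.sin_two_mul]
  have h := Real.sin_sq_add_cos_sq (Real.pi / p)
  linear_combination (2 * w.im * Real.cos (Real.pi / p)) * h

theorem tangential_planeReflection (w : ℂ) :
    tangential p (planeReflection p w) = -tangential p w := by
  simp only [planeReflection, LinearIsometryEquiv.trans_apply, Complex.conjLIE_apply,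
    rotation_apply, Circle.coe_exp, tangential, Complex.mul_re,
    Complex.mul_im, Complex.exp_ofReal_mul_I_re, Complex.exp_ofReal_mul_I_im, Real.cos_pi_sub,
    Real.sin_pi_sub, Complex.conj_re, Complex.conj_im, Real.cos_two_mul, Real.sin_two_mul]
  have h := Real.sin_sq_add_cos_sq (Real.pi / p)
  linear_combination (-2 * w.re * Real.cos (Real.pi / p)) * h

theorem preservesForm_prismRotation (k : ℤ) : PreservesForm 1 (prismRotation p k) := by
  have h : ∀ X Y : SL2Cover, 1 - conj ((prismRotation p k X).2 : ℂ) * ((prismRotation p k Y).2 : ℂ)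
      = 1 - conj (X.2 : ℂ) * (Y.2 : ℂ) := by
    intro X Y
    change 1 - conj (planeRotation p k X.2) * planeRotation p k Y.2 = _
    simp only [planeRotation, rotation_apply, map_mul]
    rw [mul_mul_mul_comm, ← Complex.normSq_eq_conj_mul_self, Circle.normSq_coe]
    simp
  have h2 : ∀ X : SL2Cover, Complex.normSq ((prismRotation p k X).2 : ℂ) =
      Complex.normSq (X.2 : ℂ) := by
    intro X
    change Complex.normSq (planeRotation p k X.2) = _
    rw [Complex.normSq_eq_norm_sq, LinearIsometryEquiv.norm_map, Complex.normSq_eq_norm_sq]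
  constructor
  · intro X Y
    rw [phaseDiff, h, one_mul]
    rfl
  · intro X Y
    rw [sep, h, h2, h2]
    rfl

/-- The plane reflection conjugates the form and so negates its argument, in step with the reversal
of heights. -/
theorem preservesForm_prismFlip (t : ℝ) : PreservesForm (-1) (prismFlip p t) := by
  have h : ∀ X Y : SL2Cover, 1 - conj ((prismFlip p t X).2 : ℂ) * ((prismFlip p t Y).2 : ℂ)
      = conj (1 - conj (X.2 : ℂ) * (Y.2 : ℂ)) := by
    intro X Y
    change 1 - conj (planeReflection p X.2) * planeReflection p Y.2 = _
    simp only [planeReflection, LinearIsometryEquiv.trans_apply, Complex.conjLIE_apply,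
      rotation_apply, map_mul, map_sub, map_one, Complex.conj_conj]
    rw [mul_mul_mul_comm, ← Complex.normSq_eq_conj_mul_self, Circle.normSq_coe]
    simp
  have h2 : ∀ X : SL2Cover, Complex.normSq ((prismFlip p t X).2 : ℂ) =
      Complex.normSq (X.2 : ℂ) := by
    intro X
    change Complex.normSq (planeReflection p X.2) = _
    rw [Complex.normSq_eq_norm_sq, LinearIsometryEquiv.norm_map, Complex.normSq_eq_norm_sq]
  constructor
  · intro X Y
    have h3 : Complex.arg (1 - conj (X.2 : ℂ) * (Y.2 : ℂ)) ≠ Real.pi := by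
      intro h3
      have h4 := Complex.abs_arg_lt_pi_div_two_iff.2 (Or.inl (re_form_pos X Y))
      rw [h3, abs_of_pos Real.pi_pos] at h4
      linarith [Real.pi_pos]
    rw [phaseDiff, h, Complex.arg_conj, if_neg h3, phaseDiff]
    change t - X.1 - (t - Y.1) + _ = _
    ring
  · intro X Y
    rw [sep, h, h2, h2, Complex.normSq_conj]
    rfl

theorem image_eq_of_mem_iff {g : SL2Cover ≃ₜ SL2Cover} {A A' : Set SL2Cover}
    (h : ∀ X, g X ∈ A' ↔ X ∈ A) : g '' A = A' := by
  ext Y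
  constructor
  · rintro ⟨X, hX, rfl⟩
    exact (h X).2 hX
  · intro hY
    exact ⟨g.symm Y, (h _).1 (by rwa [g.apply_symm_apply]), g.apply_symm_apply Y⟩

namespace RegularShape

variable (S : RegularShape p)

theorem sideForm_planeRotation (k j : ℤ) (w : ℂ) :
    S.sideForm j (planeRotation p k w) = S.sideForm (j - k) w := by
  have h : 2 * Real.pi * ((j - k : ℤ) : ℝ) / p = 2 * Real.pi * j / p - 2 * Real.pi * k / p := by
    push_cast; ring
  rw [sideForm_eq, sideForm_eq, radial_planeRotation, tangential_planeRotation, h, Real.cos_sub,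
    Real.sin_sub, Complex.normSq_eq_norm_sq, LinearIsometryEquiv.norm_map,
    ← Complex.normSq_eq_norm_sq]
  ring

theorem sideForm_planeReflection (j : ℤ) (w : ℂ) :
    S.sideForm j (planeReflection p w) = S.sideForm (-j) w := by
  have h : 2 * Real.pi * ((-j : ℤ) : ℝ) / p = -(2 * Real.pi * j / p) := by
    push_cast; ring
  rw [sideForm_eq, sideForm_eq, radial_planeReflection, tangential_planeReflection, h,
    Real.cos_neg, Real.sin_neg, Complex.normSq_eq_norm_sq, LinearIsometryEquiv.norm_map,
    ← Complex.normSq_eq_norm_sq]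
  ring

theorem planeRotation_mem_baseFigure (k : ℤ) (w : ℂ) :
    planeRotation p k w ∈ S.baseFigure ↔ w ∈ S.baseFigure := by
  simp only [baseFigure, Set.mem_ofPred_eq, sideForm_planeRotation, LinearIsometryEquiv.norm_map]
  refine and_congr_right fun _ => ⟨fun h j => ?_, fun h j => h _⟩
  have := h (j + k)
  rwa [add_sub_cancel_right] at this

theorem planeReflection_mem_baseFigure (w : ℂ) :
    planeReflection p w ∈ S.baseFigure ↔ w ∈ S.baseFigure := by
  simp only [baseFigure, Set.mem_ofPred_eq, sideForm_planeReflection, LinearIsometryEquiv.norm_map]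
  refine and_congr_right fun _ => ⟨fun h j => ?_, fun h j => h _⟩
  have := h (-j)
  rwa [neg_neg] at this

theorem planeRotation_mem_sideCurve (k j : ℤ) (w : ℂ) :
    planeRotation p k w ∈ S.sideCurve j ↔ w ∈ S.sideCurve (j - k) := by
  simp only [sideCurve, Set.mem_ofPred_eq, sideForm_planeRotation, planeRotation_mem_baseFigure]

theorem planeReflection_mem_sideCurve_zero (w : ℂ) :
    planeReflection p w ∈ S.sideCurve 0 ↔ w ∈ S.sideCurve 0 := by
  simp only [sideCurve, Set.mem_ofPred_eq, sideForm_planeReflection, planeReflection_mem_baseFigure,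
    neg_zero]

theorem prismRotation_image_prism (k : ℤ) (t : ℝ) : prismRotation p k '' S.prism t = S.prism t :=
  image_eq_of_mem_iff fun X => and_congr (S.planeRotation_mem_baseFigure k X.2) Iff.rfl

theorem prismRotation_image_side (k j : ℤ) (J : Set ℝ) :
    prismRotation p k '' overBase (S.sideCurve j) J = overBase (S.sideCurve (j + k)) J := by
  refine image_eq_of_mem_iff fun X => and_congr ?_ Iff.rfl
  have := S.planeRotation_mem_sideCurve k (j + k) X.2
  rwa [add_sub_cancel_right] at this

theorem sub_mem_uIcc_iff (t s : ℝ) : t - s ∈ Set.uIcc 0 t ↔ s ∈ Set.uIcc 0 t := by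
  rw [Set.mem_uIcc, Set.mem_uIcc]
  constructor <;> rintro (⟨h1, h2⟩ | ⟨h1, h2⟩)
  · left; constructor <;> linarith
  · right; constructor <;> linarith
  · left; constructor <;> linarith
  · right; constructor <;> linarith

theorem prismFlip_image_prism (t : ℝ) : prismFlip p t '' S.prism t = S.prism t :=
  image_eq_of_mem_iff fun X => and_congr (S.planeReflection_mem_baseFigure X.2)
    (sub_mem_uIcc_iff t X.1)

theorem prismFlip_image_side (t : ℝ) :
    prismFlip p t '' overBase (S.sideCurve 0) (Set.uIcc 0 t) =
      overBase (S.sideCurve 0) (Set.uIcc 0 t) :=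
  image_eq_of_mem_iff fun X => and_congr (S.planeReflection_mem_sideCurve_zero X.2)
    (sub_mem_uIcc_iff t X.1)

theorem continuous_sideForm (k : ℤ) : Continuous (S.sideForm k) := by
  unfold sideForm; fun_prop

theorem isClosed_baseFigure : IsClosed S.baseFigure := by
  have : S.baseFigure = Metric.closedBall 0 S.ρ ∩ ⋂ k : ℤ, {w | S.sideForm k w ≤ 0} := by
    ext w; simp [baseFigure]
  rw [this]
  exact Metric.isClosed_closedBall.inter
    (isClosed_iInter fun k => isClosed_le (S.continuous_sideForm k) continuous_const)

theorem isCompact_baseFigure : IsCompact S.baseFigure :=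
  (isCompact_closedBall (0 : ℂ) S.ρ).of_isClosed_subset S.isClosed_baseFigure
    fun w hw => by simpa using hw.1

theorem isCompact_sideCurve (k : ℤ) : IsCompact (S.sideCurve k) :=
  S.isCompact_baseFigure.inter_right
    (isClosed_eq (S.continuous_sideForm k) continuous_const)

theorem mem_ball_of_mem_baseFigure {w : ℂ} (hw : w ∈ S.baseFigure) : w ∈ Metric.ball (0 : ℂ) 1 :=
  mem_ball_zero_iff.2 (hw.1.trans_lt S.ρ_lt_one)

/-- The end points of the side curve from `A₀` to `A₁` (`i = ±1`). -/
noncomputable def sideEnd (i : ℝ) : ℂ :=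
  ofCoords p (S.ρ * Real.cos (Real.pi / p)) (i * (S.ρ * Real.sin (Real.pi / p)))

theorem sideEnd_mem (hp : 3 ≤ p) {i : ℝ} (hi : |i| = 1) : S.sideEnd i ∈ S.sideCurve 0 := by
  have hi2 : i ^ 2 = 1 := by rw [← sq_abs, hi, one_pow]
  have h := Real.sin_sq_add_cos_sq (Real.pi / p)
  have hs := sin_pi_div_pos hp
  have hρ := S.ρ_pos
  rw [S.mem_sideCurve_zero_iff hp, norm_le_iff, sideForm_zero_eq, normSq_eq_coords p, sideEnd,
    radial_ofCoords, tangential_ofCoords]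
  refine ⟨?_, ?_, ?_⟩
  · apply le_of_eq
    linear_combination S.ρ ^ 2 * h + S.ρ ^ 2 * Real.sin (Real.pi / p) ^ 2 * hi2
  · rw [abs_mul, hi, one_mul, abs_of_pos (by positivity)]
    apply le_of_eq; ring
  · linear_combination S.m * (S.ρ ^ 2 * h + S.ρ ^ 2 * Real.sin (Real.pi / p) ^ 2 * hi2)

theorem tangential_sideEnd (i : ℝ) :
    tangential p (S.sideEnd i) = i * (S.ρ * Real.sin (Real.pi / p)) :=
  tangential_ofCoords _ _

/-- A homeomorphism of a side curve onto itself permutes its end points. -/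
theorem sideEnd_permuted (hp : 3 ≤ p) {M : S.sideCurve 0 → S.sideCurve 0} (hc : Continuous M)
    (hb : Function.Bijective M) (a b : S.sideCurve 0) (ha : (a : ℂ) = S.sideEnd (-1))
    (hb' : (b : ℂ) = S.sideEnd 1) : (M a = a ∧ M b = b) ∨ (M a = b ∧ M b = a) := by
  set σ := S.ρ * Real.sin (Real.pi / p) with hσ
  have hσ0 : 0 < σ := mul_pos S.ρ_pos (sin_pi_div_pos hp)
  have hle : -σ ≤ σ := by linarith
  have : CompactSpace (S.sideCurve 0) := isCompact_iff_compactSpace.1 (S.isCompact_sideCurve 0)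
  let τ : S.sideCurve 0 → Set.Icc (-σ) σ := fun w => ⟨tangential p w, S.tangential_mapsTo hp w.2⟩
  have hτc : Continuous τ :=
    (continuous_tangential.comp continuous_subtype_val).subtype_mk _
  have hτi : Function.Injective τ := fun w z h =>
    Subtype.ext (S.tangential_injOn hp w.2 z.2 (congrArg Subtype.val h))
  have hτs : Function.Surjective τ := by
    rintro ⟨s, hs⟩
    obtain ⟨w, hw, rfl⟩ := S.tangential_surjOn hp hs
    exact ⟨⟨w, hw⟩, rfl⟩
  let H : S.sideCurve 0 ≃ₜ Set.Icc (-σ) σ :=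
    Continuous.homeoOfEquivCompactToT2 (f := Equiv.ofBijective τ ⟨hτi, hτs⟩) hτc
  have hH : ∀ w, H w = τ w := fun w => rfl
  let ψ : Set.Icc (-σ) σ → Set.Icc (-σ) σ := fun s => H (M (H.symm s))
  have hψc : Continuous ψ := H.continuous.comp (hc.comp H.symm.continuous)
  have hψb : Function.Bijective ψ := H.bijective.comp (hb.comp H.symm.bijective)
  let f : ℝ → ℝ := fun s => ψ (Set.projIcc (-σ) σ hle s)
  have hfv : ∀ s (hs : s ∈ Set.Icc (-σ) σ), f s = ψ ⟨s, hs⟩ := fun s hs => by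
    simp only [f]; rw [Set.projIcc_of_mem hle hs]
  have hfc : Continuous f := continuous_subtype_val.comp (hψc.comp continuous_projIcc)
  have hfi : Set.InjOn f (Set.Icc (-σ) σ) := by
    intro s hs s' hs' h
    rw [hfv s hs, hfv s' hs'] at h
    exact congrArg Subtype.val (hψb.1 (Subtype.ext h))
  have hfs : ∀ y ∈ Set.Icc (-σ) σ, ∃ s ∈ Set.Icc (-σ) σ, f s = y := by
    intro y hy
    obtain ⟨s, hs⟩ := hψb.2 ⟨y, hy⟩
    exact ⟨s, s.2, by rw [hfv s s.2, hs]⟩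
  have hmem : ∀ s, f s ∈ Set.Icc (-σ) σ := fun s => (ψ _).2
  have hval : ∀ w : S.sideCurve 0, f (tangential p w) = tangential p (M w) := by
    intro w
    rw [hfv _ (τ w).2]
    change ((H (M (H.symm (H w))) : Set.Icc (-σ) σ) : ℝ) = _
    rw [H.symm_apply_apply]
    rfl
  have hta : tangential p (a : ℂ) = -σ := by rw [ha, tangential_sideEnd]; ring
  have htb : tangential p (b : ℂ) = σ := by rw [hb', tangential_sideEnd]; ring
  have hlow : -σ ∈ Set.Icc (-σ) σ := ⟨le_rfl, hle⟩
  have hhigh : σ ∈ Set.Icc (-σ) σ := ⟨hle, le_rfl⟩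
  have hinj : ∀ w z : S.sideCurve 0, tangential p w = tangential p z → w = z := fun w z h =>
    hτi (Subtype.ext h)
  obtain ⟨s, hs, hsl⟩ := hfs _ hlow
  obtain ⟨s', hs', hsh⟩ := hfs _ hhigh
  -- A continuous injection of an interval is strictly monotone; being onto, it fixes or swaps the
  -- end points according to its direction.
  rcases hfc.continuousOn.strictMonoOn_of_injOn_Icc' hle hfi with h | h
  · left
    have h1 : f (-σ) = -σ :=
      le_antisymm ((h.monotoneOn hlow hs hs.1).trans_eq hsl) (hmem _).1
    have h2 : f σ = σ :=
      le_antisymm (hmem _).2 (hsh.symm.trans_le (h.monotoneOn hs' hhigh hs'.2))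
    constructor
    · apply hinj; rw [← hval, hta, h1]
    · apply hinj; rw [← hval, htb, h2]
  · right
    have h1 : f (-σ) = σ :=
      le_antisymm (hmem _).2 (hsh.symm.trans_le (h.antitoneOn hlow hs' hs'.1))
    have h2 : f σ = -σ :=
      le_antisymm ((h.antitoneOn hs hhigh hs.2).trans_eq hsl) (hmem _).1
    constructor
    · apply hinj; rw [← hval, hta, h1, htb]
    · apply hinj; rw [← hval, htb, h2, hta]

/-- At equal heights the phase difference is the argument of `1 - conj A₀ * A₁`, whose imaginary
part is `ρ² sin (2π/p) > 0`. This asymmetry of the two ends is what excludes face-to-face tilings.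
-/
theorem phaseDiff_sideEnd_ne_zero (hp : 3 ≤ p) {X Y : SL2Cover} (hX : (X.2 : ℂ) = S.sideEnd (-1))
    (hY : (Y.2 : ℂ) = S.sideEnd 1) (h0 : X.1 = Y.1) : phaseDiff X Y ≠ 0 := by
  intro h
  rw [phaseDiff, h0, sub_self, zero_add, Complex.arg_eq_zero_iff] at h
  have him := h.2
  rw [hX, hY] at him
  simp only [Complex.sub_im, Complex.one_im, Complex.mul_im, Complex.conj_re, Complex.conj_im,
    sideEnd, ofCoords] at him
  have hs := sin_pi_div_pos hp
  have hc := cos_pi_div_pos hp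
  have hρ := S.ρ_pos
  have h1 := Real.sin_sq_add_cos_sq (Real.pi / p)
  have : 0 < 2 * (S.ρ * Real.cos (Real.pi / p)) * (S.ρ * Real.sin (Real.pi / p)) := by positivity
  apply this.ne'
  linear_combination him -
    2 * (S.ρ * Real.cos (Real.pi / p)) * (S.ρ * Real.sin (Real.pi / p)) * h1

theorem eq_zero_of_mem_uIcc {f t : ℝ} (h1 : f ∈ Set.uIcc 0 t) (h2 : t + f ∈ Set.uIcc 0 t) :
    f = 0 := by
  rw [Set.mem_uIcc] at h1 h2
  rcases h1 with ⟨a, b⟩ | ⟨a, b⟩ <;> rcases h2 with ⟨c, d⟩ | ⟨c, d⟩ <;> linarith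

/-- A fibre-direction preserving isometry that takes a side face onto itself is trivial. -/
theorem eq_one_of_image_side (hp : 3 ≤ p) {e : SL2Cover ≃ₜ SL2Cover} (he : PreservesForm 1 e)
    {t : ℝ} (h : e '' overBase (S.sideCurve 0) (Set.uIcc 0 t) =
      overBase (S.sideCurve 0) (Set.uIcc 0 t)) : e = 1 := by
  let ι : S.sideCurve 0 → Metric.ball (0 : ℂ) 1 := fun w =>
    ⟨w, S.mem_ball_of_mem_baseFigure w.2.1⟩
  have hmem : ∀ (s : ℝ), s ∈ Set.uIcc 0 t → ∀ w : S.sideCurve 0,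
      e (s, ι w) ∈ overBase (S.sideCurve 0) (Set.uIcc 0 t) := fun s hs w =>
    h ▸ ⟨(s, ι w), ⟨w.2, hs⟩, rfl⟩
  -- On every fibre `e` is a shift, and a segment from `0` to `t` shifted into itself is not
  -- shifted.
  have hf : ∀ w, (e (0, ι w)).1 = 0 := by
    intro w
    apply eq_zero_of_mem_uIcc (hmem 0 Set.left_mem_uIcc w).2
    have := (hmem t Set.right_mem_uIcc w).2
    rwa [he.apply_mk, one_mul] at this
  let M : S.sideCurve 0 → S.sideCurve 0 := fun w =>
    ⟨(e (0, ι w)).2, (hmem 0 Set.left_mem_uIcc w).1⟩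
  have hι : Continuous ι := continuous_subtype_val.subtype_mk _
  have hMc : Continuous M := by
    apply Continuous.subtype_mk
    fun_prop
  have hMe : ∀ w, e (0, ι w) = (0, ι (M w)) := fun w =>
    Prod.ext (hf w) (Subtype.ext rfl)
  have hMb : Function.Bijective M := by
    constructor
    · intro w z hwz
      have h1 : e (0, ι w) = e (0, ι z) := by rw [hMe, hMe, hwz]
      have h2 := e.injective h1
      exact Subtype.ext (congrArg (fun X : SL2Cover => (X.2 : ℂ)) h2)
    · intro w
      have h1 : ((0, ι w) : SL2Cover) ∈ e '' overBase (S.sideCurve 0) (Set.uIcc 0 t) :=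
        by rw [h]; exact ⟨w.2, Set.left_mem_uIcc⟩
      obtain ⟨⟨s, z⟩, ⟨hz, -⟩, hX⟩ := h1
      refine ⟨⟨z, hz⟩, ?_⟩
      rw [he.apply_mk] at hX
      have h2 := congrArg (fun X : SL2Cover => (X.2 : ℂ)) hX
      exact Subtype.ext h2
  let a : S.sideCurve 0 := ⟨S.sideEnd (-1), S.sideEnd_mem hp (by simp)⟩
  let b : S.sideCurve 0 := ⟨S.sideEnd 1, S.sideEnd_mem hp (by simp)⟩
  have hab := S.phaseDiff_sideEnd_ne_zero hp (X := (0, ι a)) (Y := (0, ι b)) rfl rfl rfl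
  rcases S.sideEnd_permuted hp hMc hMb a b rfl rfl with ⟨h1, h2⟩ | ⟨h1, h2⟩
  · refine he.eq_one (X := (0, ι a)) (Y := (0, ι b)) (by rw [hMe, h1]) (by rw [hMe, h2]) ?_
    intro h3
    apply hab
    rw [phaseDiff_of_snd_eq h3]
    simp
  -- A swap of the ends would make their phase difference equal to its own negative.
  · exfalso
    have h3 := he.phase (0, ι a) (0, ι b)
    rw [hMe, hMe, h1, h2, phaseDiff_swap, one_mul] at h3
    apply hab
    linarith

end RegularShape

end SL2Cover

/-! ### Local finiteness of tilings by one bounded prism. -/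

namespace SL2Cover

open ComplexConjugate

variable {p : ℕ}

theorem mul_image (g h : SL2Cover ≃ₜ SL2Cover) (A : Set SL2Cover) :
    (g * h : SL2Cover ≃ₜ SL2Cover) '' A = g '' (h '' A) := by
  rw [← Set.image_comp]; rfl

theorem inv_image_image (g : SL2Cover ≃ₜ SL2Cover) (A : Set SL2Cover) :
    (g⁻¹ : SL2Cover ≃ₜ SL2Cover) '' (g '' A) = A := by
  rw [← mul_image, inv_mul_cancel]; exact Set.image_id A

/-- A compact exhaustion of the space. -/
def box (r M : ℝ) : Set SL2Cover := {X | ‖(X.2 : ℂ)‖ ≤ r ∧ |X.1| ≤ M}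

theorem isCompact_box {r : ℝ} (hr : r < 1) (M : ℝ) : IsCompact (box r M) := by
  have hind : Topology.IsInducing fun X : SL2Cover => (X.1, (X.2 : ℂ)) :=
    Topology.IsInducing.id.prodMap Topology.IsInducing.subtypeVal
  rw [hind.isCompact_iff]
  have : (fun X : SL2Cover => (X.1, (X.2 : ℂ))) '' box r M =
      Set.Icc (-M) M ×ˢ Metric.closedBall (0 : ℂ) r := by
    ext ⟨s, w⟩
    simp only [Set.mem_image, Set.mem_prod, Set.mem_Icc, mem_closedBall_zero_iff]
    constructor
    · rintro ⟨X, ⟨h1, h2⟩, h3⟩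
      obtain ⟨rfl, rfl⟩ := Prod.mk.inj h3
      exact ⟨abs_le.1 h2, h1⟩
    · rintro ⟨h1, h2⟩
      exact ⟨(s, ⟨w, mem_ball_zero_iff.2 (h2.trans_lt hr)⟩), ⟨h2, abs_le.2 h1⟩, rfl⟩
  rw [this]
  exact isCompact_Icc.prod (isCompact_closedBall _ _)

theorem exists_subset_box {K : Set SL2Cover} (hK : IsCompact K) :
    ∃ r < 1, ∃ M, K ⊆ box r M := by
  rcases K.eq_empty_or_nonempty with rfl | hne
  · exact ⟨0, one_pos, 0, Set.empty_subset _⟩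
  · have h1 : ContinuousOn (fun X : SL2Cover => ‖(X.2 : ℂ)‖) K := by fun_prop
    have h2 : ContinuousOn (fun X : SL2Cover => |X.1|) K := by fun_prop
    obtain ⟨X, -, hX⟩ := hK.exists_isMaxOn hne h1
    obtain ⟨Y, -, hY⟩ := hK.exists_isMaxOn hne h2
    exact ⟨_, X.norm_lt_one, _, fun Z hZ => ⟨hX hZ, hY hZ⟩⟩

theorem abs_phaseDiff_ge (X Y : SL2Cover) : |X.1 - Y.1| ≤ |phaseDiff X Y| + Real.pi := by
  have h1 := Complex.abs_arg_le_pi (1 - conj (X.2 : ℂ) * (Y.2 : ℂ))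
  have h2 : X.1 - Y.1 = phaseDiff X Y - Complex.arg (1 - conj (X.2 : ℂ) * (Y.2 : ℂ)) := by
    rw [phaseDiff]; ring
  rw [h2]
  exact (abs_sub _ _).trans (by linarith)

/-- With `|Y| ≤ r`, `sep` is at least `(1 - r)² / (2 (1 - |X|))`, so a bound on it keeps `X` away
from the boundary of the disc. Heights differ from phase differences by at most `π`. -/
theorem exists_box_of_sep_le {r : ℝ} (hr : r < 1) (M s d : ℝ) (hs : 1 ≤ s) :
    ∃ r' < 1, ∃ M', ∀ X Y, Y ∈ box r M → sep X Y ≤ s → |phaseDiff X Y| ≤ d → X ∈ box r' M' := by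
  have hs0 : 0 < s := by linarith
  refine ⟨1 - (1 - r) ^ 2 / (2 * s), ?_, M + d + Real.pi, ?_⟩
  · have : 0 < (1 - r) ^ 2 / (2 * s) := div_pos (pow_pos (by linarith) 2) (by linarith)
    linarith
  · rintro X Y ⟨hY, hYM⟩ hsep hd
    constructor
    · have hX1 := X.norm_lt_one
      have hY1 := Y.norm_lt_one
      have hX0 := norm_nonneg (X.2 : ℂ)
      have hY0 := norm_nonneg (Y.2 : ℂ)
      have h1 : 1 - ‖(Y.2 : ℂ)‖ ≤ ‖1 - conj (X.2 : ℂ) * (Y.2 : ℂ)‖ := by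
        have h2 := norm_sub_norm_le (1 : ℂ) (conj (X.2 : ℂ) * (Y.2 : ℂ))
        rw [norm_one, norm_mul, RCLike.norm_conj] at h2
        nlinarith
      rw [sep, Complex.normSq_eq_norm_sq, Complex.normSq_eq_norm_sq, Complex.normSq_eq_norm_sq,
        div_le_iff₀ (by apply mul_pos <;> nlinarith)] at hsep
      generalize ‖1 - conj (X.2 : ℂ) * (Y.2 : ℂ)‖ = n at *
      generalize ‖(X.2 : ℂ)‖ = x at *
      generalize ‖(Y.2 : ℂ)‖ = y at *
      have h3 : (1 - r) ^ 2 ≤ n ^ 2 := pow_le_pow_left₀ (by linarith) (by linarith) 2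
      have h4 : (1 - x ^ 2) * (1 - y ^ 2) ≤ 2 * (1 - x) := by
        nlinarith [mul_nonneg (sub_nonneg.2 hX1.le) (sq_nonneg y), mul_nonneg hX0 (sq_nonneg y),
          mul_nonneg (mul_nonneg hX0 hX0) (sq_nonneg y)]
      have h5 : (1 - r) ^ 2 ≤ s * (2 * (1 - x)) :=
        h3.trans (hsep.trans (mul_le_mul_of_nonneg_left h4 hs0.le))
      have h6 : (1 - r) ^ 2 / (2 * s) ≤ 1 - x := by
        rw [div_le_iff₀ (by linarith)]; linarith
      linarith
    · have h1 := abs_phaseDiff_ge X Y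
      have h2 : |X.1| ≤ |X.1 - Y.1| + |Y.1| := by
        have := abs_add_le (X.1 - Y.1) Y.1
        rwa [sub_add_cancel] at this
      linarith

namespace RegularShape

variable (S : RegularShape p)

/-- At the origin every side form equals `-(m ρ² + ρ cos (π/p))`, negative by `m_gt`, with a margin
that does not depend on the side. -/
theorem exists_ball_subset_baseFigure (hp : 3 ≤ p) :
    ∃ r > 0, ∀ w : ℂ, ‖w‖ < r → w ∈ S.baseFigure := by
  have hc := cos_pi_div_pos hp
  have hρ := S.ρ_pos
  have hm := S.m_mul_gt
  have hd : 0 < S.m * S.ρ ^ 2 + S.ρ * Real.cos (Real.pi / p) := by nlinarith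
  set d := S.m * S.ρ ^ 2 + S.ρ * Real.cos (Real.pi / p) with hd_def
  have hpos : 0 < |S.m| + 1 := by positivity
  refine ⟨min (min S.ρ 1) (d / (|S.m| + 1)), by positivity, fun w hw => ⟨?_, fun k => ?_⟩⟩
  · exact (hw.trans_le ((min_le_left _ _).trans (min_le_left _ _))).le
  · have h1 : ‖w‖ < 1 := hw.trans_le ((min_le_left _ _).trans (min_le_right _ _))
    have h2 : ‖w‖ * (|S.m| + 1) < d := (lt_div_iff₀ hpos).1 (hw.trans_le (min_le_right _ _))
    have h3 : w.re * Real.sin (2 * Real.pi * (k + 1 / 2) / p) +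
        w.im * Real.cos (2 * Real.pi * (k + 1 / 2) / p) ≤ ‖w‖ := by
      apply (abs_le_of_sq_le_sq' _ (norm_nonneg w)).2
      have h4 := Real.sin_sq_add_cos_sq (2 * Real.pi * (k + 1 / 2) / p)
      have h5 : ‖w‖ ^ 2 = w.re ^ 2 + w.im ^ 2 := by
        rw [← Complex.normSq_eq_norm_sq, Complex.normSq_apply]; ring
      rw [h5]
      nlinarith [sq_nonneg (w.re * Real.cos (2 * Real.pi * (k + 1 / 2) / p) -
        w.im * Real.sin (2 * Real.pi * (k + 1 / 2) / p))]
    have h6 : S.m * ‖w‖ ^ 2 ≤ |S.m| * ‖w‖ := by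
      calc S.m * ‖w‖ ^ 2 ≤ |S.m| * ‖w‖ ^ 2 := by gcongr; exact le_abs_self _
        _ ≤ |S.m| * ‖w‖ := by gcongr; nlinarith [norm_nonneg w]
    rw [sideForm]
    linarith

/-- The centre of the bounded prism of height `t`. -/
noncomputable def prismCentre (t : ℝ) : SL2Cover := (t / 2, ⟨0, by simp⟩)

theorem sep_prismCentre (t : ℝ) (Y : SL2Cover) :
    sep (prismCentre t) Y = 1 / (1 - Complex.normSq (Y.2 : ℂ)) := by
  simp [sep, prismCentre]

theorem phaseDiff_prismCentre (t : ℝ) (Y : SL2Cover) :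
    phaseDiff (prismCentre t) Y = t / 2 - Y.1 := by
  simp [phaseDiff, prismCentre]

/-- The neighbourhood is described by the two invariants only, so the same `η` serves for every copy
of the prism. -/
theorem exists_nhd_prismCentre (hp : 3 ≤ p) {t : ℝ} (ht : t ≠ 0) : ∃ η > 0, ∀ Y,
    sep (prismCentre t) Y < 1 + η → |phaseDiff (prismCentre t) Y| < η → Y ∈ S.prism t := by
  obtain ⟨r, hr, h⟩ := S.exists_ball_subset_baseFigure hp
  have ht' : 0 < |t| := abs_pos.2 ht
  refine ⟨min (r ^ 2) (|t| / 2), by positivity, fun Y h1 h2 => ⟨h _ ?_, ?_⟩⟩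
  · have h3 := Y.normSq_lt_one
    rw [sep_prismCentre, div_lt_iff₀ (by linarith)] at h1
    apply lt_of_pow_lt_pow_left₀ 2 hr.le
    rw [← Complex.normSq_eq_norm_sq]
    have h4 : min (r ^ 2) (|t| / 2) ≤ r ^ 2 := min_le_left _ _
    have h5 := Complex.normSq_nonneg (Y.2 : ℂ)
    have h6 : 0 < min (r ^ 2) (|t| / 2) := by positivity
    nlinarith
  · rw [phaseDiff_prismCentre] at h2
    have h3 := abs_lt.1 (h2.trans_le (min_le_right _ _))
    rw [Set.mem_uIcc]
    rcases lt_or_gt_of_ne ht with h | h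
    · rw [abs_of_neg h] at h3
      right; constructor <;> linarith
    · rw [abs_of_pos h] at h3
      left; constructor <;> linarith

theorem sep_prismCentre_le {t : ℝ} {Y : SL2Cover} (hY : Y ∈ S.prism t) :
    sep (prismCentre t) Y ≤ 1 / (1 - S.ρ ^ 2) := by
  rw [sep_prismCentre, Complex.normSq_eq_norm_sq]
  have h1 : ‖(Y.2 : ℂ)‖ ^ 2 ≤ S.ρ ^ 2 := pow_le_pow_left₀ (norm_nonneg _) hY.1.1 2
  have h2 : S.ρ ^ 2 < 1 := by nlinarith [S.ρ_pos, S.ρ_lt_one]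
  exact one_div_le_one_div_of_le (by linarith) (by linarith)

theorem abs_phaseDiff_prismCentre_le {t : ℝ} {Y : SL2Cover} (hY : Y ∈ S.prism t) :
    |phaseDiff (prismCentre t) Y| ≤ |t| := by
  rw [phaseDiff_prismCentre]
  have h := hY.2
  rw [Set.mem_uIcc] at h
  rcases h with ⟨h1, h2⟩ | ⟨h1, h2⟩
  · rw [abs_of_nonneg (h1.trans h2), abs_le]; constructor <;> linarith
  · rw [abs_of_nonpos (h1.trans h2), abs_le]; constructor <;> linarith

theorem isCompact_prism (t : ℝ) : IsCompact (S.prism t) := by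
  refine (isCompact_box S.ρ_lt_one |t|).of_isClosed_subset ?_ ?_
  · exact (S.isClosed_baseFigure.preimage (by fun_prop :
      Continuous fun X : SL2Cover => (X.2 : ℂ))).inter
      ((isClosed_Icc (a := 0 ⊓ t) (b := 0 ⊔ t)).preimage continuous_fst)
  · intro X hX
    refine ⟨hX.1.1, ?_⟩
    have h := hX.2
    rw [Set.mem_uIcc] at h
    rcases h with ⟨h1, h2⟩ | ⟨h1, h2⟩
    · rw [abs_of_nonneg (h1.trans h2), abs_le]; constructor <;> linarith
    · rw [abs_of_nonpos (h1.trans h2), abs_le]; constructor <;> linarith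

end RegularShape

open RegularShape

theorem PreservesForm.abs_phase {ε : ℝ} {g : SL2Cover ≃ₜ SL2Cover} (hg : PreservesForm ε g)
    (hε : ε = 1 ∨ ε = -1) (X Y : SL2Cover) : |phaseDiff (g X) (g Y)| = |phaseDiff X Y| := by
  rw [hg.phase, abs_mul]
  rcases hε with rfl | rfl <;> simp

/-- Tilings by copies of one bounded prism are locally finite. -/
theorem IsRegularPrismTiling.locallyFinite (hp : 3 ≤ p) {S : RegularShape p} {t : ℝ} (ht : t ≠ 0)
    {𝒯 : Set (Set SL2Cover)} (h : IsRegularPrismTiling S t 𝒯) {K : Set SL2Cover}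
    (hK : IsCompact K) : {T ∈ 𝒯 | (T ∩ K).Nonempty}.Finite := by
  obtain ⟨⟨-, -, hdis⟩, hcop⟩ := h
  have hcop' : ∀ T ∈ 𝒯, ∃ g : SL2Cover ≃ₜ SL2Cover, ∃ ε : ℝ, (ε = 1 ∨ ε = -1) ∧
      PreservesForm ε g ∧ T = g '' S.prism t := by
    intro T hT
    obtain ⟨g, hg, rfl⟩ := hcop T hT
    obtain ⟨ε, hε, hgε⟩ := exists_preservesForm hg
    exact ⟨g, ε, hε, hgε, rfl⟩
  choose! g ε hε hg hgT using hcop'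
  obtain ⟨η, hη, hnhd⟩ := S.exists_nhd_prismCentre hp ht
  have hsub : ∀ T ∈ 𝒯, ∀ Y, sep (g T (prismCentre t)) Y < 1 + η →
      |phaseDiff (g T (prismCentre t)) Y| < η → Y ∈ interior T := by
    intro T hT Y hY1 hY2
    have hopen : IsOpen {Y | sep (g T (prismCentre t)) Y < 1 + η ∧
        |phaseDiff (g T (prismCentre t)) Y| < η} := by
      have hs : Continuous fun Y => sep (g T (prismCentre t)) Y :=
        continuous_sep.comp (f := fun Y => (g T (prismCentre t), Y)) (by fun_prop)
      have hc : Continuous fun Y => phaseDiff (g T (prismCentre t)) Y :=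
        continuous_phaseDiff.comp (f := fun Y => (g T (prismCentre t), Y)) (by fun_prop)
      exact (isOpen_lt hs continuous_const).inter (isOpen_lt hc.abs continuous_const)
    refine interior_maximal ?_ hopen ⟨hY1, hY2⟩
    rintro Z ⟨h1, h2⟩
    rw [hgT T hT]
    refine ⟨(g T).symm Z, hnhd _ ?_ ?_, (g T).apply_symm_apply Z⟩
    · rwa [← (hg T hT).sep, (g T).apply_symm_apply]
    · rwa [← (hg T hT).abs_phase (hε T hT), (g T).apply_symm_apply]
  -- Each tile has an `η`-neighbourhood of its centre in its interior, so the centres of distinct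
  -- tiles are `η`-separated.
  have hsep : ∀ T ∈ 𝒯, ∀ T' ∈ 𝒯, sep (g T (prismCentre t)) (g T' (prismCentre t)) < 1 + η →
      |phaseDiff (g T (prismCentre t)) (g T' (prismCentre t))| < η → T = T' := by
    intro T hT T' hT' h1 h2
    by_contra hne
    refine Set.disjoint_left.1 (hdis T hT T' hT' hne) (hsub T hT _ h1 h2) (hsub T' hT' _ ?_ ?_)
    · rw [sep_self]; linarith
    · rw [phaseDiff_self, abs_zero]; exact hη
  have hs1 : 1 ≤ 1 / (1 - S.ρ ^ 2) := by
    have h2 : S.ρ ^ 2 < 1 := by nlinarith [S.ρ_pos, S.ρ_lt_one]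
    rw [le_div_iff₀ (by linarith)]
    nlinarith [sq_nonneg S.ρ]
  obtain ⟨r, hr, M, hKbox⟩ := exists_subset_box hK
  obtain ⟨r', hr', M', hbox⟩ := exists_box_of_sep_le hr M (1 / (1 - S.ρ ^ 2)) |t| hs1
  by_contra hinf
  have hinj : Set.InjOn (fun T => g T (prismCentre t)) {T ∈ 𝒯 | (T ∩ K).Nonempty} := by
    intro T hT T' hT' hTT
    apply hsep T hT.1 T' hT'.1
    · rw [show g T (prismCentre t) = g T' (prismCentre t) from hTT, sep_self]; linarith
    · rw [show g T (prismCentre t) = g T' (prismCentre t) from hTT, phaseDiff_self, abs_zero]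
      exact hη
  -- Infinitely many tiles meeting `K` would have infinitely many centres in one compact box, hence
  -- an accumulation point, near which two distinct centres are closer than `η`.
  have hinf' := (show Set.Infinite _ from hinf).image hinj
  obtain ⟨Z, -, hZ⟩ := hinf'.exists_accPt_of_subset_isCompact (isCompact_box hr' M') (by
    rintro _ ⟨T, ⟨hT, Y, hYT, hYK⟩, rfl⟩
    rw [hgT T hT] at hYT
    obtain ⟨Y₀, hY₀, rfl⟩ := hYT
    apply hbox _ (g T Y₀) (hKbox hYK)
    · rw [(hg T hT).sep]; exact S.sep_prismCentre_le hY₀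
    · rw [(hg T hT).abs_phase (hε T hT)]; exact S.abs_phaseDiff_prismCentre_le hY₀)
  have hV : ∀ᶠ W in nhds (Z, Z), sep W.1 W.2 < 1 + η ∧ |phaseDiff W.1 W.2| < η := by
    refine Filter.Eventually.and ?_ ?_
    · refine continuous_sep.continuousAt.eventually (gt_mem_nhds ?_)
      change sep Z Z < 1 + η
      rw [sep_self]; linarith
    · refine continuous_phaseDiff.abs.continuousAt.eventually (gt_mem_nhds ?_)
      change |phaseDiff Z Z| < η
      rw [phaseDiff_self, abs_zero]; exact hη
  rw [nhds_prod_eq] at hV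
  obtain ⟨V, hV, hVV⟩ := (Filter.eventually_prod_self_iff
    (r := fun X Y => sep X Y < 1 + η ∧ |phaseDiff X Y| < η)).1 hV
  obtain ⟨c₁, ⟨hc₁V, T₁, hT₁, rfl⟩, hne₁⟩ := accPt_iff_nhds.1 hZ V hV
  have hV2 : V ∩ {g T₁ (prismCentre t)}ᶜ ∈ nhds Z :=
    Filter.inter_mem hV (isOpen_compl_singleton.mem_nhds hne₁.symm)
  obtain ⟨c₂, ⟨⟨hc₂V, hc₂⟩, T₂, hT₂, rfl⟩, hne₂⟩ := accPt_iff_nhds.1 hZ _ hV2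
  obtain ⟨h1, h2⟩ := hVV _ hc₁V _ hc₂V
  have := hsep T₁ hT₁.1 T₂ hT₂.1 h1 h2
  exact hc₂ (by rw [this]; rfl)

end SL2Cover

/-! ### No tiling is face-to-face. -/

namespace SL2Cover

open RegularShape

variable {p : ℕ}

namespace RegularShape

variable (S : RegularShape p)

theorem infinite_sideCurve (hp : 3 ≤ p) : (S.sideCurve 0).Infinite := by
  have h : 0 < S.ρ * Real.sin (Real.pi / p) := mul_pos S.ρ_pos (sin_pi_div_pos hp)
  exact ((Set.Icc_infinite (by linarith)).mono (S.tangential_surjOn hp)).of_image _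

/-- The trace point of a point of a side curve, as an element of the disc. -/
def sidePoint {k : ℤ} (w : S.sideCurve k) : Metric.ball (0 : ℂ) 1 :=
  ⟨w, S.mem_ball_of_mem_baseFigure w.2.1⟩

/-- A radial displacement by `τ` from the side curve changes the side form by `τ (2 m x + 1) + m
τ²`, where `x` is the radial coordinate; this is positive for small `τ > 0`, so the point leaves the
base figure. -/
theorem notMem_interior_prism (hp : 3 ≤ p) {t : ℝ} (w : S.sideCurve 0) (s : ℝ) :
    ((s, S.sidePoint w) : SL2Cover) ∉ interior (S.prism t) := by
  intro hint
  obtain ⟨w, hw⟩ := w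
  obtain ⟨h1, h2, h3⟩ := (S.mem_sideCurve_zero_iff hp).1 hw
  have hball : Metric.ball (0 : ℂ) 1 ∈ nhds w :=
    Metric.isOpen_ball.mem_nhds (S.mem_ball_of_mem_baseFigure hw.1)
  have hx := radial_nonneg_of_sector hp h2
  have hpos := S.one_add_m_mul_pos hx hx (S.radial_le h1) (S.radial_le h1)
  let W : ℝ → ℂ := fun τ => ofCoords p (radial p w + τ) (tangential p w)
  have hW : Continuous W := by
    refine Complex.continuous_ofReal.comp ?_ |>.add
      ((Complex.continuous_ofReal.comp ?_).mul continuous_const) |>.congr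
      fun τ => Complex.re_add_im (W τ)
    · simp only [W, ofCoords]; fun_prop
    · simp only [W, ofCoords]; fun_prop
  have hW0 : W 0 = w := by simp only [W, add_zero]; exact ofCoords_radial_tangential w
  have hform : ∀ τ, S.sideForm 0 (W τ) =
      τ * (S.m * (radial p w + radial p w) + 1) + S.m * τ ^ 2 := by
    intro τ
    rw [sideForm_zero_eq, normSq_eq_coords p] at h3 ⊢
    simp only [W, radial_ofCoords, tangential_ofCoords]
    linear_combination h3
  have hev : ∀ᶠ τ in nhds (0 : ℝ), W τ ∈ S.baseFigure := by
    have hnh := mem_interior_iff_mem_nhds.1 hint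
    have h4 : ∀ᶠ z in nhds (S.sidePoint ⟨w, hw⟩), ((s, z) : SL2Cover) ∈ S.prism t :=
      (Continuous.prodMk_right s).continuousAt.eventually hnh
    have h5 : ∀ᶠ z in nhds w, z ∈ S.baseFigure := by
      have h6 := (Metric.isOpen_ball.isOpenEmbedding_subtypeVal).map_nhds_eq (S.sidePoint ⟨w, hw⟩)
      change ∀ᶠ z in nhds ((S.sidePoint ⟨w, hw⟩ : Metric.ball (0 : ℂ) 1) : ℂ), _
      rw [← h6, Filter.eventually_map]
      exact h4.mono fun z hz => hz.1
    rw [← hW0] at h5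
    exact hW.continuousAt.eventually h5
  have hev2 : ∀ᶠ τ in nhds (0 : ℝ), 0 < (S.m * (radial p w + radial p w) + 1) + S.m * τ := by
    have hc : Continuous fun τ => (S.m * (radial p w + radial p w) + 1) + S.m * τ := by fun_prop
    exact hc.continuousAt.eventually (lt_mem_nhds (by simpa using hpos))
  obtain ⟨τ, ⟨h4, h5⟩, h6⟩ :=
    ((((hev.and hev2).filter_mono nhdsWithin_le_nhds :
      ∀ᶠ τ in nhdsWithin (0 : ℝ) (Set.Ioi 0), _)).and self_mem_nhdsWithin).exists
  have h7 := h4.2 0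
  rw [hform] at h7
  have h8 : (0 : ℝ) < τ := h6
  nlinarith

/-- A fibre segment of full height goes to one of full height inside the prism, so heights change by
`s ↦ s` or `s ↦ t - s`, and both fix `t / 2`. -/
theorem fst_mid {ε t : ℝ} (hε : ε = 1 ∨ ε = -1) {e : SL2Cover ≃ₜ SL2Cover}
    (he : PreservesForm ε e) (h : e '' S.prism t = S.prism t) {w : Metric.ball (0 : ℂ) 1}
    (hw : (w : ℂ) ∈ S.baseFigure) : (e (t / 2, w)).1 = t / 2 := by
  have h0 : (e (0, w)).1 ∈ Set.uIcc 0 t :=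
    (h ▸ Set.mem_image_of_mem e (⟨hw, Set.left_mem_uIcc⟩ : ((0, w) : SL2Cover) ∈ S.prism t) :
      e (0, w) ∈ S.prism t).2
  have h1 : (e (t, w)).1 ∈ Set.uIcc 0 t :=
    (h ▸ Set.mem_image_of_mem e (⟨hw, Set.right_mem_uIcc⟩ : ((t, w) : SL2Cover) ∈ S.prism t) :
      e (t, w) ∈ S.prism t).2
  rw [he.apply_mk] at h1 ⊢
  simp only at h1 ⊢
  generalize (e (0, w)).1 = f at *
  rw [Set.mem_uIcc] at h0 h1
  rcases hε with rfl | rfl <;> rcases h0 with ⟨a, b⟩ | ⟨a, b⟩ <;>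
    rcases h1 with ⟨c, d⟩ | ⟨c, d⟩ <;> linarith

/-- A face that contains interior points of the fibre segments over two different trace points is
a side face. -/
theorem IsPrismFace.eq_side_of_mid {t : ℝ} (ht : t ≠ 0) {F : Set SL2Cover}
    (hF : S.IsPrismFace t F) {X Y : SL2Cover} (hX : X ∈ F) (hY : Y ∈ F) (hX1 : X.1 = t / 2)
    (hXY : X.2 ≠ Y.2) : ∃ k, F = overBase (S.sideCurve k) (Set.uIcc 0 t) := by
  have h0 : t / 2 ≠ 0 := div_ne_zero ht two_ne_zero
  have h1 : t / 2 ≠ t := fun h => ht (by linarith)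
  cases hF with
  | bottomCover => exact absurd (hX1.symm.trans hX.2) h0
  | topCover => exact absurd (hX1.symm.trans hX.2) h1
  | side k => exact ⟨k, rfl⟩
  | bottomEdge k => exact absurd (hX1.symm.trans hX.2) h0
  | topEdge k => exact absurd (hX1.symm.trans hX.2) h1
  | sideEdge k => exact absurd (Subtype.ext (hX.1.trans hY.1.symm)) hXY
  | bottomVertex k => exact absurd (hX1.symm.trans hX.2) h0
  | topVertex k => exact absurd (hX1.symm.trans hX.2) h1

/-- A face that contains two points of one fibre and points of different fibres is a side face. -/
theorem IsPrismFace.eq_side_of_fibre {t : ℝ} {F : Set SL2Cover}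
    (hF : S.IsPrismFace t F) {X Y Z : SL2Cover} (hX : X ∈ F) (hY : Y ∈ F) (hZ : Z ∈ F)
    (hXZ : X.1 ≠ Z.1) (hXY : X.2 ≠ Y.2) :
    ∃ k, F = overBase (S.sideCurve k) (Set.uIcc 0 t) := by
  cases hF with
  | bottomCover => exact absurd (hX.2.trans hZ.2.symm) hXZ
  | topCover => exact absurd (hX.2.trans hZ.2.symm) hXZ
  | side k => exact ⟨k, rfl⟩
  | bottomEdge k => exact absurd (hX.2.trans hZ.2.symm) hXZ
  | topEdge k => exact absurd (hX.2.trans hZ.2.symm) hXZ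
  | sideEdge k => exact absurd (Subtype.ext (hX.1.trans hY.1.symm)) hXY
  | bottomVertex k => exact absurd (hX.2.trans hZ.2.symm) hXZ
  | topVertex k => exact absurd (hX.2.trans hZ.2.symm) hXZ

/-- An isometry that takes a side face of the prism onto a side face preserves the prism. -/
theorem image_prism_of_image_side (hp : 3 ≤ p) {ε t : ℝ} (hε : ε = 1 ∨ ε = -1)
    {e : SL2Cover ≃ₜ SL2Cover} (he : PreservesForm ε e) {k j : ℤ}
    (h : e '' overBase (S.sideCurve k) (Set.uIcc 0 t) = overBase (S.sideCurve j) (Set.uIcc 0 t)) :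
    e '' S.prism t = S.prism t := by
  -- Rotating the prism about its axis before and after `e` reduces to an isometry of the side with
  -- index `0` onto itself.
  set e' : SL2Cover ≃ₜ SL2Cover := prismRotation p (-j) * (e * prismRotation p k) with he'
  have hpe' : PreservesForm ε e' := by
    have := (preservesForm_prismRotation (p := p) (-j)).mul
      (he.mul (preservesForm_prismRotation (p := p) k))
    rwa [one_mul, mul_one] at this
  have hside : e' '' overBase (S.sideCurve 0) (Set.uIcc 0 t) =
      overBase (S.sideCurve 0) (Set.uIcc 0 t) := by
    rw [he', mul_image, mul_image, prismRotation_image_side, zero_add, h,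
      prismRotation_image_side, add_neg_cancel]
  have hprism : e' '' S.prism t = S.prism t := by
    rcases hε with rfl | rfl
    · rw [S.eq_one_of_image_side hp hpe' hside]
      exact Set.image_id _
    -- Composition with the half-turn, which preserves both this side and the prism, reduces to the
    -- direction-preserving case.
    · have hflip : PreservesForm 1 (prismFlip p t * e') := by
        have := (preservesForm_prismFlip (p := p) t).mul hpe'
        rwa [neg_one_mul, neg_neg] at this
      have h1 := S.eq_one_of_image_side hp (t := t) hflip (by
        rw [mul_image, hside, prismFlip_image_side])
      have h2 : prismFlip p t '' (e' '' S.prism t) = prismFlip p t '' S.prism t := by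
        rw [← mul_image, h1, prismFlip_image_prism]
        exact Set.image_id _
      exact Set.image_injective.2 (prismFlip p t).injective h2
  rw [he', mul_image, mul_image, prismRotation_image_prism] at hprism
  rw [← S.prismRotation_image_prism (-j) t] at hprism
  have := Set.image_injective.2 (prismRotation p (-j)).injective hprism
  rwa [prismRotation_image_prism] at this

end RegularShape

/-- Tilings by copies of one regular bounded prism are not face-to-face: two tiles with a common
side face would coincide. -/
theorem not_isFaceToFace (hp : 3 ≤ p) {S : RegularShape p} {t : ℝ} (ht : t ≠ 0)
    {𝒯 : Set (Set SL2Cover)} (h : IsRegularPrismTiling S t 𝒯) : ¬ IsFaceToFace S t 𝒯 := by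
  intro hff
  have hcov := h.1.2.1
  obtain ⟨T, hT⟩ : 𝒯.Nonempty := by
    obtain ⟨T, hT, -⟩ : prismCentre t ∈ ⋃₀ 𝒯 := hcov ▸ Set.mem_univ _
    exact ⟨T, hT⟩
  obtain ⟨g, hg, hgT⟩ := h.2 T hT
  obtain ⟨ε, hε, hgε⟩ := exists_preservesForm hg
  have hTc : IsCompact T := by
    rw [hgT]; exact (S.isCompact_prism t).image g.continuous
  have : LocallyCompactSpace (Metric.ball (0 : ℂ) 1) := Metric.isOpen_ball.locallyCompactSpace
  -- Since `K` is a neighbourhood of `T`, the tiles near `T` all meet `K` and are therefore finite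
  -- in number.
  obtain ⟨K, hK, hTK⟩ := exists_compact_superset hTc
  set 𝓕 := {T' ∈ 𝒯 | (T' ∩ K).Nonempty} \ {T} with h𝓕
  have hfin : 𝓕.Finite := (h.locallyFinite hp ht hK).subset Set.sdiff_subset
  let y : S.sideCurve 0 → SL2Cover := fun w => g (t / 2, S.sidePoint w)
  have hmid : ∀ w : S.sideCurve 0, ((t / 2, S.sidePoint w) : SL2Cover) ∈ S.prism t := by
    intro w
    refine ⟨w.2.1, ?_⟩
    rw [Set.mem_uIcc]
    rcases le_total 0 t with h | h
    · left; constructor <;> linarith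
    · right; constructor <;> linarith
  have hyT : ∀ w, y w ∈ T := fun w => by rw [hgT]; exact ⟨_, hmid w, rfl⟩
  -- Otherwise a neighbourhood of the point would be covered by `T` alone, although boundary points
  -- of the prism are not interior.
  have hother : ∀ w, ∃ T' ∈ 𝓕, y w ∈ T' := by
    intro w
    by_contra hcon
    push Not at hcon
    have hcl : IsClosed (⋃₀ 𝓕) := by
      rw [Set.sUnion_eq_biUnion]
      exact hfin.isClosed_biUnion fun T' hT' => h.1.1 T' hT'.1.1
    have hopen : IsOpen (interior K ∩ (⋃₀ 𝓕)ᶜ) := isOpen_interior.inter hcl.isOpen_compl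
    have hsub : interior K ∩ (⋃₀ 𝓕)ᶜ ⊆ T := by
      rintro Z ⟨hZK, hZ⟩
      obtain ⟨T', hT', hZT'⟩ : Z ∈ ⋃₀ 𝒯 := hcov ▸ Set.mem_univ _
      by_contra hZT
      exact hZ ⟨T', ⟨⟨hT', Z, hZT', interior_subset hZK⟩, fun hTT => hZT (hTT ▸ hZT')⟩, hZT'⟩
    have hyint : y w ∈ interior T := interior_maximal hsub hopen
      ⟨hTK (hyT w), fun ⟨T', hT', hy⟩ => hcon T' hT' hy⟩
    rw [hgT, ← g.image_interior] at hyint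
    obtain ⟨X, hX, hXy⟩ := hyint
    rw [g.injective hXy] at hX
    exact S.notMem_interior_prism hp w (t / 2) hX
  choose T' hT' hyT' using hother
  have : Infinite (S.sideCurve 0) := (S.infinite_sideCurve hp).to_subtype
  -- Pigeonhole: infinitely many mid-height points, finitely many neighbours. So one neighbour
  -- contains two of them.
  obtain ⟨w₁, -, w₂, -, hne, heq⟩ := Set.infinite_univ.exists_ne_map_eq_of_mapsTo
    (f := T') (t := 𝓕) (fun w _ => hT' w) hfin
  have hTT' : T ≠ T' w₁ := fun hh => (hT' w₁).2 hh.symm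
  rcases hff T hT (T' w₁) (hT' w₁).1.1 hTT' with hempty | ⟨hF, hF'⟩
  · exact (Set.eq_empty_iff_forall_notMem.1 hempty) (y w₁) ⟨hyT w₁, hyT' w₁⟩
  obtain ⟨g₁, hg₁, hTg₁, F, hF, hTF⟩ := hF
  obtain ⟨g₂, hg₂, hTg₂, F', hF', hTF'⟩ := hF'
  obtain ⟨ε₁, hε₁, hgε₁⟩ := exists_preservesForm hg₁
  obtain ⟨ε₂, hε₂, hgε₂⟩ := exists_preservesForm hg₂
  have hsq : ∀ {ε : ℝ}, (ε = 1 ∨ ε = -1) → ε * ε = 1 := by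
    rintro ε (rfl | rfl) <;> norm_num
  have hmulε : ∀ {ε ε' : ℝ}, (ε = 1 ∨ ε = -1) → (ε' = 1 ∨ ε' = -1) →
      (ε * ε' = 1 ∨ ε * ε' = -1) := by
    rintro ε ε' (rfl | rfl) (rfl | rfl) <;> norm_num
  obtain ⟨k, rfl⟩ : ∃ k, F = overBase (S.sideCurve k) (Set.uIcc 0 t) := by
    -- The isometry `g₁` exhibiting the face need not be `g`. They differ by a symmetry of the
    -- prism, which keeps mid-height points at mid-height.
    set e := g₁⁻¹ * g with he
    have hpe : PreservesForm (ε₁ * ε) e := (hgε₁.inv (hsq hε₁)).mul hgε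
    have heP : e '' S.prism t = S.prism t := by
      rw [he, mul_image, ← hgT, hTg₁, inv_image_image]
    have hmem : ∀ w, y w ∈ T ∩ T' w₁ → e (t / 2, S.sidePoint w) ∈ F := by
      intro w hw
      rw [hTF] at hw
      obtain ⟨Z, hZ, hZy⟩ := hw
      have : e (t / 2, S.sidePoint w) = Z := by
        change g₁.symm (y w) = Z
        rw [← hZy, g₁.symm_apply_apply]
      rwa [this]
    refine IsPrismFace.eq_side_of_mid S ht hF (hmem w₁ ⟨hyT w₁, hyT' w₁⟩)
      (hmem w₂ ⟨hyT w₂, heq ▸ hyT' w₂⟩) (S.fst_mid (hmulε hε₁ hε) hpe heP w₁.2.1) ?_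
    intro hh
    rw [hpe.snd_eq_iff] at hh
    exact hne (Subtype.ext (congrArg (fun z : Metric.ball (0 : ℂ) 1 => (z : ℂ)) hh))
  set e := g₂⁻¹ * g₁ with he
  have hpe : PreservesForm (ε₂ * ε₁) e := (hgε₂.inv (hsq hε₂)).mul hgε₁
  have heF : e '' overBase (S.sideCurve k) (Set.uIcc 0 t) = F' := by
    rw [he, mul_image, ← hTF, hTF', inv_image_image]
  -- As an image of a side face, `F'` contains points at two heights on one fibre and points of two
  -- fibres.
  obtain ⟨j, rfl⟩ : ∃ j, F' = overBase (S.sideCurve j) (Set.uIcc 0 t) := by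
    let a : S.sideCurve k := ⟨planeRotation p k (S.sideEnd (-1)), by
      rw [S.planeRotation_mem_sideCurve, sub_self]; exact S.sideEnd_mem hp (by simp)⟩
    let b : S.sideCurve k := ⟨planeRotation p k (S.sideEnd 1), by
      rw [S.planeRotation_mem_sideCurve, sub_self]; exact S.sideEnd_mem hp (by simp)⟩
    have hab : S.sidePoint a ≠ S.sidePoint b := by
      intro hh
      have h1 : planeRotation p k (S.sideEnd (-1)) = planeRotation p k (S.sideEnd 1) :=
        congrArg Subtype.val hh
      have h2 := congrArg (tangential p) ((planeRotation p k).injective h1)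
      rw [tangential_sideEnd, tangential_sideEnd] at h2
      have := mul_pos S.ρ_pos (sin_pi_div_pos hp)
      linarith
    have hmem : ∀ s ∈ Set.uIcc 0 t, ∀ w : S.sideCurve k, e (s, S.sidePoint w) ∈ F' :=
      fun s hs w => heF ▸ ⟨_, ⟨w.2, hs⟩, rfl⟩
    refine IsPrismFace.eq_side_of_fibre S hF' (hmem 0 Set.left_mem_uIcc a)
      (hmem 0 Set.left_mem_uIcc b) (hmem t Set.right_mem_uIcc a) ?_ ?_
    · intro hh
      have h1 := hpe.fst_sub (X := (0, S.sidePoint a)) (Y := (t, S.sidePoint a)) rfl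
      rw [hh, sub_self, zero_sub] at h1
      rcases hmulε hε₂ hε₁ with h2 | h2 <;> rw [h2] at h1 <;> exact ht (by linarith)
    · rw [Ne, hpe.snd_eq_iff]
      exact hab
  -- The isometry matching the common face as seen from the two tiles preserves the prism, so the
  -- tiles are equal.
  have hP := S.image_prism_of_image_side hp (hmulε hε₂ hε₁) hpe heF
  apply hTT'
  rw [hTg₁, hTg₂]
  conv_rhs => rw [← hP, he, ← mul_image, mul_inv_cancel_left]

end SL2Cover

/-! ### Groups generated by reflections in the walls of a simplicial cone -/

namespace ReflectionGroup

variable {ι : Type*} [DecidableEq ι] (c : ι → ι → ℝ)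

/-- The reflection in the `i`-th wall of the cone `{v | ∀ i, 0 ≤ v i}`, in the coordinates given by
the normals `eᵢ` of the walls: `c i j = -2⟨eᵢ, eⱼ⟩`. -/
def reflFun (i : ι) (v : ι → ℝ) : ι → ℝ := fun j => if j = i then -v j else v j + c i j * v i

theorem reflFun_same (i : ι) (v : ι → ℝ) : reflFun c i v i = -v i := if_pos rfl

theorem reflFun_of_ne {i j : ι} (h : j ≠ i) (v : ι → ℝ) :
    reflFun c i v j = v j + c i j * v i := if_neg h

theorem reflFun_involutive (i : ι) : Function.Involutive (reflFun c i) := by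
  intro v
  ext j
  by_cases h : j = i
  · subst h; rw [reflFun_same, reflFun_same, neg_neg]
  · rw [reflFun_of_ne c h, reflFun_of_ne c h, reflFun_same]; ring

/-- The reflection `reflFun` as a permutation. -/
def refl (i : ι) : Equiv.Perm (ι → ℝ) := (reflFun_involutive c i).toPerm

theorem refl_apply (i : ι) (v : ι → ℝ) : refl c i v = reflFun c i v := rfl

theorem refl_mul_self (i : ι) : refl c i * refl c i = 1 :=
  Equiv.ext fun v => reflFun_involutive c i v

theorem refl_inv (i : ι) : (refl c i)⁻¹ = refl c i := inv_eq_of_mul_eq_one_left (refl_mul_self c i)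

theorem refl_mul_cancel (i : ι) (w : Equiv.Perm (ι → ℝ)) : refl c i * (refl c i * w) = w := by
  rw [← mul_assoc, refl_mul_self, one_mul]

/-- The group generated by the reflections with index in `I`. -/
def gen (I : Set ι) : Subgroup (Equiv.Perm (ι → ℝ)) := Subgroup.closure (refl c '' I)

variable {c} {I : Set ι}

theorem refl_mem_gen {i : ι} (hi : i ∈ I) : refl c i ∈ gen c I :=
  Subgroup.subset_closure ⟨i, hi, rfl⟩

theorem gen_mono {J : Set ι} (h : I ⊆ J) : gen c I ≤ gen c J :=
  Subgroup.closure_mono (Set.image_mono h)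

variable (c) in
/-- The product of the reflections with indices in a list. -/
def word (l : List ι) : Equiv.Perm (ι → ℝ) := (l.map (refl c)).prod

theorem word_cons (i : ι) (l : List ι) : word c (i :: l) = refl c i * word c l := by
  simp [word]

theorem word_append (l l' : List ι) : word c (l ++ l') = word c l * word c l' := by
  simp [word]

theorem word_mem_gen {l : List ι} (hl : ∀ i ∈ l, i ∈ I) : word c l ∈ gen c I := by
  induction l with
  | nil => exact one_mem _
  | cons i l ih =>
    rw [word_cons]
    exact mul_mem (refl_mem_gen (hl i (by simp))) (ih fun j hj => hl j (by simp [hj]))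

theorem word_inv (l : List ι) : (word c l)⁻¹ = word c l.reverse := by
  induction l with
  | nil => simp [word]
  | cons i l ih =>
    rw [word_cons, mul_inv_rev, ih, refl_inv, List.reverse_cons, word_append]
    simp [word]

theorem exists_word {w : Equiv.Perm (ι → ℝ)} (hw : w ∈ gen c I) :
    ∃ l : List ι, (∀ i ∈ l, i ∈ I) ∧ word c l = w := by
  induction hw using Subgroup.closure_induction with
  | mem x hx =>
    obtain ⟨i, hi, rfl⟩ := hx
    exact ⟨[i], by simpa using hi, by simp [word]⟩
  | one => exact ⟨[], by simp, rfl⟩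
  | mul x y _ _ hx hy =>
    obtain ⟨l, hl, rfl⟩ := hx
    obtain ⟨l', hl', rfl⟩ := hy
    refine ⟨l ++ l', fun i hi => ?_, word_append l l'⟩
    rcases List.mem_append.1 hi with h | h
    exacts [hl i h, hl' i h]
  | inv x _ hx =>
    obtain ⟨l, hl, rfl⟩ := hx
    exact ⟨l.reverse, fun i hi => hl i (List.mem_reverse.1 hi), (word_inv l).symm⟩

variable (c I) in
/-- The length of an element with respect to the reflections with index in `I`. -/
noncomputable def len (w : Equiv.Perm (ι → ℝ)) : ℕ :=
  sInf {n | ∃ l : List ι, (∀ i ∈ l, i ∈ I) ∧ l.length = n ∧ word c l = w}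

theorem len_word_le {l : List ι} (hl : ∀ i ∈ l, i ∈ I) : len c I (word c l) ≤ l.length :=
  Nat.sInf_le ⟨l, hl, rfl, rfl⟩

theorem exists_reduced_word {w : Equiv.Perm (ι → ℝ)} (hw : w ∈ gen c I) :
    ∃ l : List ι, (∀ i ∈ l, i ∈ I) ∧ l.length = len c I w ∧ word c l = w := by
  obtain ⟨l, hl, h⟩ := exists_word hw
  exact Nat.sInf_mem (s := {n | ∃ l : List ι, (∀ i ∈ l, i ∈ I) ∧ l.length = n ∧ word c l = w})
    ⟨l.length, l, hl, rfl, h⟩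

theorem len_mul_le {w w' : Equiv.Perm (ι → ℝ)} (hw : w ∈ gen c I) (hw' : w' ∈ gen c I) :
    len c I (w * w') ≤ len c I w + len c I w' := by
  obtain ⟨l, hl, h1, rfl⟩ := exists_reduced_word hw
  obtain ⟨l', hl', h2, rfl⟩ := exists_reduced_word hw'
  rw [← word_append, ← h1, ← h2, ← List.length_append]
  apply len_word_le
  intro i hi
  rcases List.mem_append.1 hi with h | h
  exacts [hl i h, hl' i h]

theorem len_le_of_subset {J : Set ι} (h : I ⊆ J) {w : Equiv.Perm (ι → ℝ)} (hw : w ∈ gen c I) :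
    len c J w ≤ len c I w := by
  obtain ⟨l, hl, h1, rfl⟩ := exists_reduced_word hw
  rw [← h1]
  exact len_word_le fun i hi => h (hl i hi)

theorem len_one : len c I 1 = 0 := by
  have := len_word_le (c := c) (I := I) (l := []) (by simp)
  simpa [word] using this

theorem len_refl_mul_le {i : ι} (hi : i ∈ I) {w : Equiv.Perm (ι → ℝ)} (hw : w ∈ gen c I) :
    len c I (refl c i * w) ≤ len c I w + 1 := by
  obtain ⟨l, hl, h1, rfl⟩ := exists_reduced_word hw
  rw [← h1, ← word_cons, ← List.length_cons (a := i)]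
  apply len_word_le
  intro j hj
  rcases List.mem_cons.1 hj with rfl | h
  exacts [hi, hl j h]

/-! #### Dihedral subgroups -/

variable (c) in
/-- The alternating product `sᵢ sⱼ sᵢ ⋯` with `n` factors. -/
def alt (i j : ι) : ℕ → Equiv.Perm (ι → ℝ)
  | 0 => 1
  | n + 1 => refl c i * alt j i n

theorem alt_mem_gen (i j : ι) (n : ℕ) : alt c i j n ∈ gen c {i, j} := by
  induction n generalizing i j with
  | zero => exact one_mem _
  | succ n ih =>
    refine mul_mem (refl_mem_gen (by simp)) ?_
    rw [Set.pair_comm]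
    exact ih j i

theorem len_alt_le (i j : ι) (n : ℕ) : len c {i, j} (alt c i j n) ≤ n := by
  induction n generalizing i j with
  | zero => exact len_one.le
  | succ n ih =>
    have h1 := ih j i
    have h2 := alt_mem_gen (c := c) j i n
    rw [Set.pair_comm] at h1 h2
    exact (len_refl_mul_le (by simp) h2).trans (Nat.succ_le_succ h1)

/-- Up to the factor `sin θ`, the coordinates of the images under alternating products. -/
noncomputable def altCoord (θ : ℝ) (n : ℕ) (x y : ℝ) : ℝ :=
  if Even n then Real.sin ((n - 1) * θ) * x + Real.sin (n * θ) * y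
  else Real.sin (n * θ) * x + Real.sin ((n - 1) * θ) * y

/-- This is the Chebyshev recursion for `sin (nθ)`. The arguments are swapped at each step because
`alt` strips its leading letter. -/
theorem altCoord_rec (θ : ℝ) (n : ℕ) (x y : ℝ) : altCoord θ (n + 2) y x =
    2 * Real.cos θ * altCoord θ (n + 1) x y - altCoord θ n y x := by
  have h : ∀ t : ℝ, Real.sin (t + θ) + Real.sin (t - θ) = 2 * Real.cos θ * Real.sin t := by
    intro t; rw [Real.sin_add, Real.sin_sub]; ring
  have h1 := h ((n + 1 : ℕ) * θ)
  have h2 := h (n * θ)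
  have e1 : ((n + 1 : ℕ) : ℝ) * θ + θ = (n + 2 : ℕ) * θ := by push_cast; ring
  have e2 : ((n + 1 : ℕ) : ℝ) * θ - θ = n * θ := by push_cast; ring
  have e3 : (n : ℝ) * θ + θ = (n + 1 : ℕ) * θ := by push_cast; ring
  have e4 : (n : ℝ) * θ - θ = (n - 1) * θ := by ring
  have e5 : (((n + 2 : ℕ) : ℝ) - 1) = (n + 1 : ℕ) := by push_cast; ring
  have e6 : (((n + 1 : ℕ) : ℝ) - 1) = (n : ℕ) := by push_cast; ring
  rw [e1, e2] at h1
  rw [e3, e4] at h2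
  rw [altCoord, altCoord, altCoord, e5, e6]
  rcases Nat.even_or_odd n with hn | hn
  · rw [if_pos (by simpa [Nat.even_add] using hn), if_neg (by simpa [Nat.even_add_one] using hn),
      if_pos hn]
    linear_combination x * h1 + y * h2
  · have hn' : ¬Even n := Nat.not_even_iff_odd.2 hn
    rw [if_neg (by simpa [Nat.even_add] using hn'), if_pos (by simpa [Nat.even_add_one] using hn'),
      if_neg hn']
    linear_combination y * h1 + x * h2

/-- For `1 ≤ n ≤ m` both angles lie in `[0, π]`, so both sines are nonnegative and at least one is
positive. -/
theorem altCoord_pos {m n : ℕ} (hm : 2 ≤ m) (hn : 1 ≤ n) (hnm : n ≤ m) {x y : ℝ} (hx : 0 < x)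
    (hy : 0 < y) : 0 < altCoord (Real.pi / m) n x y := by
  have hm0 : (0 : ℝ) < m := by exact_mod_cast (by omega : 0 < m)
  have hpi := Real.pi_pos
  have hpos : ∀ k : ℝ, 0 < k → k < m → 0 < Real.sin (k * (Real.pi / m)) := by
    intro k hk hkm
    apply Real.sin_pos_of_pos_of_lt_pi (by positivity)
    rw [← mul_div_assoc, div_lt_iff₀ hm0]
    nlinarith
  have hn' : (n : ℝ) ≤ m := by exact_mod_cast hnm
  rcases hn.eq_or_lt with rfl | h2
  · rw [altCoord, if_neg (by decide)]
    have h2m : (2 : ℝ) ≤ m := by exact_mod_cast hm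
    have := hpos 1 one_pos (by linarith)
    simp only [Nat.cast_one, sub_self, zero_mul, Real.sin_zero, add_zero]
    positivity
  · have h2n : (2 : ℝ) ≤ n := by exact_mod_cast h2
    have h3 := hpos (n - 1) (by linarith) (by linarith)
    have h4 : 0 ≤ Real.sin (n * (Real.pi / m)) := by
      rcases hn'.eq_or_lt with h | h
      · rw [h, mul_div_cancel₀ _ hm0.ne', Real.sin_pi]
      · exact (hpos n (by linarith) h).le
    rw [altCoord]
    split_ifs <;> positivity

theorem altCoord_antipodal {m : ℕ} (hm : 2 ≤ m) (x y : ℝ) :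
    altCoord (Real.pi / m) (m + 1) x y = -altCoord (Real.pi / m) m x y := by
  have hm0 : (m : ℝ) ≠ 0 := by exact_mod_cast (by omega : m ≠ 0)
  have e1 : (m : ℝ) * (Real.pi / m) = Real.pi := mul_div_cancel₀ _ hm0
  have e2 : ((m + 1 : ℕ) : ℝ) * (Real.pi / m) = Real.pi / m + Real.pi := by
    push_cast; rw [add_mul, e1]; ring
  have e3 : ((m : ℝ) - 1) * (Real.pi / m) = Real.pi - Real.pi / m := by
    rw [sub_mul, e1]; ring
  have e4 : (((m + 1 : ℕ) : ℝ) - 1) = (m : ℕ) := by push_cast; ring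
  rw [altCoord, altCoord, e4, e1, e2, e3, Real.sin_pi, Real.sin_add_pi, Real.sin_pi_sub]
  rcases Nat.even_or_odd m with hn | hn
  · rw [if_neg (by simpa [Nat.even_add_one] using hn), if_pos hn]; ring
  · have hn' : ¬Even m := Nat.not_even_iff_odd.2 hn
    rw [if_pos (by simpa [Nat.even_add_one] using hn'), if_neg hn']; ring

/-- The numbers `c i j` are those of a cone with dihedral angles `π / m i j`. -/
structure IsAngles (c : ι → ι → ℝ) (m : ι → ι → ℕ) : Prop where
  two_le : ∀ i j, 2 ≤ m i j
  symm : ∀ i j, m i j = m j i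
  eq_cos : ∀ i j, i ≠ j → c i j = 2 * Real.cos (Real.pi / m i j)

variable {m : ι → ι → ℕ}

theorem alt_apply (hc : IsAngles c m) {i j : ι} (hij : i ≠ j) (n : ℕ) (v : ι → ℝ) :
    Real.sin (Real.pi / m i j) * alt c i j n v i = -altCoord (Real.pi / m i j) n (v i) (v j) ∧
    Real.sin (Real.pi / m i j) * alt c i j n v j =
      altCoord (Real.pi / m i j) (n + 1) (v j) (v i) := by
  induction n generalizing i j with
  | zero => simp [alt, altCoord]
  | succ n ih =>
    obtain ⟨h1, h2⟩ := ih hij.symm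
    rw [hc.symm j i] at h1 h2
    have e : alt c i j (n + 1) v = reflFun c i (alt c j i n v) := rfl
    rw [e, reflFun_same, reflFun_of_ne c hij.symm, altCoord_rec]
    constructor
    · rw [mul_neg, h2]
    · rw [mul_add, h1, hc.eq_cos i j hij]
      linear_combination 2 * Real.cos (Real.pi / m i j) * h2

theorem sin_angle_pos {κ : Type*} {c : κ → κ → ℝ} {m : κ → κ → ℕ} (hc : IsAngles c m) (i j : κ) : 0 < Real.sin (Real.pi / m i j) := by
  have h2 : (2 : ℝ) ≤ m i j := by exact_mod_cast hc.two_le i j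
  apply Real.sin_pos_of_pos_of_lt_pi (by have := Real.pi_pos; positivity)
  rw [div_lt_iff₀ (by linarith)]
  nlinarith [Real.pi_pos]

/-- The equations for `a` and `b` make `v r + a v i + b v j` invariant under both reflections, so
the remaining coordinates are determined by those with index `i` and `j`. -/
theorem alt_apply_third {i j r : ι} (hi : r ≠ i) (hj : r ≠ j) (hij : i ≠ j) {a b : ℝ}
    (ha : c i r - 2 * a + b * c i j = 0) (hb : c j r - 2 * b + a * c j i = 0) (n : ℕ) (v : ι → ℝ) :
    alt c i j n v r + a * alt c i j n v i + b * alt c i j n v j = v r + a * v i + b * v j := by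
  induction n generalizing i j a b with
  | zero => rfl
  | succ n ih =>
    have h := ih hj hi hij.symm hb ha
    have e : alt c i j (n + 1) v = reflFun c i (alt c j i n v) := rfl
    rw [e, reflFun_same, reflFun_of_ne c hij.symm, reflFun_of_ne c hi]
    linear_combination h + alt c j i n v i * ha

/-- The braid relation. On the coordinates `i` and `j` it follows from the closed form at the
half-turn, and on the others from the invariant functional. -/
theorem alt_comm (hc : IsAngles c m) {i j : ι} (hij : i ≠ j) : alt c i j (m i j) = alt c j i (m i j) := by
  have hs := sin_angle_pos hc i j
  have hi : ∀ v, alt c i j (m i j) v i = alt c j i (m i j) v i := by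
    intro v
    have h1 := (alt_apply hc hij (m i j) v).1
    have h2 := (alt_apply hc hij.symm (m i j) v).2
    rw [hc.symm j i, altCoord_antipodal (hc.two_le i j)] at h2
    exact mul_left_cancel₀ hs.ne' (h1.trans h2.symm)
  have hj : ∀ v, alt c i j (m i j) v j = alt c j i (m i j) v j := by
    intro v
    have h1 := (alt_apply hc hij (m i j) v).2
    have h2 := (alt_apply hc hij.symm (m i j) v).1
    rw [hc.symm j i] at h2
    rw [altCoord_antipodal (hc.two_le i j)] at h1
    exact mul_left_cancel₀ hs.ne' (h1.trans h2.symm)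
  ext v r
  by_cases h1 : r = i
  · rw [h1, hi]
  by_cases h2 : r = j
  · rw [h2, hj]
  have hcij : c j i = c i j := by rw [hc.eq_cos i j hij, hc.eq_cos j i hij.symm, hc.symm]
  -- Up to a factor this is the Gram determinant of the two normals, nonzero since the angle is not
  -- a multiple of `π`; it makes the system for `a`, `b` solvable.
  have hd : 4 - c i j ^ 2 ≠ 0 := by
    rw [hc.eq_cos i j hij]
    have := Real.sin_sq_add_cos_sq (Real.pi / m i j)
    have h3 : 0 < Real.sin (Real.pi / m i j) ^ 2 := by positivity
    nlinarith
  obtain ⟨a, b, ha, hb⟩ : ∃ a b : ℝ, c i r - 2 * a + b * c i j = 0 ∧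
      c j r - 2 * b + a * c j i = 0 := by
    refine ⟨(2 * c i r + c i j * c j r) / (4 - c i j ^ 2),
      (2 * c j r + c i j * c i r) / (4 - c i j ^ 2), ?_, ?_⟩
    · field_simp; ring
    · rw [hcij]; field_simp; ring
  have e1 := alt_apply_third h1 h2 hij ha hb (m i j) v
  have e2 := alt_apply_third h2 h1 hij.symm hb ha (m i j) v
  rw [hi, hj] at e1
  linarith

/-- A new leading letter cancels the old one or lengthens the alternating product. At the maximal
length the braid relation lets the product start with the same letter, so it cancels there too. -/
theorem exists_alt_refl_mul (hc : IsAngles c m) {i j : ι} (hij : i ≠ j) {n : ℕ} (hn : n ≤ m i j)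
    {w : Equiv.Perm (ι → ℝ)} (hw : w = alt c i j n ∨ w = alt c j i n) :
    ∃ k ≤ m i j, k ≤ n + 1 ∧ (refl c i * w = alt c i j k ∨ refl c i * w = alt c j i k) := by
  rcases hw with rfl | rfl
  · cases n with
    | zero => exact ⟨1, by have := hc.two_le i j; omega, le_rfl, Or.inl rfl⟩
    | succ n =>
      refine ⟨n, by omega, by omega, Or.inr ?_⟩
      rw [alt, refl_mul_cancel]
  · rcases hn.eq_or_lt with rfl | hlt
    · obtain ⟨k, hk⟩ : ∃ k, m i j = k + 1 :=
        ⟨m i j - 1, by have := hc.two_le i j; omega⟩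
      refine ⟨k, by omega, by omega, Or.inr ?_⟩
      rw [← alt_comm hc hij, hk, alt, refl_mul_cancel]
    · exact ⟨n + 1, hlt, le_rfl, Or.inl rfl⟩

theorem exists_alt_of_word (hc : IsAngles c m) {i j : ι} (hij : i ≠ j) {l : List ι}
    (hl : ∀ k ∈ l, k ∈ ({i, j} : Set ι)) :
    ∃ n ≤ m i j, n ≤ l.length ∧ (word c l = alt c i j n ∨ word c l = alt c j i n) := by
  induction l with
  | nil => exact ⟨0, Nat.zero_le _, le_rfl, Or.inl rfl⟩
  | cons a l ih =>
    obtain ⟨n, hn, hnl, h⟩ := ih fun k hk => hl k (by simp [hk])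
    rw [word_cons]
    rcases hl a (by simp) with rfl | ha
    · obtain ⟨k, hk, hkn, h'⟩ := exists_alt_refl_mul hc hij hn h
      exact ⟨k, hk, hkn.trans (Nat.succ_le_succ hnl), h'⟩
    · rw [Set.mem_singleton_iff] at ha
      subst ha
      rw [hc.symm] at hn ⊢
      obtain ⟨k, hk, hkn, h'⟩ := exists_alt_refl_mul hc hij.symm hn h.symm
      exact ⟨k, hk, hkn.trans (Nat.succ_le_succ hnl), h'.symm⟩

theorem finite_gen_pair (hc : IsAngles c m) {i j : ι} (hij : i ≠ j) :
    (gen c {i, j} : Set (Equiv.Perm (ι → ℝ))).Finite := by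
  refine (((Set.finite_Iic (m i j)).image (alt c i j)).union
    ((Set.finite_Iic (m i j)).image (alt c j i))).subset ?_
  intro w hw
  obtain ⟨l, hl, rfl⟩ := exists_word hw
  obtain ⟨n, hn, -, h | h⟩ := exists_alt_of_word hc hij hl
  · exact Or.inl ⟨n, hn, h.symm⟩
  · exact Or.inr ⟨n, hn, h.symm⟩

/-- The `i`-th coordinate is negative precisely when the alternating product can be written with
leading letter `i`, and then that letter can be removed. -/
theorem dihedral_dichotomy (hc : IsAngles c m) {i j : ι} (hij : i ≠ j) {u : Equiv.Perm (ι → ℝ)}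
    (hu : u ∈ gen c {i, j}) {v : ι → ℝ} (hi : 0 < v i) (hj : 0 < v j) :
    0 < u v i ∨ (u v i < 0 ∧ len c {i, j} (refl c i * u) + 1 ≤ len c {i, j} u) := by
  obtain ⟨l, hl, hlen, rfl⟩ := exists_reduced_word hu
  have hs := sin_angle_pos hc i j
  obtain ⟨n, hn, hnl, h⟩ := exists_alt_of_word hc hij hl
  rw [← hlen]
  have key : ∀ k, k ≤ m i j → k ≤ l.length → word c l = alt c i j k → 1 ≤ k →
      (word c l v i < 0 ∧ len c {i, j} (refl c i * word c l) + 1 ≤ l.length) := by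
    intro k hkm hkl hk hk1
    constructor
    · have h1 := (alt_apply hc hij k v).1
      have h2 := altCoord_pos (hc.two_le i j) hk1 hkm hi hj
      rw [hk]
      by_contra h3
      push Not at h3
      have := mul_nonneg hs.le h3
      linarith
    · obtain ⟨k, rfl⟩ : ∃ k', k = k' + 1 := ⟨k - 1, by omega⟩
      rw [hk, alt, refl_mul_cancel]
      have := len_alt_le (c := c) j i k
      rw [Set.pair_comm] at this
      omega
  rcases h with h | h
  · rcases Nat.eq_zero_or_pos n with rfl | hpos
    · left; rw [h]; exact hi
    · right; exact key n hn hnl h hpos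
  · rcases hn.eq_or_lt with rfl | hlt
    · right
      exact key _ le_rfl hnl (h.trans (alt_comm hc hij).symm) (by have := hc.two_le i j; omega)
    · left
      have h1 := (alt_apply hc hij.symm n v).2
      rw [hc.symm j i] at h1
      have h2 := altCoord_pos (hc.two_le i j) (Nat.succ_le_succ (Nat.zero_le n)) hlt hi hj
      rw [h]
      rw [← h1] at h2
      exact pos_of_mul_pos_right h2 hs.le

/-! #### Tits' theorem -/

/-- Tits' dichotomy: the sign of a coordinate of the image of an interior point of the cone is
determined by the length. -/
theorem tits_dichotomy (hc : IsAngles c m) {v : ι → ℝ} (hv : ∀ i, 0 < v i) (n : ℕ) :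
    ∀ w ∈ gen c Set.univ, len c Set.univ w = n →
      (∀ i, 0 < w v i ∨ (w v i < 0 ∧ len c Set.univ (refl c i * w) + 1 ≤ len c Set.univ w)) ∧
      (∀ i j, i ≠ j → ∃ u ∈ gen c {i, j}, 0 < (u⁻¹ * w) v i ∧ 0 < (u⁻¹ * w) v j ∧
        len c {i, j} u + len c Set.univ (u⁻¹ * w) ≤ len c Set.univ w) := by
  induction n with
  | zero =>
    intro w hw hlen
    obtain ⟨l, -, hl, rfl⟩ := exists_reduced_word hw
    rw [hlen, List.length_eq_zero_iff] at hl
    subst hl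
    refine ⟨fun i => Or.inl (hv i), fun i j hij => ⟨1, one_mem _, ?_⟩⟩
    rw [inv_one, one_mul, len_one, zero_add]
    exact ⟨hv i, hv j, le_rfl⟩
  | succ n ih =>
    intro w hw hlen
    -- The two halves are proved together by induction on the length: signs for `w` use the dihedral
    -- factorisation of a shorter element, and the factorisation of `w` uses its signs.
    have hP : ∀ i, 0 < w v i ∨
        (w v i < 0 ∧ len c Set.univ (refl c i * w) + 1 ≤ len c Set.univ w) := by
      intro i
      obtain ⟨l, -, hl, hlw⟩ := exists_reduced_word hw
      obtain _ | ⟨t, l⟩ := l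
      · rw [hlen] at hl; simp at hl
      rw [word_cons] at hlw
      set w' := word c l with hw'_def
      have hw' : w' ∈ gen c Set.univ := word_mem_gen fun _ _ => Set.mem_univ _
      have hlen' : len c Set.univ w' = n := by
        apply le_antisymm
        · have := len_word_le (c := c) (I := Set.univ) (l := l) fun _ _ => Set.mem_univ _
          rw [← hw'_def] at this
          rw [hlen, List.length_cons] at hl
          omega
        · have := len_refl_mul_le (c := c) (Set.mem_univ t) hw'
          rw [hlw] at this
          omega
      obtain ⟨hP', hQ'⟩ := ih w' hw' hlen'
      by_cases hti : i = t
      · subst hti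
        have hwv : w v i = -w' v i := by rw [← hlw]; exact reflFun_same c i (w' v)
        rcases hP' i with h | ⟨-, h⟩
        · right
          refine ⟨by linarith, ?_⟩
          rw [← hlw, refl_mul_cancel, hlw]
          omega
        · rw [hlw] at h; omega
      -- Peel off from `w'` its factor in the dihedral group of `i` and `t`. The rest sends `v` to a
      -- point positive on both walls, so the sign question moves into that dihedral group and
      -- lengths add up.
      · obtain ⟨u, hu, hui, hut, hul⟩ := hQ' i t hti
        have htu : refl c t * u ∈ gen c {i, t} := mul_mem (refl_mem_gen (by simp)) hu
        have hwv : w v = (refl c t * u) ((u⁻¹ * w') v) := by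
          rw [← Equiv.Perm.mul_apply, ← hlw]; congr 1; group
        have huw : u⁻¹ * w' ∈ gen c Set.univ :=
          mul_mem (inv_mem (gen_mono (Set.subset_univ _) hu)) hw'
        rcases dihedral_dichotomy hc hti htu hui hut with h | ⟨h, hl2⟩
        · left; rw [hwv]; exact h
        · right
          refine ⟨by rw [hwv]; exact h, ?_⟩
          have hstu : refl c i * (refl c t * u) ∈ gen c {i, t} :=
            mul_mem (refl_mem_gen (by simp)) htu
          have e1 : refl c i * w = (refl c i * (refl c t * u)) * (u⁻¹ * w') := by
            rw [← hlw]; group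
          have e2 := len_mul_le (gen_mono (Set.subset_univ _) hstu) huw
          have e3 := len_le_of_subset (Set.subset_univ {i, t}) hstu
          have e4 := len_refl_mul_le (c := c) (i := t) (I := {i, t}) (by simp) hu
          rw [e1]
          omega
    -- If the `i`-th coordinate is negative, `refl c i * w` is shorter; its factorisation,
    -- multiplied by the reflection, is one for `w`.
    have hside : ∀ i j, i ≠ j → ¬ 0 < w v i → ∃ u ∈ gen c {i, j}, 0 < (u⁻¹ * w) v i ∧
        0 < (u⁻¹ * w) v j ∧
        len c {i, j} u + len c Set.univ (u⁻¹ * w) ≤ len c Set.univ w := by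
      intro i j hij hneg
      obtain ⟨-, hl⟩ := (hP i).resolve_left hneg
      have hsw : refl c i * w ∈ gen c Set.univ := mul_mem (refl_mem_gen (Set.mem_univ i)) hw
      have hlsw : len c Set.univ (refl c i * w) = n := by
        have := len_refl_mul_le (c := c) (Set.mem_univ i) hsw
        rw [refl_mul_cancel] at this
        omega
      obtain ⟨u, hu, hui, huj, hul⟩ := (ih _ hsw hlsw).2 i j hij
      have e : (refl c i * u)⁻¹ * w = u⁻¹ * (refl c i * w) := by
        rw [mul_inv_rev, refl_inv, mul_assoc]
      have e4 := len_refl_mul_le (c := c) (i := i) (I := {i, j}) (by simp) hu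
      refine ⟨refl c i * u, mul_mem (refl_mem_gen (by simp)) hu, ?_⟩
      rw [e]
      exact ⟨hui, huj, by omega⟩
    refine ⟨hP, fun i j hij => ?_⟩
    by_cases h1 : 0 < w v i
    · by_cases h2 : 0 < w v j
      · refine ⟨1, one_mem _, ?_⟩
        rw [inv_one, one_mul, len_one, zero_add]
        exact ⟨h1, h2, le_rfl⟩
      · obtain ⟨u, hu, huj, hui, hul⟩ := hside j i hij.symm h2
        rw [Set.pair_comm] at hu hul
        exact ⟨u, hu, hui, huj, hul⟩
    · exact hside i j hij h1

/-- An element of the reflection group that takes an interior point of the cone into the cone is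
trivial. -/
theorem eq_one_of_nonneg (hc : IsAngles c m) {v : ι → ℝ} (hv : ∀ i, 0 < v i) {w : Equiv.Perm (ι → ℝ)}
    (hw : w ∈ gen c Set.univ) (h : ∀ i, 0 ≤ w v i) : w = 1 := by
  obtain ⟨l, -, hl, hlw⟩ := exists_reduced_word hw
  obtain _ | ⟨i, l⟩ := l
  · exact hlw.symm
  exfalso
  rw [word_cons] at hlw
  have hw' : word c l ∈ gen c Set.univ := word_mem_gen fun _ _ => Set.mem_univ _
  have h1 := len_word_le (c := c) (I := Set.univ) (l := l) fun _ _ => Set.mem_univ _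
  rw [List.length_cons] at hl
  -- With leading letter `i` removed the coordinate becomes negative, so by the dichotomy restoring
  -- the letter would shorten the word, contrary to reducedness.
  have hpos : 0 < w v i := ((tits_dichotomy hc hv _ w hw rfl).1 i).resolve_right
    fun hn => absurd hn.1 (not_lt.2 (h i))
  have hwv : w v i = -word c l v i := by rw [← hlw]; exact reflFun_same c i _
  rcases (tits_dichotomy hc hv _ _ hw' rfl).1 i with h2 | ⟨-, h2⟩
  · linarith
  · rw [hlw] at h2; omega

end ReflectionGroup

/-! ### Covering by the chambers. -/

namespace ReflectionGroup

variable {ι : Type*} [DecidableEq ι] {c : ι → ι → ℝ}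

theorem continuous_refl (i : ι) : Continuous (refl c i) := by
  refine continuous_pi fun j => ?_
  change Continuous fun v => reflFun c i v j
  by_cases h : j = i
  · subst h; simp only [reflFun_same]; fun_prop
  · simp only [reflFun_of_ne c h]; fun_prop

theorem continuous_of_mem_gen {I : Set ι} {w : Equiv.Perm (ι → ℝ)} (hw : w ∈ gen c I) :
    Continuous w := by
  obtain ⟨l, -, rfl⟩ := exists_word hw
  clear hw
  induction l with
  | nil => exact continuous_id
  | cons i l ih =>
    rw [word_cons]
    exact (continuous_refl i).comp ih

theorem gen_fixes {I : Set ι} {v : ι → ℝ} (hv : ∀ i ∈ I, v i = 0) {w : Equiv.Perm (ι → ℝ)}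
    (hw : w ∈ gen c I) : w v = v := by
  obtain ⟨l, hl, rfl⟩ := exists_word hw
  clear hw
  induction l with
  | nil => rfl
  | cons i l ih =>
    have hl' : ∀ j ∈ l, j ∈ I := fun j hj => hl j (by simp [hj])
    rw [word_cons, Equiv.Perm.mul_apply, ih hl']
    ext j
    have hi := hv i (hl i (by simp))
    rw [refl_apply]
    by_cases h : j = i
    · subst h; rw [reflFun_same, hi, neg_zero]
    · rw [reflFun_of_ne c h, hi, mul_zero, add_zero]

/-- A finite reflection group moves every point to the positive side of the walls. -/
theorem exists_nonneg_of_finite {I : Set ι} (hfin : (gen c I : Set (Equiv.Perm (ι → ℝ))).Finite)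
    {f : (ι → ℝ) → ℝ} {κ : ι → ℝ} (hκ : ∀ i, 0 < κ i)
    (hf : ∀ i v, f (refl c i v) = f v + κ i * v i) (v : ι → ℝ) :
    ∃ u ∈ gen c I, ∀ i ∈ I, 0 ≤ u v i := by
  -- At a point of minimal height in the orbit, a reflection cannot lower the height, and the change
  -- is a positive multiple of the coordinate.
  obtain ⟨u, hu, hmin⟩ := Set.exists_min_image _ (fun u : Equiv.Perm (ι → ℝ) => f (u v)) hfin
    ⟨1, one_mem _⟩
  refine ⟨u, hu, fun i hi => ?_⟩
  have h1 := hmin (refl c i * u) (mul_mem (refl_mem_gen hi) hu)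
  rw [Equiv.Perm.mul_apply, hf] at h1
  exact nonneg_of_mul_nonneg_right (by linarith) (hκ i)

/-- The images of the cone under a reflection group of rank three cover every subset of the space
that is invariant under the reflections and on which a suitable height function is proper. -/
theorem exists_nonneg {c : Fin 3 → Fin 3 → ℝ} {m : Fin 3 → Fin 3 → ℕ} (hc : IsAngles c m)
    {D : Type*} [TopologicalSpace D] {a : D → Fin 3 → ℝ} (ha : Continuous a)
    (hinv : ∀ i z, ∃ z', a z' = refl c i (a z)) {f : (Fin 3 → ℝ) → ℝ} (hfc : Continuous f)
    (hf0 : f 0 = 0) {κ : Fin 3 → ℝ} (hκ : ∀ i, 0 < κ i)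
    (hf : ∀ i v, f (refl c i v) = f v + κ i * v i) (hpos : ∀ z, 0 < f (a z))
    (hproper : ∀ M, IsCompact {z | f (a z) ≤ M}) (z₀ : D) :
    ∃ w ∈ gen c Set.univ, ∀ i, 0 ≤ w (a z₀) i := by
  have hfa : Continuous fun z => f (a z) := hfc.comp ha
  let O : Set D := {z | ∃ w ∈ gen c Set.univ, a z = w (a z₀)}
  let K : Set D := {z | f (a z) ≤ f (a z₀)}
  have hOK : z₀ ∈ O ∩ K := ⟨⟨1, one_mem _, rfl⟩, le_refl (f (a z₀))⟩
  have hKcl : IsClosed K := isClosed_le hfa continuous_const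
  have hcomp : IsCompact (closure (O ∩ K)) :=
    (hproper _).of_isClosed_subset isClosed_closure
      (closure_minimal Set.inter_subset_right hKcl)
  -- The minimum is taken over the closure of the orbit, as discreteness is not known here. The
  -- minimiser `z` lies in the cone, since reflecting a nearby orbit point in a violated wall would
  -- give a lower one.
  obtain ⟨z, hz, hmin⟩ := hcomp.exists_isMinOn ⟨z₀, subset_closure hOK⟩ hfa.continuousOn
  have hzK : f (a z) ≤ f (a z₀) := hmin (subset_closure hOK)
  have hnonneg : ∀ i, 0 ≤ a z i := by
    intro i
    by_contra hneg
    push Not at hneg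
    have hlt : f (refl c i (a z)) < f (a z) := by
      rw [hf]; nlinarith [hκ i]
    have hev : ∀ᶠ y in nhds z, f (refl c i (a y)) < f (a z) :=
      (hfc.comp ((continuous_refl i).comp ha)).continuousAt.eventually (gt_mem_nhds hlt)
    obtain ⟨y, hy1, ⟨w, hw, hyw⟩, hyK⟩ := mem_closure_iff_nhds.1 hz _ hev
    obtain ⟨y', hy'⟩ := hinv i y
    have hy1' : f (a y') < f (a z) := by rw [hy']; exact hy1
    have hmem : y' ∈ O ∩ K := by
      refine ⟨⟨refl c i * w, mul_mem (refl_mem_gen (Set.mem_univ i)) hw, ?_⟩, ?_⟩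
      · rw [hy', hyw]; rfl
      · exact hy1'.le.trans hzK
    exact absurd (hmin (subset_closure hmem)) (not_le.2 hy1')
  -- The walls through `z`. Not all three contain it, because the height vanishes at `0`, so they
  -- generate a finite subgroup, contained in a dihedral one.
  let J : Set (Fin 3) := {i | a z i = 0}
  obtain ⟨k, hk⟩ : ∃ k, k ∉ J := by
    by_contra hall
    push Not at hall
    have h0 : a z = 0 := funext fun i => hall i
    have := hpos z
    rw [h0, hf0] at this
    exact lt_irrefl _ this
  have hfin : (gen c J : Set (Equiv.Perm (Fin 3 → ℝ))).Finite := by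
    obtain ⟨i, j, hij, hJ⟩ : ∃ i j : Fin 3, i ≠ j ∧ J ⊆ {i, j} := by
      have : ∀ k : Fin 3, ∃ i j : Fin 3, i ≠ j ∧ ∀ r, r ≠ k → r = i ∨ r = j := by decide
      obtain ⟨i, j, hij, h⟩ := this k
      exact ⟨i, j, hij, fun r hr => h r fun hrk => hk (hrk ▸ hr)⟩
    exact (finite_gen_pair hc hij).subset (gen_mono hJ)
  have hev : ∀ᶠ y in nhds z, ∀ u ∈ (gen c J : Set (Equiv.Perm (Fin 3 → ℝ))),
      ∀ i, i ∉ J → 0 < u (a y) i := by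
    rw [Filter.eventually_all_finite hfin]
    intro u hu
    rw [Filter.eventually_all]
    intro i
    by_cases hi : i ∈ J
    · exact Filter.Eventually.of_forall fun y h => absurd hi h
    · have h1 : 0 < u (a z) i := by
        rw [gen_fixes (fun i hi => hi) hu]
        exact lt_of_le_of_ne (hnonneg i) fun h => hi h.symm
      have h2 : Continuous fun y => u (a y) i :=
        (continuous_apply i).comp ((continuous_of_mem_gen hu).comp ha)
      exact (h2.continuousAt.eventually (lt_mem_nhds h1)).mono fun y hy _ => hy
  -- An orbit point near `z` stays positive on the other walls under this finite group, which can
  -- make it nonnegative on the walls in `J`.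
  obtain ⟨y, hy, ⟨w, hw, hyw⟩, -⟩ := mem_closure_iff_nhds.1 hz _ hev
  obtain ⟨u, hu, hui⟩ := exists_nonneg_of_finite hfin hκ hf (a y)
  refine ⟨u * w, mul_mem (gen_mono (Set.subset_univ _) hu) hw, fun i => ?_⟩
  rw [Equiv.Perm.mul_apply, ← hyw]
  by_cases hi : i ∈ J
  · exact hui i hi
  · exact (hy u hu i hi).le

end ReflectionGroup

namespace SL2Cover

open ComplexConjugate

/-! ### Lifts of collineations -/

/-- The matrices act on row vectors, so they compose in the opposite order. -/
theorem Lifts.mul {g h : SL2Cover ≃ₜ SL2Cover} {a b : Matrix (Fin 4) (Fin 4) ℝ} (hg : Lifts g a)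
    (hh : Lifts h b) : Lifts (g * h) (b * a) := by
  intro X
  obtain ⟨r, hr, hX⟩ := hh X
  obtain ⟨s, hs, hY⟩ := hg (h X)
  refine ⟨s * r, mul_pos hs hr, ?_⟩
  change homCoord (g (h X)) = _
  rw [hY, hX, Matrix.smul_vecMul, Matrix.vecMul_vecMul, smul_smul]

theorem Lifts.inv {g : SL2Cover ≃ₜ SL2Cover} {a b : Matrix (Fin 4) (Fin 4) ℝ} (hg : Lifts g a)
    (hab : a * b = 1) : Lifts g⁻¹ b := by
  intro X
  obtain ⟨r, hr, hX⟩ := hg (g⁻¹ X)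
  have h : g (g⁻¹ X) = X := g.apply_symm_apply X
  rw [h] at hX
  refine ⟨r⁻¹, inv_pos.2 hr, ?_⟩
  rw [hX, Matrix.smul_vecMul, Matrix.vecMul_vecMul, hab, Matrix.vecMul_one, smul_smul,
    inv_mul_cancel₀ hr.ne', one_smul]

theorem Lifts.smul {g : SL2Cover ≃ₜ SL2Cover} {a : Matrix (Fin 4) (Fin 4) ℝ} (hg : Lifts g a)
    {r : ℝ} (hr : 0 < r) : Lifts g (r • a) := by
  intro X
  obtain ⟨s, hs, hX⟩ := hg X
  refine ⟨s * r⁻¹, mul_pos hs (inv_pos.2 hr), ?_⟩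
  rw [Matrix.vecMul_smul, smul_smul, mul_assoc, inv_mul_cancel₀ hr.ne', mul_one, hX]

theorem homCoord_fst (X : SL2Cover) : (⟨homCoord X 0, homCoord X 1⟩ : ℂ) =
    Complex.exp ((X.1 : ℂ) * Complex.I) := by
  apply Complex.ext
  · rw [Complex.exp_ofReal_mul_I_re]; rfl
  · rw [Complex.exp_ofReal_mul_I_im]; rfl

theorem homCoord_snd (X : SL2Cover) : (⟨homCoord X 2, homCoord X 3⟩ : ℂ) =
    (X.2 : ℂ) * Complex.exp (-((X.1 : ℂ) * Complex.I)) := by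
  have h : -((X.1 : ℂ) * Complex.I) = ((-X.1 : ℝ) : ℂ) * Complex.I := by push_cast; ring
  rw [h]
  apply Complex.ext
  · rw [Complex.mul_re, Complex.exp_ofReal_mul_I_re, Complex.exp_ofReal_mul_I_im, Real.cos_neg,
      Real.sin_neg]
    simp only [homCoord, Matrix.cons_val]
    ring
  · rw [Complex.mul_im, Complex.exp_ofReal_mul_I_re, Complex.exp_ofReal_mul_I_im, Real.cos_neg,
      Real.sin_neg]
    simp only [homCoord, Matrix.cons_val]
    ring

/-- Two lifts of the same collineation induce the same map of the base plane. -/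
theorem Lifts.snd_eq {g h : SL2Cover ≃ₜ SL2Cover} {a : Matrix (Fin 4) (Fin 4) ℝ}
    (hg : Lifts g a) (hh : Lifts h a) (X : SL2Cover) : (g X).2 = (h X).2 := by
  obtain ⟨r, hr, hX⟩ := hg X
  obtain ⟨s, hs, hY⟩ := hh X
  obtain ⟨k, hk, hXY⟩ : ∃ k : ℝ, 0 < k ∧ homCoord (g X) = k • homCoord (h X) := by
    refine ⟨r * s⁻¹, mul_pos hr (inv_pos.2 hs), ?_⟩
    rw [hX, hY, smul_smul, mul_assoc, inv_mul_cancel₀ hs.ne', mul_one]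
  have hj : ∀ j, homCoord (g X) j = k * homCoord (h X) j := fun j => by rw [hXY]; rfl
  have h1 := homCoord_fst (g X)
  have h2 := homCoord_snd (g X)
  have h3 := homCoord_fst (h X)
  have h4 := homCoord_snd (h X)
  have e1 : (⟨homCoord (g X) 0, homCoord (g X) 1⟩ : ℂ) =
      k * ⟨homCoord (h X) 0, homCoord (h X) 1⟩ := by
    rw [hj, hj]; apply Complex.ext <;> simp
  have e2 : (⟨homCoord (g X) 2, homCoord (g X) 3⟩ : ℂ) =
      k * ⟨homCoord (h X) 2, homCoord (h X) 3⟩ := by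
    rw [hj, hj]; apply Complex.ext <;> simp
  rw [h1, h3] at e1
  rw [h2, h4] at e2
  have hk1 : k = 1 := by
    have := congrArg norm e1
    rw [norm_mul, Complex.norm_exp_ofReal_mul_I, Complex.norm_exp_ofReal_mul_I, Complex.norm_real,
      Real.norm_of_nonneg hk.le, mul_one] at this
    exact this.symm
  rw [hk1, Complex.ofReal_one, one_mul] at e1 e2
  rw [Complex.exp_neg, Complex.exp_neg, e1] at e2
  exact Subtype.ext (mul_right_cancel₀ (inv_ne_zero (Complex.exp_ne_zero _)) e2)

theorem lifts_of_complex {g : SL2Cover ≃ₜ SL2Cover} {a : Matrix (Fin 4) (Fin 4) ℝ}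
    (h : ∀ X, ∃ c : ℝ, 0 < c ∧ (c : ℂ) * Complex.exp (((g X).1 : ℂ) * Complex.I) =
      ⟨Matrix.vecMul (homCoord X) a 0, Matrix.vecMul (homCoord X) a 1⟩ ∧
      (c : ℂ) * (((g X).2 : ℂ) * Complex.exp (-(((g X).1 : ℂ) * Complex.I))) =
      ⟨Matrix.vecMul (homCoord X) a 2, Matrix.vecMul (homCoord X) a 3⟩) : Lifts g a := by
  intro X
  obtain ⟨c, hc, h1, h2⟩ := h X
  refine ⟨c⁻¹, inv_pos.2 hc, ?_⟩
  rw [← homCoord_fst] at h1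
  rw [← homCoord_snd] at h2
  have a1 := congrArg Complex.re h1
  have a2 := congrArg Complex.im h1
  have a3 := congrArg Complex.re h2
  have a4 := congrArg Complex.im h2
  rw [Complex.re_ofReal_mul] at a1 a3
  rw [Complex.im_ofReal_mul] at a2 a4
  simp only at a1 a2 a3 a4
  ext j
  rw [Pi.smul_apply, smul_eq_mul, eq_inv_mul_iff_mul_eq₀ hc.ne']
  fin_cases j
  · exact a1
  · exact a2
  · exact a3
  · exact a4

/-! ### Isometries -/

/-- Multiplication of `(x⁰ + i x¹, x² - i x³)` by `i`. -/
def complexMatrix : Matrix (Fin 4) (Fin 4) ℝ :=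
  !![0, 1, 0, 0; -1, 0, 0, 0; 0, 0, 0, -1; 0, 0, 1, 0]

/-- The Gram matrix of the quadratic form. -/
def formMatrix : Matrix (Fin 4) (Fin 4) ℝ :=
  !![-1, 0, 0, 0; 0, -1, 0, 0; 0, 0, 1, 0; 0, 0, 0, 1]

theorem formMatrix_mul_self : formMatrix * formMatrix = 1 := by
  ext i j
  fin_cases i <;> fin_cases j <;>
    simp [formMatrix, Matrix.mul_apply, Fin.sum_univ_four]

/-- Matrices of complex linear or antilinear maps that preserve the form. -/
def IsUnitary (a : Matrix (Fin 4) (Fin 4) ℝ) : Prop :=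
  (∃ ε : ℝ, (ε = 1 ∨ ε = -1) ∧ complexMatrix * a = ε • (a * complexMatrix)) ∧
    a * formMatrix * a.transpose = formMatrix

/-- Commutation with `complexMatrix` up to sign determines rows 1 and 3 from rows 0 and 2, and four
entries of the Gram identity are the quadratic relations. Unlike these relations, `IsUnitary` is
visibly stable under products and inverses. -/
theorem IsUnitary.isIsometryMatrix {a : Matrix (Fin 4) (Fin 4) ℝ} (ha : IsUnitary a) :
    IsIsometryMatrix a := by
  obtain ⟨⟨ε, hε, hJ⟩, hG⟩ := ha
  have hJ' := fun i j => congrFun (congrFun hJ i) j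
  have hG' := fun i j => congrFun (congrFun hG i) j
  simp only [complexMatrix, formMatrix, Matrix.smul_apply, Matrix.mul_apply, Fin.sum_univ_four,
    Matrix.transpose_apply, smul_eq_mul] at hJ' hG'
  have J0 := fun j => hJ' 0 j
  have J2 := fun j => hJ' 2 j
  have r0 := J0 0
  have r1 := J0 1
  have r2 := J0 2
  have r3 := J0 3
  have s0 := J2 0
  have s1 := J2 1
  have s2 := J2 2
  have s3 := J2 3
  have g00 := hG' 0 0
  have g22 := hG' 2 2
  have g02 := hG' 0 2
  have g03 := hG' 0 3
  simp at r0 r1 r2 r3 s0 s1 s2 s3 g00 g22 g02 g03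
  have t0 : a 3 0 = ε * a 2 1 := by linarith
  have t1 : a 3 1 = -ε * a 2 0 := by linarith
  have t2 : a 3 2 = -ε * a 2 3 := by linarith
  have t3 : a 3 3 = ε * a 2 2 := by linarith
  refine ⟨⟨ε, hε, by linarith, by linarith, by linarith, by linarith, t0, t1, t2, t3⟩, ?_, ?_,
    ?_, ?_⟩
  · linear_combination g00
  · linear_combination g22
  · linear_combination g02
  · rw [t0, t1, t2, t3] at g03
    have hε2 : ε * ε = 1 := by rcases hε with rfl | rfl <;> norm_num
    linear_combination ε * g03 -
      (-(a 0 0) * a 2 1 + a 0 1 * a 2 0 - a 0 2 * a 2 3 + a 0 3 * a 2 2) * hε2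

theorem isUnitary_one : IsUnitary 1 :=
  ⟨⟨1, Or.inl rfl, by simp⟩, by simp⟩

theorem IsUnitary.mul {a b : Matrix (Fin 4) (Fin 4) ℝ} (ha : IsUnitary a) (hb : IsUnitary b) :
    IsUnitary (a * b) := by
  obtain ⟨⟨ε, hε, hJ⟩, hG⟩ := ha
  obtain ⟨⟨ε', hε', hJ'⟩, hG'⟩ := hb
  refine ⟨⟨ε * ε', ?_, ?_⟩, ?_⟩
  · rcases hε with rfl | rfl <;> rcases hε' with rfl | rfl <;> norm_num
  · rw [← mul_assoc, hJ, Matrix.smul_mul, mul_assoc, hJ', Matrix.mul_smul, smul_smul, mul_assoc]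
  · rw [Matrix.transpose_mul]
    calc a * b * formMatrix * (b.transpose * a.transpose)
        = a * (b * formMatrix * b.transpose) * a.transpose := by simp only [mul_assoc]
      _ = formMatrix := by rw [hG', hG]

theorem IsUnitary.exists_inv {a : Matrix (Fin 4) (Fin 4) ℝ} (ha : IsUnitary a) :
    ∃ b, a * b = 1 ∧ IsUnitary b := by
  obtain ⟨⟨ε, hε, hJ⟩, hG⟩ := ha
  have hε2 : ε * ε = 1 := by rcases hε with rfl | rfl <;> norm_num
  have hab : a * (formMatrix * a.transpose * formMatrix) = 1 := by
    rw [← mul_assoc, ← mul_assoc, hG, formMatrix_mul_self]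
  generalize formMatrix * a.transpose * formMatrix = b at hab
  have hba := mul_eq_one_comm.1 hab
  refine ⟨b, hab, ⟨ε, hε, ?_⟩, ?_⟩
  · have h : b * (complexMatrix * a) * b = b * (ε • (a * complexMatrix)) * b := by rw [hJ]
    rw [Matrix.mul_smul, Matrix.smul_mul, mul_assoc, mul_assoc, hab, mul_one, ← mul_assoc b a,
      hba, one_mul] at h
    rw [h, smul_smul, hε2, one_smul]
  · have h : b * (a * formMatrix * a.transpose) * b.transpose =
        b * formMatrix * b.transpose := by rw [hG]
    rw [← h, mul_assoc a, ← mul_assoc b, hba, one_mul, mul_assoc, ← Matrix.transpose_mul, hba,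
      Matrix.transpose_one, mul_one]

/-- The group of the lifts of unitary matrices. -/
def isometryGroup : Subgroup (SL2Cover ≃ₜ SL2Cover) where
  carrier := {g | ∃ a, IsUnitary a ∧ Lifts g a}
  mul_mem' := by
    rintro g h ⟨a, ha, hg⟩ ⟨b, hb, hh⟩
    exact ⟨b * a, hb.mul ha, hg.mul hh⟩
  one_mem' := ⟨1, isUnitary_one, fun X => ⟨1, one_pos, by rw [Matrix.vecMul_one, one_smul]; rfl⟩⟩
  inv_mem' := by
    rintro g ⟨a, ha, hg⟩
    obtain ⟨b, hab, hb⟩ := ha.exists_inv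
    exact ⟨b, hb, hg.inv hab⟩

theorem isIsometry_of_mem {g : SL2Cover ≃ₜ SL2Cover} (hg : g ∈ isometryGroup) : IsIsometry g := by
  obtain ⟨a, ha, hl⟩ := hg
  exact ⟨a, ha.isIsometryMatrix, hl⟩

theorem fibreTranslation_mem (t : ℝ) : fibreTranslation t ∈ isometryGroup := by
  refine ⟨!![Real.cos t, Real.sin t, 0, 0; -Real.sin t, Real.cos t, 0, 0;
    0, 0, Real.cos t, -Real.sin t; 0, 0, Real.sin t, Real.cos t], ⟨⟨1, Or.inl rfl, ?_⟩, ?_⟩, ?_⟩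
  · ext i j
    fin_cases i <;> fin_cases j <;>
      simp [complexMatrix, Matrix.mul_apply, Fin.sum_univ_four]
  · have h := Real.sin_sq_add_cos_sq t
    ext i j
    fin_cases i <;> fin_cases j <;>
      simp [formMatrix, Matrix.mul_apply, Fin.sum_univ_four] <;> linarith
  · intro X
    refine ⟨1, one_pos, ?_⟩
    rw [one_smul]
    have e1 : (fibreTranslation t X).1 = X.1 + t := rfl
    have e2 : (fibreTranslation t X).2 = X.2 := rfl
    ext j
    fin_cases j <;>
      simp [homCoord, e1, e2, Matrix.vecMul, dotProduct, Fin.sum_univ_four, Real.cos_add,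
        Real.sin_add] <;> ring

theorem complexMatrix_mul_translationMatrix (x : Fin 4 → ℝ) :
    complexMatrix * translationMatrix x = translationMatrix x * complexMatrix := by
  ext i j
  fin_cases i <;> fin_cases j <;>
    simp [complexMatrix, translationMatrix, Matrix.mul_apply, Fin.sum_univ_four]

theorem translationMatrix_form (x : Fin 4 → ℝ) :
    translationMatrix x * formMatrix * (translationMatrix x).transpose =
      (x 0 ^ 2 + x 1 ^ 2 - x 2 ^ 2 - x 3 ^ 2) • formMatrix := by
  ext i j
  fin_cases i <;> fin_cases j <;>
    simp [formMatrix, translationMatrix, Matrix.mul_apply, Fin.sum_univ_four] <;> ring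

theorem translationInvMatrix_eq (x : Fin 4 → ℝ) :
    translationInvMatrix x = translationMatrix ![x 0, -x 1, -x 2, -x 3] := by
  ext i j
  fin_cases i <;> fin_cases j <;> simp [translationInvMatrix, translationMatrix]

theorem originRotationMatrix_isUnitary (ω : ℝ) : IsUnitary (originRotationMatrix ω) := by
  refine ⟨⟨1, Or.inl rfl, ?_⟩, ?_⟩
  · ext i j
    fin_cases i <;> fin_cases j <;>
      simp [complexMatrix, originRotationMatrix, Matrix.mul_apply, Fin.sum_univ_four]
  · have h := Real.sin_sq_add_cos_sq ω
    ext i j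
    fin_cases i <;> fin_cases j <;>
      simp [formMatrix, originRotationMatrix, Matrix.mul_apply, Fin.sum_univ_four] <;> linarith

theorem smul_isUnitary {a : Matrix (Fin 4) (Fin 4) ℝ} {r : ℝ} (hr : 0 < r)
    (hJ : complexMatrix * a = a * complexMatrix)
    (hG : a * formMatrix * a.transpose = r • formMatrix) : IsUnitary ((√r)⁻¹ • a) := by
  refine ⟨⟨1, Or.inl rfl, ?_⟩, ?_⟩
  · rw [Matrix.mul_smul, Matrix.smul_mul, hJ, one_smul]
  · rw [Matrix.transpose_smul, Matrix.smul_mul, Matrix.smul_mul, Matrix.mul_smul, hG, smul_smul,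
      smul_smul, ← mul_inv, Real.mul_self_sqrt hr.le, inv_mul_cancel₀ hr.ne', one_smul]

/-- The translation matrices scale the form by a positive factor. Dividing each by its square root
makes them unitary, and lifts ignore positive factors. -/
theorem IsRotation.mem_isometryGroup {A : SL2Cover} {ω : ℝ} {g : SL2Cover ≃ₜ SL2Cover}
    (h : IsRotation A ω g) : g ∈ isometryGroup := by
  have hn : 0 < homCoord A 0 ^ 2 + homCoord A 1 ^ 2 - homCoord A 2 ^ 2 - homCoord A 3 ^ 2 := by
    have h1 := herm_re A A
    rw [herm_self, Complex.ofReal_re] at h1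
    nlinarith [A.normSq_lt_one]
  set r := homCoord A 0 ^ 2 + homCoord A 1 ^ 2 - homCoord A 2 ^ 2 - homCoord A 3 ^ 2 with hr
  have h1 := smul_isUnitary hn (complexMatrix_mul_translationMatrix (homCoord A))
    (translationMatrix_form (homCoord A))
  have h2 := smul_isUnitary hn
    (complexMatrix_mul_translationMatrix ![homCoord A 0, -homCoord A 1, -homCoord A 2,
      -homCoord A 3]) (by
    rw [translationMatrix_form]
    simp [hr])
  rw [← translationInvMatrix_eq] at h2
  refine ⟨_, (h2.mul (originRotationMatrix_isUnitary ω)).mul h1, ?_⟩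
  have hs : 0 < (√r)⁻¹ := inv_pos.2 (Real.sqrt_pos.2 hn)
  have := (h.1.smul hs).smul hs
  rwa [← Matrix.mul_smul, ← Matrix.smul_mul, ← Matrix.smul_mul] at this

end SL2Cover

namespace SL2Cover

open ComplexConjugate

/-! ### Translations and rotations -/

theorem norm_ball (A : Metric.ball (0 : ℂ) 1) : ‖(A : ℂ)‖ < 1 := mem_ball_zero_iff.1 A.2

theorem re_one_add_pos (A w : Metric.ball (0 : ℂ) 1) : 0 < (1 + (A : ℂ) * conj (w : ℂ)).re := by
  have h := re_one_sub_pos (z := w) (w := -(A : ℂ)) (norm_ball w)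
    (by rw [norm_neg]; exact norm_ball A)
  have e : (1 + (A : ℂ) * conj (w : ℂ)) = 1 - conj (w : ℂ) * -(A : ℂ) := by ring
  rwa [e]

theorem one_add_ne_zero (A w : Metric.ball (0 : ℂ) 1) : 1 + (A : ℂ) * conj (w : ℂ) ≠ 0 := by
  intro h
  have := re_one_add_pos A w
  rw [h] at this
  simp at this

theorem one_add_conj_ne_zero (A w : Metric.ball (0 : ℂ) 1) : 1 + conj (A : ℂ) * (w : ℂ) ≠ 0 := by
  rw [mul_comm]; exact one_add_ne_zero w A

theorem mobius_mem (A w : Metric.ball (0 : ℂ) 1) :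
    ((w : ℂ) + A) / (1 + conj (A : ℂ) * w) ∈ Metric.ball (0 : ℂ) 1 := by
  rw [mem_ball_zero_iff, norm_div, div_lt_one (norm_pos_iff.2 (one_add_conj_ne_zero A w))]
  apply lt_of_pow_lt_pow_left₀ 2 (norm_nonneg _)
  rw [← Complex.normSq_eq_norm_sq, ← Complex.normSq_eq_norm_sq]
  have h1 : Complex.normSq (1 + conj (A : ℂ) * w) - Complex.normSq ((w : ℂ) + A) =
      (1 - Complex.normSq (A : ℂ)) * (1 - Complex.normSq (w : ℂ)) := by
    simp [Complex.normSq_apply]; ring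
  have h2 := normSq_lt_one ((0, A) : SL2Cover)
  have h3 := normSq_lt_one ((0, w) : SL2Cover)
  have : 0 < (1 - Complex.normSq (A : ℂ)) * (1 - Complex.normSq (w : ℂ)) :=
    mul_pos (sub_pos.2 h2) (sub_pos.2 h3)
  linarith

/-- The translation of the disc that takes `0` to `A`. -/
noncomputable def mobius (A w : Metric.ball (0 : ℂ) 1) : Metric.ball (0 : ℂ) 1 :=
  ⟨((w : ℂ) + A) / (1 + conj (A : ℂ) * w), mobius_mem A w⟩

/-- The opposite point of the disc. -/
def opp (A : Metric.ball (0 : ℂ) 1) : Metric.ball (0 : ℂ) 1 :=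
  ⟨-(A : ℂ), by rw [mem_ball_zero_iff, norm_neg]; exact norm_ball A⟩

theorem opp_opp (A : Metric.ball (0 : ℂ) 1) : opp (opp A) = A := Subtype.ext (neg_neg _)

theorem one_sub_normSq_ne_zero (A : Metric.ball (0 : ℂ) 1) :
    (1 : ℂ) - conj (A : ℂ) * A ≠ 0 := by
  have h2 := normSq_lt_one ((0, A) : SL2Cover)
  rw [← Complex.normSq_eq_conj_mul_self]
  exact_mod_cast (sub_pos.2 h2).ne'

theorem mobius_opp (A w : Metric.ball (0 : ℂ) 1) : mobius (opp A) (mobius A w) = w := by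
  have h1 := one_add_conj_ne_zero A w
  have h3 := one_sub_normSq_ne_zero A
  apply Subtype.ext
  simp only [mobius, opp, map_neg]
  have e1 : ((w : ℂ) + A) / (1 + conj (A : ℂ) * w) + -(A : ℂ) =
      (1 - conj (A : ℂ) * A) * w / (1 + conj (A : ℂ) * w) := by
    rw [eq_div_iff h1, add_mul, div_mul_cancel₀ _ h1]; ring
  have e2 : 1 + -conj (A : ℂ) * (((w : ℂ) + A) / (1 + conj (A : ℂ) * w)) =
      (1 - conj (A : ℂ) * A) / (1 + conj (A : ℂ) * w) := by
    field_simp; ring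
  rw [e1, e2]
  field_simp

/-- The second number is a positive multiple of the inverse of the first, so the height shifts of
opposite translations cancel. -/
theorem arg_add_arg_mobius (A w : Metric.ball (0 : ℂ) 1) :
    Complex.arg (1 + (A : ℂ) * conj (w : ℂ)) +
      Complex.arg (1 + (opp A : ℂ) * conj (mobius A w : ℂ)) = 0 := by
  have h1 := one_add_ne_zero A w
  have h2 := normSq_lt_one ((0, A) : SL2Cover)
  have e : 1 + (opp A : ℂ) * conj (mobius A w : ℂ) =
      ((1 - Complex.normSq (A : ℂ) : ℝ) : ℂ) * (1 + (A : ℂ) * conj (w : ℂ))⁻¹ := by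
    simp only [mobius, opp, map_div₀, map_add, map_mul, map_one, Complex.conj_conj]
    push_cast
    rw [Complex.normSq_eq_conj_mul_self]
    field_simp; ring
  have h3 : Complex.arg (1 + (A : ℂ) * conj (w : ℂ)) ≠ Real.pi := by
    intro h3
    have h4 := Complex.abs_arg_lt_pi_div_two_iff.2 (Or.inl (re_one_add_pos A w))
    rw [h3, abs_of_pos Real.pi_pos] at h4
    linarith [Real.pi_pos]
  rw [e, Complex.arg_real_mul _ (sub_pos.2 h2), Complex.arg_inv, if_neg h3, add_neg_cancel]

/-- The translation taking the origin to the point with trace point `A` of the base plane. -/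
noncomputable def translateFun (A : Metric.ball (0 : ℂ) 1) (X : SL2Cover) : SL2Cover :=
  (X.1 + Complex.arg (1 + (A : ℂ) * conj (X.2 : ℂ)), mobius A X.2)

theorem translateFun_opp (A : Metric.ball (0 : ℂ) 1) (X : SL2Cover) :
    translateFun (opp A) (translateFun A X) = X := by
  refine Prod.ext ?_ (mobius_opp A X.2)
  have := arg_add_arg_mobius A X.2
  simp only [translateFun]
  linarith

theorem continuous_translateFun (A : Metric.ball (0 : ℂ) 1) : Continuous (translateFun A) := by
  refine Continuous.prodMk (continuous_fst.add ?_) ?_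
  · refine continuous_iff_continuousAt.2 fun X => ?_
    exact (Complex.continuousAt_arg (Or.inl (re_one_add_pos A X.2))).comp
      (f := fun X : SL2Cover => 1 + (A : ℂ) * conj (X.2 : ℂ)) (by fun_prop)
  · refine Continuous.subtype_mk ?_ _
    exact Continuous.div (by fun_prop) (by fun_prop) fun X => one_add_conj_ne_zero A X.2

/-- The translation taking the origin to the point with trace point `A` of the base plane, as a
homeomorphism. -/
noncomputable def translate (A : Metric.ball (0 : ℂ) 1) : SL2Cover ≃ₜ SL2Cover where
  toFun := translateFun A
  invFun := translateFun (opp A)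
  left_inv := translateFun_opp A
  right_inv X := by
    have := translateFun_opp (opp A) X
    rwa [opp_opp] at this
  continuous_toFun := continuous_translateFun A
  continuous_invFun := continuous_translateFun (opp A)

theorem lifts_translate (A : Metric.ball (0 : ℂ) 1) :
    Lifts (translate A) (translationMatrix (homCoord (0, A))) := by
  refine lifts_of_complex fun X => ⟨‖1 + (A : ℂ) * conj (X.2 : ℂ)‖,
    norm_pos_iff.2 (one_add_ne_zero A X.2), ?_, ?_⟩
  -- The matrix multiplies `e^{iφ}` by `1 + A w̄`. Its modulus is absorbed by the homogeneous
  -- factor, and its argument is the height shift.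
  · have e : (‖1 + (A : ℂ) * conj (X.2 : ℂ)‖ : ℂ) *
        Complex.exp (((translate A X).1 : ℂ) * Complex.I) =
        Complex.exp ((X.1 : ℂ) * Complex.I) * (1 + (A : ℂ) * conj (X.2 : ℂ)) := by
      have h1 : (translate A X).1 = X.1 + Complex.arg (1 + (A : ℂ) * conj (X.2 : ℂ)) := rfl
      conv_rhs => rw [← Complex.norm_mul_exp_arg_mul_I (1 + (A : ℂ) * conj (X.2 : ℂ))]
      rw [h1, Complex.ofReal_add, add_mul, Complex.exp_add]
      ring
    rw [e]
    apply Complex.ext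
    · rw [Complex.mul_re, Complex.exp_ofReal_mul_I_re, Complex.exp_ofReal_mul_I_im]
      simp [Matrix.vecMul, dotProduct, Fin.sum_univ_four, homCoord, translationMatrix]
      ring
    · rw [Complex.mul_im, Complex.exp_ofReal_mul_I_re, Complex.exp_ofReal_mul_I_im]
      simp [Matrix.vecMul, dotProduct, Fin.sum_univ_four, homCoord, translationMatrix]
      ring
  · have e : (‖1 + (A : ℂ) * conj (X.2 : ℂ)‖ : ℂ) * (((translate A X).2 : ℂ) *
        Complex.exp (-(((translate A X).1 : ℂ) * Complex.I))) =
        Complex.exp (((-X.1 : ℝ) : ℂ) * Complex.I) * ((X.2 : ℂ) + A) := by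
      have h1 : (translate A X).1 = X.1 + Complex.arg (1 + (A : ℂ) * conj (X.2 : ℂ)) := rfl
      have h2 : ((translate A X).2 : ℂ) = ((X.2 : ℂ) + A) / (1 + conj (A : ℂ) * X.2) := rfl
      have h3 := Complex.norm_mul_exp_arg_mul_I (1 + (A : ℂ) * conj (X.2 : ℂ))
      have h4 : conj (1 + (A : ℂ) * conj (X.2 : ℂ)) = 1 + conj (A : ℂ) * X.2 := by simp
      have h5 := one_add_conj_ne_zero A X.2
      have h6 : (‖1 + (A : ℂ) * conj (X.2 : ℂ)‖ : ℂ) *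
          Complex.exp (-(Complex.arg (1 + (A : ℂ) * conj (X.2 : ℂ)) * Complex.I)) =
          1 + conj (A : ℂ) * X.2 := by
        rw [← h4, ← h3, map_mul, Complex.conj_ofReal, ← Complex.exp_conj, map_mul,
          Complex.conj_ofReal, Complex.conj_I, h3, mul_neg]
      rw [h1, h2, Complex.ofReal_add, add_mul, neg_add, Complex.exp_add, Complex.ofReal_neg,
        neg_mul]
      calc _ = (‖1 + (A : ℂ) * conj (X.2 : ℂ)‖ : ℂ) *
          Complex.exp (-(Complex.arg (1 + (A : ℂ) * conj (X.2 : ℂ)) * Complex.I)) *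
          (((X.2 : ℂ) + A) / (1 + conj (A : ℂ) * X.2)) *
          Complex.exp (-((X.1 : ℂ) * Complex.I)) := by ring
        _ = _ := by rw [h6]; field_simp
    rw [e]
    apply Complex.ext
    · rw [Complex.mul_re, Complex.exp_ofReal_mul_I_re, Complex.exp_ofReal_mul_I_im, Real.cos_neg,
        Real.sin_neg]
      simp [Matrix.vecMul, dotProduct, Fin.sum_univ_four, homCoord, translationMatrix]
      ring
    · rw [Complex.mul_im, Complex.exp_ofReal_mul_I_re, Complex.exp_ofReal_mul_I_im, Real.cos_neg,
        Real.sin_neg]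
      simp [Matrix.vecMul, dotProduct, Fin.sum_univ_four, homCoord, translationMatrix]
      ring

/-- The rotation by `ω` about the fibre through the origin. -/
noncomputable def originRotation (ω : ℝ) : SL2Cover ≃ₜ SL2Cover :=
  (Homeomorph.refl ℝ).prodCongr (ballIsometry (rotation (Circle.exp ω)))

theorem originRotation_snd (ω : ℝ) (X : SL2Cover) :
    ((originRotation ω X).2 : ℂ) = Complex.exp ((ω : ℂ) * Complex.I) * X.2 := by
  change rotation (Circle.exp ω) X.2 = _
  rw [rotation_apply, Circle.coe_exp]

theorem lifts_originRotation (ω : ℝ) : Lifts (originRotation ω) (originRotationMatrix ω) := by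
  intro X
  refine ⟨1, one_pos, ?_⟩
  rw [one_smul]
  have e1 : (originRotation ω X).1 = X.1 := rfl
  have e2 := originRotation_snd ω X
  have e3 : ((originRotation ω X).2 : ℂ).re =
      Real.cos ω * (X.2 : ℂ).re - Real.sin ω * (X.2 : ℂ).im := by
    rw [e2, Complex.mul_re, Complex.exp_ofReal_mul_I_re, Complex.exp_ofReal_mul_I_im]
  have e4 : ((originRotation ω X).2 : ℂ).im =
      Real.cos ω * (X.2 : ℂ).im + Real.sin ω * (X.2 : ℂ).re := by
    rw [e2, Complex.mul_im, Complex.exp_ofReal_mul_I_re, Complex.exp_ofReal_mul_I_im]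
  ext j
  fin_cases j <;>
    simp [homCoord, originRotationMatrix, e1, e3, e4, Matrix.vecMul, dotProduct,
      Fin.sum_univ_four] <;> ring

/-- The rotation by `ω` about the fibre over `A`. -/
noncomputable def rotationAbout (A : Metric.ball (0 : ℂ) 1) (ω : ℝ) : SL2Cover ≃ₜ SL2Cover :=
  translate A * (originRotation ω * translate (opp A))

theorem isRotation_rotationAbout (A : Metric.ball (0 : ℂ) 1) (ω : ℝ) :
    IsRotation (0, A) ω (rotationAbout A ω) := by
  constructor
  · have e : translationInvMatrix (homCoord (0, A)) = translationMatrix (homCoord (0, opp A)) := by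
      rw [translationInvMatrix_eq]
      congr 1
      ext j
      fin_cases j <;> simp [homCoord, opp]
    rw [e]
    exact (lifts_translate A).mul ((lifts_originRotation ω).mul (lifts_translate (opp A)))
  · have h2 := normSq_lt_one ((0, A) : SL2Cover)
    have e1 : translate (opp A) (0, A) = (0, ⟨0, by simp⟩) := by
      refine Prod.ext ?_ (Subtype.ext ?_)
      · change 0 + Complex.arg (1 + -(A : ℂ) * conj (A : ℂ)) = 0
        have : 1 + -(A : ℂ) * conj (A : ℂ) = ((1 - Complex.normSq (A : ℂ) : ℝ) : ℂ) := by
          rw [neg_mul, Complex.mul_conj]; push_cast; ring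
        rw [this, Complex.arg_ofReal_of_nonneg (sub_pos.2 h2).le, add_zero]
      · change ((A : ℂ) + -(A : ℂ)) / _ = 0
        rw [add_neg_cancel, zero_div]
    have e2 : originRotation ω (0, ⟨0, by simp⟩) = (0, ⟨0, by simp⟩) := by
      refine Prod.ext rfl (Subtype.ext ?_)
      rw [originRotation_snd, mul_zero]
    change translate A (originRotation ω (translate (opp A) (0, A))) = (0, A)
    rw [e1, e2]
    refine Prod.ext ?_ (Subtype.ext ?_)
    · change 0 + Complex.arg (1 + (A : ℂ) * conj (0 : ℂ)) = 0
      simp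
    · change ((0 : ℂ) + A) / (1 + conj (A : ℂ) * 0) = A
      simp

theorem rotationAbout_snd (A : Metric.ball (0 : ℂ) 1) (ω : ℝ) (X : SL2Cover) :
    ((rotationAbout A ω X).2 : ℂ) =
      (Complex.exp ((ω : ℂ) * Complex.I) * (X.2 - A) + A * (1 - conj (A : ℂ) * X.2)) /
      (1 - conj (A : ℂ) * X.2 + conj (A : ℂ) * (Complex.exp ((ω : ℂ) * Complex.I) * (X.2 - A))) := by
  have h1 : ((translate (opp A) X).2 : ℂ) = (X.2 - A) / (1 - conj (A : ℂ) * X.2) := by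
    change ((X.2 : ℂ) + -(A : ℂ)) / (1 + conj (-(A : ℂ)) * X.2) = _
    rw [map_neg, neg_mul, ← sub_eq_add_neg, ← sub_eq_add_neg]
  have h2 : (1 - conj (A : ℂ) * X.2) ≠ 0 := by
    have := one_add_conj_ne_zero (opp A) X.2
    rw [sub_eq_add_neg, ← neg_mul, ← map_neg]
    exact this
  have h3 : ((rotationAbout A ω X).2 : ℂ) =
      (((originRotation ω (translate (opp A) X)).2 : ℂ) + A) /
        (1 + conj (A : ℂ) * (originRotation ω (translate (opp A) X)).2) := rfl
  rw [h3, originRotation_snd, h1]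
  have e1 : Complex.exp ((ω : ℂ) * Complex.I) * (((X.2 : ℂ) - A) / (1 - conj (A : ℂ) * X.2)) + A =
      (Complex.exp ((ω : ℂ) * Complex.I) * (X.2 - A) + A * (1 - conj (A : ℂ) * X.2)) /
        (1 - conj (A : ℂ) * X.2) := by
    rw [eq_div_iff h2, add_mul, mul_assoc, div_mul_cancel₀ _ h2]
  have e2 : 1 + conj (A : ℂ) *
      (Complex.exp ((ω : ℂ) * Complex.I) * (((X.2 : ℂ) - A) / (1 - conj (A : ℂ) * X.2))) =
      (1 - conj (A : ℂ) * X.2 + conj (A : ℂ) *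
        (Complex.exp ((ω : ℂ) * Complex.I) * (X.2 - A))) / (1 - conj (A : ℂ) * X.2) := by
    field_simp
  rw [e1, e2, div_div_div_cancel_right₀ h2]

theorem IsRotation.snd_eq {A : Metric.ball (0 : ℂ) 1} {ω : ℝ} {g : SL2Cover ≃ₜ SL2Cover}
    (h : IsRotation (0, A) ω g) (X : SL2Cover) : (g X).2 = (rotationAbout A ω X).2 :=
  h.1.snd_eq (isRotation_rotationAbout A ω).1 X

end SL2Cover

namespace SL2Cover

open ComplexConjugate ReflectionGroup

/-! ### The regular hyperbolic polygon with angle `2π / q` -/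

variable {p q : ℕ}

/-- The condition `q > 2p / (p - 2)` in the form in which it is used. -/
theorem sin_lt_cos_of_lt (hp : 3 ≤ p) (hq : (2 * p : ℝ) / (p - 2) < q) :
    2 < q ∧ Real.sin (Real.pi / p) < Real.cos (Real.pi / q) := by
  have h3 : (3 : ℝ) ≤ p := by exact_mod_cast hp
  rw [div_lt_iff₀ (by linarith)] at hq
  have hq2 : (2 : ℝ) < q := by
    by_contra h
    push Not at h
    nlinarith
  refine ⟨by exact_mod_cast hq2, ?_⟩
  rw [← Real.cos_pi_div_two_sub]
  have hpi := Real.pi_pos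
  apply Real.cos_lt_cos_of_nonneg_of_le_pi_div_two (by positivity)
  · have : 0 < Real.pi / p := by positivity
    linarith
  · have e : Real.pi / 2 - Real.pi / p - Real.pi / q =
        Real.pi * (q * (p - 2) - 2 * p) / (2 * p * q) := by
      field_simp
    have : 0 < Real.pi * (q * (p - 2) - 2 * p) / (2 * p * q) := by
      apply div_pos (mul_pos hpi (by linarith)) (by positivity)
    linarith

/-- The coefficients of the unit normals of the sides are `sideL` (spacelike) and `sideK`
(timelike). -/
noncomputable def sideL (p q : ℕ) : ℝ := Real.cos (Real.pi / q) / Real.sin (Real.pi / p)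

/-- See `sideL`. -/
noncomputable def sideK (p q : ℕ) : ℝ := √(sideL p q ^ 2 - 1)

/-- The parameters of a hyperbolic tiling by regular `p`-gons, `q` of which meet at each vertex. -/
structure IsHyperbolic (p q : ℕ) : Prop where
  three_le : 3 ≤ p
  two_lt : 2 < q
  sin_lt_cos : Real.sin (Real.pi / p) < Real.cos (Real.pi / q)

namespace IsHyperbolic

theorem sideL_mul (h : IsHyperbolic p q) : sideL p q * Real.sin (Real.pi / p) = Real.cos (Real.pi / q) :=
  div_mul_cancel₀ _ (sin_pi_div_pos h.three_le).ne'

theorem one_lt_sideL (h : IsHyperbolic p q) : 1 < sideL p q := by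
  rw [sideL, one_lt_div (sin_pi_div_pos h.three_le)]
  exact h.sin_lt_cos

theorem sideK_sq (h : IsHyperbolic p q) : sideK p q ^ 2 = sideL p q ^ 2 - 1 :=
  Real.sq_sqrt (by nlinarith [h.one_lt_sideL])

theorem sideK_pos (h : IsHyperbolic p q) : 0 < sideK p q := Real.sqrt_pos.2 (by nlinarith [h.one_lt_sideL])

theorem sin_q_pos (h : IsHyperbolic p q) : 0 < Real.sin (Real.pi / q) := sin_pi_div_pos h.two_lt

/-- The regular hyperbolic `p`-gon with angle `2π / q`. -/
noncomputable def shape (h : IsHyperbolic p q) : RegularShape p where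
  -- The side circle is `sideK (1 + |w|²) = 2 sideL ⟨w, u₀⟩`, orthogonal to the unit circle. At the
  -- vertices this reads `sideK (1 + ρ²) = 2 sideL cos (π/p) ρ`, with discriminant `4 sin² (π/q)`.
  -- `ρ` is the smaller root, and `m` comes from normalising the linear part.
  ρ := (sideL p q * Real.cos (Real.pi / p) - Real.sin (Real.pi / q)) / sideK p q
  m := -(sideK p q / (2 * sideL p q))
  ρ_pos := by
    have h1 := h.sideK_sq
    have h2 := h.sideK_pos
    have h3 := h.one_lt_sideL
    have h4 := h.sideL_mul
    have h5 := h.sin_q_pos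
    have h6 := Real.sin_sq_add_cos_sq (Real.pi / p)
    have h7 := Real.sin_sq_add_cos_sq (Real.pi / q)
    have hc := cos_pi_div_pos h.three_le
    have h8 : Real.sin (Real.pi / q) ^ 2 < (sideL p q * Real.cos (Real.pi / p)) ^ 2 := by
      rw [← h4] at h7
      have : 0 < sideK p q ^ 2 := by positivity
      linear_combination this + h1 + h7 - sideL p q ^ 2 * h6
    have := lt_of_pow_lt_pow_left₀ 2 (by positivity) h8
    exact div_pos (by linarith) h2
  ρ_lt_one := by
    have h1 := h.sideK_sq
    have h2 := h.sideK_pos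
    have h3 := h.one_lt_sideL
    have h4 := h.sideL_mul
    have h5 := h.sin_q_pos
    have h6 := Real.sin_sq_add_cos_sq (Real.pi / p)
    have h7 := Real.sin_sq_add_cos_sq (Real.pi / q)
    rw [div_lt_one h2]
    have h8 : (sideL p q * Real.cos (Real.pi / p)) ^ 2 <
        (sideK p q + Real.sin (Real.pi / q)) ^ 2 := by
      rw [← h4] at h7
      have : 0 < 2 * sideK p q * Real.sin (Real.pi / q) := by positivity
      linear_combination this - h1 - h7 + sideL p q ^ 2 * h6
    have := lt_of_pow_lt_pow_left₀ 2 (by positivity) h8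
    linarith
  m_gt := by
    have h1 := h.sideK_sq
    have h2 := h.sideK_pos
    have h3 := h.one_lt_sideL
    have h4 := h.sideL_mul
    have h5 := h.sin_q_pos
    have h6 := Real.sin_sq_add_cos_sq (Real.pi / p)
    have h7 := Real.sin_sq_add_cos_sq (Real.pi / q)
    have hc := cos_pi_div_pos h.three_le
    have h8 : Real.sin (Real.pi / q) ^ 2 < (sideL p q * Real.cos (Real.pi / p)) ^ 2 := by
      rw [← h4] at h7
      have : 0 < sideK p q ^ 2 := by positivity
      linear_combination this + h1 + h7 - sideL p q ^ 2 * h6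
    have h9 := lt_of_pow_lt_pow_left₀ 2 (by positivity) h8
    have hpos : 0 < (sideL p q * Real.cos (Real.pi / p) - Real.sin (Real.pi / q)) / sideK p q :=
      div_pos (by linarith) h2
    rw [neg_lt_neg_iff, div_lt_div_iff₀ (by linarith) (by linarith)]
    have e : sideK p q * (2 * ((sideL p q * Real.cos (Real.pi / p) - Real.sin (Real.pi / q)) /
        sideK p q)) = 2 * (sideL p q * Real.cos (Real.pi / p) - Real.sin (Real.pi / q)) := by
      field_simp
    rw [e]
    nlinarith

theorem sideK_mul_ρ (h : IsHyperbolic p q) : sideK p q * h.shape.ρ =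
    sideL p q * Real.cos (Real.pi / p) - Real.sin (Real.pi / q) :=
  mul_div_cancel₀ _ h.sideK_pos.ne'

/-- The two roots of the quadratic equation for `ρ` have product `1`. -/
theorem sideK_eq (h : IsHyperbolic p q) : sideK p q = h.shape.ρ *
    (sideL p q * Real.cos (Real.pi / p) + Real.sin (Real.pi / q)) := by
  apply mul_left_cancel₀ h.sideK_pos.ne'
  rw [← mul_assoc, h.sideK_mul_ρ]
  have h7 := Real.sin_sq_add_cos_sq (Real.pi / q)
  rw [← h.sideL_mul] at h7
  linear_combination h.sideK_sq + h7 -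
    sideL p q ^ 2 * Real.sin_sq_add_cos_sq (Real.pi / p)

theorem sideK_mul_one_add (h : IsHyperbolic p q) : sideK p q * (1 + h.shape.ρ ^ 2) =
    2 * sideL p q * Real.cos (Real.pi / p) * h.shape.ρ := by
  linear_combination h.sideK_eq + h.shape.ρ * h.sideK_mul_ρ

theorem sideK_mul_one_sub (h : IsHyperbolic p q) : sideK p q * (1 - h.shape.ρ ^ 2) =
    2 * Real.sin (Real.pi / q) * h.shape.ρ := by
  linear_combination h.sideK_eq - h.shape.ρ * h.sideK_mul_ρ

theorem shape_m_mul (h : IsHyperbolic p q) : 2 * sideL p q * h.shape.m = -sideK p q := by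
  have h3 := h.one_lt_sideL
  change 2 * sideL p q * -(sideK p q / (2 * sideL p q)) = _
  field_simp

theorem sideForm_zero (h : IsHyperbolic p q) (w : ℂ) : -(2 * sideL p q) * h.shape.sideForm 0 w =
    sideK p q * (1 + Complex.normSq w) - 2 * sideL p q * radial p w := by
  rw [RegularShape.sideForm_zero_eq]
  linear_combination (h.shape.ρ ^ 2 - Complex.normSq w) * h.shape_m_mul - h.sideK_mul_one_add

end IsHyperbolic

/-- The orders of the rotations about the vertices of a characteristic triangle of the polygon. -/
def angleOrder (p q : ℕ) : Fin 3 → Fin 3 → ℕ := ![![2, p, 2], ![p, 2, q], ![2, q, 2]]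

/-- The Gram coefficients of the triangle with angles `π / p`, `π / 2`, `π / q`. -/
noncomputable def triangleCoeff (p q : ℕ) (i j : Fin 3) : ℝ :=
  2 * Real.cos (Real.pi / angleOrder p q i j)

theorem IsHyperbolic.isAngles (h : IsHyperbolic p q) :
    IsAngles (triangleCoeff p q) (angleOrder p q) where
  two_le i j := by
    have h1 := h.three_le
    have h2 := h.two_lt
    fin_cases i <;> fin_cases j <;> simp [angleOrder] <;> omega
  symm i j := by fin_cases i <;> fin_cases j <;> rfl
  eq_cos i j _ := rfl

/-- The Minkowski products of the point of the hyperboloid over `w` with the unit normals of the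
sides of the characteristic triangle. -/
noncomputable def wallCoord (p q : ℕ) (w : ℂ) : Fin 3 → ℝ :=
  ![2 * tangential p w / (1 - Complex.normSq w),
    2 * (radial p w * Real.sin (Real.pi / p) - tangential p w * Real.cos (Real.pi / p)) /
      (1 - Complex.normSq w),
    (sideK p q * (1 + Complex.normSq w) - 2 * sideL p q * radial p w) / (1 - Complex.normSq w)]

theorem refl_triangle_zero (v : Fin 3 → ℝ) : refl (triangleCoeff p q) 0 v =
    ![-v 0, v 1 + 2 * Real.cos (Real.pi / p) * v 0, v 2] := by
  ext j
  rw [refl_apply]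
  fin_cases j
  · rfl
  · rfl
  · change v 2 + 2 * Real.cos (Real.pi / (2 : ℕ)) * v 0 = v 2
    simp

theorem refl_triangle_one (v : Fin 3 → ℝ) : refl (triangleCoeff p q) 1 v =
    ![v 0 + 2 * Real.cos (Real.pi / p) * v 1, -v 1, v 2 + 2 * Real.cos (Real.pi / q) * v 1] := by
  ext j
  rw [refl_apply]
  fin_cases j <;> rfl

theorem refl_triangle_two (v : Fin 3 → ℝ) : refl (triangleCoeff p q) 2 v =
    ![v 0, v 1 + 2 * Real.cos (Real.pi / q) * v 2, -v 2] := by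
  ext j
  rw [refl_apply]
  fin_cases j
  · change v 0 + 2 * Real.cos (Real.pi / (2 : ℕ)) * v 2 = v 0
    simp
  · rfl
  · rfl

theorem wallCoord_planeReflection (w : ℂ) :
    wallCoord p q (planeReflection p w) = refl (triangleCoeff p q) 0 (wallCoord p q w) := by
  rw [refl_triangle_zero]
  simp only [wallCoord, radial_planeReflection, tangential_planeReflection,
    Complex.normSq_eq_norm_sq, LinearIsometryEquiv.norm_map]
  ext j
  fin_cases j <;> simp <;> ring

/-- The reflection of the plane that fixes `A₁`. -/
noncomputable def vertexReflection (p : ℕ) : ℂ ≃ₗᵢ[ℝ] ℂ :=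
  (planeReflection p).trans (planeRotation p 1)

theorem wallCoord_vertexReflection (h : IsHyperbolic p q) (w : ℂ) :
    wallCoord p q (vertexReflection p w) = refl (triangleCoeff p q) 1 (wallCoord p q w) := by
  rw [refl_triangle_one]
  have e : vertexReflection p w = planeRotation p 1 (planeReflection p w) := rfl
  have e2 : 2 * Real.pi * ((1 : ℤ) : ℝ) / p = 2 * (Real.pi / p) := by push_cast; ring
  have hsc := Real.sin_sq_add_cos_sq (Real.pi / p)
  have hn : Complex.normSq (vertexReflection p w) = Complex.normSq w := by
    rw [Complex.normSq_eq_norm_sq, LinearIsometryEquiv.norm_map, Complex.normSq_eq_norm_sq]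
  have hr : radial p (vertexReflection p w) =
      radial p w * (2 * Real.cos (Real.pi / p) ^ 2 - 1) +
      tangential p w * (2 * Real.sin (Real.pi / p) * Real.cos (Real.pi / p)) := by
    rw [e, radial_planeRotation, radial_planeReflection, tangential_planeReflection, e2,
      Real.cos_two_mul, Real.sin_two_mul]
    ring
  have ht : tangential p (vertexReflection p w) =
      -tangential p w * (2 * Real.cos (Real.pi / p) ^ 2 - 1) +
      radial p w * (2 * Real.sin (Real.pi / p) * Real.cos (Real.pi / p)) := by
    rw [e, tangential_planeRotation, radial_planeReflection, tangential_planeReflection, e2,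
      Real.cos_two_mul, Real.sin_two_mul]
  have hL := h.sideL_mul
  simp only [wallCoord, hn, hr, ht]
  generalize 1 - Complex.normSq w = N
  ext j
  fin_cases j
  · change 2 * _ / N = 2 * _ / N + 2 * _ * (2 * _ / N)
    ring
  · change 2 * _ / N = -(2 * _ / N)
    rw [← neg_div]
    congr 1
    linear_combination 4 * tangential p w * Real.cos (Real.pi / p) * hsc
  · change (_ - 2 * _ * _) / N = (_ - 2 * _ * _) / N + 2 * _ * (2 * _ / N)
    rw [← hL, mul_div_assoc', ← add_div]
    congr 1
    linear_combination -4 * sideL p q * radial p w * hsc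

end SL2Cover

namespace SL2Cover

open ComplexConjugate ReflectionGroup

variable {p q : ℕ}

/-! ### The inversion in a side and the rotation about a vertex -/

/-- The inversion in the circle that carries the side `A₀ A₁` of the polygon. -/
noncomputable def sideInversion (p q : ℕ) (w : ℂ) : ℂ :=
  ofCoords p
    (sideL p q / sideK p q + (radial p w - sideL p q / sideK p q) /
      (sideK p q ^ 2 * ((radial p w - sideL p q / sideK p q) ^ 2 + tangential p w ^ 2)))
    (tangential p w /
      (sideK p q ^ 2 * ((radial p w - sideL p q / sideK p q) ^ 2 + tangential p w ^ 2)))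

theorem IsHyperbolic.sideK_mul_div (h : IsHyperbolic p q) :
    sideK p q * (sideL p q / sideK p q) = sideL p q :=
  mul_div_cancel₀ _ h.sideK_pos.ne'

theorem IsHyperbolic.one_lt_div (h : IsHyperbolic p q) : 1 < sideL p q / sideK p q := by
  rw [_root_.one_lt_div h.sideK_pos]
  exact lt_of_pow_lt_pow_left₀ 2 (by linarith [h.one_lt_sideL]) (by linarith [h.sideK_sq])

theorem IsHyperbolic.dist_pos (h : IsHyperbolic p q) {w : ℂ} (hw : Complex.normSq w < 1) :
    0 < sideK p q ^ 2 *
      ((radial p w - sideL p q / sideK p q) ^ 2 + tangential p w ^ 2) := by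
  have h1 := h.one_lt_div
  have h2 : radial p w < 1 := by
    rw [normSq_eq_coords p] at hw
    nlinarith [sq_nonneg (tangential p w)]
  have h3 := h.sideK_pos
  have h4 : radial p w - sideL p q / sideK p q ≠ 0 := by linarith
  positivity

/-- The circle has centre at distance `sideL / sideK` and radius `1 / sideK`, hence is orthogonal to
the unit circle, and the inversion preserves the disc. -/
theorem IsHyperbolic.one_sub_normSq_sideInversion (h : IsHyperbolic p q) {w : ℂ}
    (hw : Complex.normSq w < 1) : 1 - Complex.normSq (sideInversion p q w) =
      (1 - Complex.normSq w) / (sideK p q ^ 2 *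
        ((radial p w - sideL p q / sideK p q) ^ 2 + tangential p w ^ 2)) := by
  have h1 := h.dist_pos hw
  have hK := h.sideK_mul_div
  have hK2 := h.sideK_sq
  rw [normSq_eq_coords p, normSq_eq_coords p, sideInversion, radial_ofCoords, tangential_ofCoords]
  generalize sideL p q / sideK p q = g at *
  rw [← hK] at hK2
  rw [eq_div_iff h1.ne']
  set D := sideK p q ^ 2 * ((radial p w - g) ^ 2 + tangential p w ^ 2) with hD
  field_simp
  rw [hD]
  linear_combination (sideK p q ^ 2 * ((radial p w - g) ^ 2 + tangential p w ^ 2) - 1) *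
    ((radial p w - g) ^ 2 + tangential p w ^ 2) * hK2

theorem IsHyperbolic.normSq_sideInversion_lt (h : IsHyperbolic p q) {w : ℂ}
    (hw : Complex.normSq w < 1) : Complex.normSq (sideInversion p q w) < 1 := by
  have := div_pos (sub_pos.2 hw) (h.dist_pos hw)
  rw [← h.one_sub_normSq_sideInversion hw] at this
  exact sub_pos.1 this

theorem wallCoord_sideInversion (h : IsHyperbolic p q) {w : ℂ} (hw : Complex.normSq w < 1) :
    wallCoord p q (sideInversion p q w) = refl (triangleCoeff p q) 2 (wallCoord p q w) := by
  rw [refl_triangle_two]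
  have h1 := h.dist_pos hw
  have h2 := h.one_sub_normSq_sideInversion hw
  have hK := h.sideK_mul_div
  have hK2 := h.sideK_sq
  have hN : 1 - Complex.normSq w ≠ 0 := (sub_pos.2 hw).ne'
  have hN2 : Complex.normSq (sideInversion p q w) = 1 - (1 - Complex.normSq w) / (sideK p q ^ 2 *
        ((radial p w - sideL p q / sideK p q) ^ 2 + tangential p w ^ 2)) := by linarith
  have hr : radial p (sideInversion p q w) = _ := radial_ofCoords _ _
  have ht : tangential p (sideInversion p q w) = _ := tangential_ofCoords _ _
  have hn := normSq_eq_coords p w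
  rw [wallCoord, hN2, hr, ht, wallCoord, sub_sub_cancel]
  have hL := h.sideL_mul
  generalize sideL p q / sideK p q = g at *
  generalize radial p w = x at *
  generalize tangential p w = s at *
  generalize Complex.normSq w = n at *
  have hKp := h.sideK_pos
  generalize sideK p q = K at *
  rw [← hK] at hK2 hL ⊢
  rw [← hL]
  have hD : K ^ 2 * ((x - g) ^ 2 + s ^ 2) = K ^ 2 * (n - 2 * g * x + g ^ 2) := by rw [hn]; ring
  have hD0 := h1.ne'
  set D := K ^ 2 * ((x - g) ^ 2 + s ^ 2)
  ext j
  fin_cases j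
  · change 2 * (s / D) / ((1 - n) / D) = 2 * s / (1 - n)
    field_simp
  · change 2 * ((g + (x - g) / D) * _ - s / D * _) / ((1 - n) / D) =
      2 * _ / (1 - n) + 2 * _ * ((K * (1 + n) - 2 * (K * g) * x) / (1 - n))
    field_simp
    rw [hD]
    linear_combination -(g * Real.sin (Real.pi / p)) * hK2
  · change (K * (1 + (1 - (1 - n) / D)) - 2 * (K * g) * (g + (x - g) / D)) / ((1 - n) / D) =
      - ((K * (1 + n) - 2 * (K * g) * x) / (1 - n))
    field_simp
    rw [hD]
    linear_combination 2 * (n - 2 * g * x + g ^ 2) * hK2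

/-- The unit complex number that takes the coordinates `tangential + i radial` to `w`. -/
noncomputable def frame (p : ℕ) : ℂ := ⟨Real.cos (Real.pi / p), -Real.sin (Real.pi / p)⟩

theorem frame_mul_conj : frame p * conj (frame p) = 1 := by
  rw [Complex.mul_conj, Complex.normSq_apply]
  norm_cast
  simp only [frame]
  linear_combination Real.sin_sq_add_cos_sq (Real.pi / p)

theorem ofCoords_eq (x s : ℝ) : ofCoords p x s = (s + x * Complex.I) * frame p := by
  apply Complex.ext <;> simp [ofCoords, frame] <;> ring

theorem vertex_one_eq (S : RegularShape p) : S.vertex 1 =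
    S.ρ * (Real.sin (Real.pi / p) + Real.cos (Real.pi / p) * Complex.I) * frame p := by
  have e : 2 * Real.pi * ((1 : ℤ) : ℝ) / p = 2 * (Real.pi / p) := by push_cast; ring
  rw [RegularShape.vertex, e, Real.sin_two_mul, Real.cos_two_mul]
  have := Real.sin_sq_add_cos_sq (Real.pi / p)
  rw [frame]
  generalize Real.sin (Real.pi / p) = sn at *
  generalize Real.cos (Real.pi / p) = c at *
  apply Complex.ext
  · simp; ring
  · simp
    linear_combination S.ρ * this

/-- With `G` the centre, this is `conj (z - G) * (w - G) = |G|² - 1`, the squared radius, expanded.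
-/
theorem sideInversion_mul (h : IsHyperbolic p q) {w : ℂ} (hw : Complex.normSq w < 1) :
    conj (sideInversion p q w) * (w - (sideL p q / sideK p q : ℝ) * Complex.I * frame p) =
      conj ((sideL p q / sideK p q : ℝ) * Complex.I * frame p) * w - 1 := by
  have h1 := h.dist_pos hw
  have hK := h.sideK_mul_div
  have hK2 := h.sideK_sq
  have hu := frame_mul_conj (p := p)
  rw [sideInversion]
  conv_lhs => rw [← ofCoords_radial_tangential (p := p) w]
  conv_rhs => rw [← ofCoords_radial_tangential (p := p) w]
  simp only [radial_ofCoords, tangential_ofCoords]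
  rw [ofCoords_eq, ofCoords_eq]
  generalize sideL p q / sideK p q = g at *
  generalize radial p w = x at *
  generalize tangential p w = s at *
  rw [← hK] at hK2
  have hKp := h.sideK_pos
  generalize sideK p q = K at *
  have hD0 := h1.ne'
  have e : ∀ a b : ℂ, conj (a * frame p) * (b * frame p) = conj a * b := by
    intro a b
    rw [map_mul]
    linear_combination conj a * b * hu
  rw [e, ← sub_mul, e]
  set D := K ^ 2 * ((x - g) ^ 2 + s ^ 2) with hD
  have e1 : s * s / D + (x - g) * (x - g) / D = g ^ 2 - 1 := by
    rw [← add_div, div_eq_iff hD0, hD]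
    linear_combination (s ^ 2 + (x - g) ^ 2) * hK2
  apply Complex.ext
  · simp
    linear_combination e1
  · simp
    ring

theorem vertexReflection_eq (w : ℂ) : vertexReflection p w =
    ((Real.sin (Real.pi / p) + Real.cos (Real.pi / p) * Complex.I) * frame p) ^ 2 * conj w := by
  have e : vertexReflection p w = planeRotation p 1 (planeReflection p w) := rfl
  have e2 : 2 * Real.pi * ((1 : ℤ) : ℝ) / p = 2 * (Real.pi / p) := by push_cast; ring
  have hsc := Real.sin_sq_add_cos_sq (Real.pi / p)
  have hu := frame_mul_conj (p := p)
  rw [← ofCoords_radial_tangential (p := p) (vertexReflection p w), e, radial_planeRotation,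
    radial_planeReflection, tangential_planeRotation, radial_planeReflection,
    tangential_planeReflection, e2, Real.cos_two_mul, Real.sin_two_mul]
  conv_rhs => rw [← ofCoords_radial_tangential (p := p) w]
  rw [ofCoords_eq, ofCoords_eq, map_mul]
  have e3 : ∀ a b : ℂ, (a * frame p) ^ 2 * (b * conj (frame p)) = a ^ 2 * b * frame p := by
    intro a b
    linear_combination a ^ 2 * b * frame p * hu
  rw [e3]
  congr 1
  generalize Real.sin (Real.pi / p) = sn at *
  generalize Real.cos (Real.pi / p) = c at *
  apply Complex.ext
  · simp [sq]
    linear_combination -(tangential p w) * hsc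
  · simp [sq]
    linear_combination (radial p w) * hsc

/-- The side `A₀A₁` and the radius to `A₁` meet at angle `π/q`, so reflecting in one and then in the
other rotates by `2π/q` about `A₁`. Both maps are Möbius, and numerators and denominators are
compared up to a common factor. -/
theorem rotationAbout_eq_reflections (h : IsHyperbolic p q) (X : SL2Cover) :
    ((rotationAbout ⟨h.shape.vertex 1, h.shape.vertex_mem 1⟩ (2 * Real.pi / q) X).2 : ℂ) =
      vertexReflection p (sideInversion p q X.2) := by
  have hw := X.normSq_lt_one
  have hI := sideInversion_mul h hw
  have hu := frame_mul_conj (p := p)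
  have hsc := Real.sin_sq_add_cos_sq (Real.pi / p)
  have hsq := Real.sin_sq_add_cos_sq (Real.pi / q)
  have hs0 := h.sin_q_pos
  have hρ := h.shape.ρ_pos
  have hK := h.sideK_mul_div
  have h1 : 2 * (sideL p q / sideK p q) * h.shape.ρ * Real.cos (Real.pi / p) =
      1 + h.shape.ρ ^ 2 := by
    apply mul_left_cancel₀ h.sideK_pos.ne'
    linear_combination 2 * h.shape.ρ * Real.cos (Real.pi / p) * hK - h.sideK_mul_one_add
  have h2 : 2 * (sideL p q / sideK p q) * h.shape.ρ * Real.sin (Real.pi / p) *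
      Real.sin (Real.pi / q) = Real.cos (Real.pi / q) * (1 - h.shape.ρ ^ 2) := by
    apply mul_left_cancel₀ h.sideK_pos.ne'
    linear_combination 2 * h.shape.ρ * Real.sin (Real.pi / p) * Real.sin (Real.pi / q) * hK -
      Real.cos (Real.pi / q) * h.sideK_mul_one_sub +
      2 * h.shape.ρ * Real.sin (Real.pi / q) * h.sideL_mul
  have hG1 := h.one_lt_div
  rw [rotationAbout_snd, vertexReflection_eq]
  have e2 : 2 * Real.pi / (q : ℝ) = 2 * (Real.pi / q) := by ring
  have hE : Complex.exp (((2 * Real.pi / q : ℝ) : ℂ) * Complex.I) =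
      ⟨1 - 2 * Real.sin (Real.pi / q) ^ 2, 2 * Real.sin (Real.pi / q) * Real.cos (Real.pi / q)⟩ := by
    rw [e2]
    apply Complex.ext
    · rw [Complex.exp_ofReal_mul_I_re, Real.cos_two_mul]
      linear_combination 2 * hsq
    · rw [Complex.exp_ofReal_mul_I_im, Real.sin_two_mul]
  rw [hE]
  have hA := vertex_one_eq h.shape
  simp only [hA]
  generalize h.shape.ρ = ρ at *
  generalize sideL p q / sideK p q = g at *
  generalize Real.sin (Real.pi / p) = sn at *
  generalize Real.cos (Real.pi / p) = c at *
  generalize Real.sin (Real.pi / q) = sq at *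
  generalize Real.cos (Real.pi / q) = cq at *
  generalize sideInversion p q (X.2 : ℂ) = z at *
  have hne : (X.2 : ℂ) - g * Complex.I * frame p ≠ 0 := by
    intro h0
    have h3 := congrArg Complex.normSq (sub_eq_zero.1 h0)
    have h4 : Complex.normSq (frame p) = 1 := by
      rw [Complex.mul_conj] at hu; exact_mod_cast hu
    rw [map_mul, map_mul, Complex.normSq_ofReal, Complex.normSq_I, h4] at h3
    nlinarith
  generalize (X.2 : ℂ) = w at *
  set E : ℂ := ⟨1 - 2 * sq ^ 2, 2 * sq * cq⟩ with hEdef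
  have hE1 : E - 1 ≠ 0 := by
    intro h0
    have := congrArg Complex.re h0
    simp [hEdef] at this
    exact hs0.ne' this
  -- Both identities combine the incidence of `A₁` with the side circle, `h1`, and the angle
  -- condition, `h2`.
  have s1 : (ρ : ℂ) * g * (c + sn * Complex.I) * (1 - E) = 1 - ρ ^ 2 * E := by
    apply Complex.ext
    · simp [hEdef, pow_two]
      linear_combination sq ^ 2 * h1 + cq * h2 + (1 - ρ ^ 2) * hsq
    · simp [hEdef, pow_two]
      linear_combination sq * h2 - sq * cq * h1
  have s2 : (ρ : ℂ) * g * (c - sn * Complex.I) * (E - 1) = E - ρ ^ 2 := by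
    apply Complex.ext
    · simp [hEdef, pow_two]
      linear_combination -sq ^ 2 * h1 + cq * h2 + (1 - ρ ^ 2) * hsq
    · simp [hEdef, pow_two]
      linear_combination sq * cq * h1 + sq * h2
  generalize frame p = u at *
  have hη : ((sn + c * Complex.I) * u) * conj ((sn + c * Complex.I) * u) = 1 := by
    have : ((sn : ℂ) + c * Complex.I) * conj ((sn : ℂ) + c * Complex.I) = 1 := by
      simp only [map_add, map_mul, Complex.conj_ofReal, Complex.conj_I]
      have h5 : (sn : ℂ) ^ 2 + c ^ 2 = 1 := by exact_mod_cast hsc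
      linear_combination h5 - (c : ℂ) ^ 2 * Complex.I_sq
    rw [map_mul]
    linear_combination u * conj u * this + hu
  have hA' : (ρ : ℂ) * (sn + c * Complex.I) * u = ρ * ((sn + c * Complex.I) * u) := by ring
  have hηG : ((sn + c * Complex.I) * u) * conj (g * Complex.I * u) = g * (c - sn * Complex.I) := by
    simp only [map_mul, Complex.conj_ofReal, Complex.conj_I]
    linear_combination (-(sn : ℂ) * g * Complex.I - c * g * Complex.I ^ 2) * hu
      - c * g * Complex.I_sq
  have hGη : conj ((sn + c * Complex.I) * u) * (g * Complex.I * u) = g * (c + sn * Complex.I) := by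
    simp only [map_mul, map_add, Complex.conj_ofReal, Complex.conj_I]
    linear_combination ((sn : ℂ) * g * Complex.I - c * g * Complex.I ^ 2) * hu
      - c * g * Complex.I_sq
  rw [hA']
  generalize ((sn : ℂ) + c * Complex.I) * u = η at *
  generalize (g : ℂ) * Complex.I * u = G at *
  have hη0 : conj η ≠ 0 := right_ne_zero_of_mul_eq_one hη
  have hden : 1 - conj ((ρ : ℂ) * η) * w + conj ((ρ : ℂ) * η) * (E * (w - ρ * η)) =
      ρ * conj η * (E - 1) * (w - G) := by
    rw [map_mul, Complex.conj_ofReal]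
    linear_combination -s1 + ρ * (E - 1) * hGη - ρ ^ 2 * E * hη
  have hnum : E * (w - ρ * η) + ρ * η * (1 - conj ((ρ : ℂ) * η) * w) =
      ρ * η * (E - 1) * (conj G * w - 1) := by
    rw [map_mul, Complex.conj_ofReal]
    linear_combination -w * s2 - ρ * (E - 1) * w * hηG - ρ ^ 2 * w * hη
  rw [hden, hnum, div_eq_iff (mul_ne_zero (mul_ne_zero (mul_ne_zero
    (by exact_mod_cast hρ.ne') hη0) hE1) hne), ← hI]
  linear_combination -ρ * (E - 1) * (w - G) * η * conj z * hη

end SL2Cover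

namespace SL2Cover

open ComplexConjugate ReflectionGroup

variable {p q : ℕ}

/-! ### The action of the rotation group on the wall coordinates -/

theorem planeRotation_add (j k : ℤ) (w : ℂ) :
    planeRotation p (j + k) w = planeRotation p j (planeRotation p k w) := by
  simp only [planeRotation, rotation_apply]
  rw [← mul_assoc, ← Circle.coe_mul, ← Circle.exp_add]
  congr 3
  push_cast
  ring

theorem planeRotation_zero (w : ℂ) : planeRotation p 0 w = w := by
  simp [planeRotation]

theorem planeRotation_vertex (S : RegularShape p) (n j : ℤ) :
    planeRotation p n (S.vertex j) = S.vertex (n + j) := by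
  have e : 2 * Real.pi * ((n + j : ℤ) : ℝ) / p = 2 * Real.pi * n / p + 2 * Real.pi * j / p := by
    push_cast; ring
  rw [RegularShape.vertex, RegularShape.vertex, e, planeRotation, rotation_apply, Circle.coe_exp,
    Real.sin_add, Real.cos_add]
  apply Complex.ext
  · rw [Complex.mul_re, Complex.exp_ofReal_mul_I_re, Complex.exp_ofReal_mul_I_im, Real.cos_neg,
      Real.sin_neg]
    ring
  · rw [Complex.mul_im, Complex.exp_ofReal_mul_I_re, Complex.exp_ofReal_mul_I_im, Real.cos_neg,
      Real.sin_neg]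
    ring

variable (p q) in
/-- The action on the wall coordinates of the rotation that takes `A_j` to `A_{j+1}`. -/
noncomputable def turn : Equiv.Perm (Fin 3 → ℝ) :=
  refl (triangleCoeff p q) 1 * refl (triangleCoeff p q) 0

theorem wallCoord_planeRotation_one (h : IsHyperbolic p q) (w : ℂ) :
    wallCoord p q (planeRotation p 1 w) = turn p q (wallCoord p q w) := by
  have h1 := wallCoord_vertexReflection h ((planeReflection p).symm w)
  have h2 := wallCoord_planeReflection (p := p) (q := q) ((planeReflection p).symm w)
  have e : vertexReflection p ((planeReflection p).symm w) =
      planeRotation p 1 (planeReflection p ((planeReflection p).symm w)) := rfl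
  rw [e] at h1
  rw [LinearIsometryEquiv.apply_symm_apply] at h1 h2
  rw [h1, h2, turn, Equiv.Perm.mul_apply, ← Equiv.Perm.mul_apply (refl _ 0), refl_mul_self]
  rfl

theorem wallCoord_planeRotation (h : IsHyperbolic p q) (n : ℤ) (w : ℂ) :
    wallCoord p q (planeRotation p n w) = (turn p q ^ n) (wallCoord p q w) := by
  induction n using Int.induction_on generalizing w with
  | zero => rw [planeRotation_zero, zpow_zero]; rfl
  | succ n ih =>
    rw [planeRotation_add, ih, wallCoord_planeRotation_one h, zpow_add_one]
    rfl
  | pred n ih =>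
    have e := ih (planeRotation p (-1) w)
    have h1 := wallCoord_planeRotation_one h (planeRotation p (-1) w)
    rw [← planeRotation_add, add_neg_cancel, planeRotation_zero] at h1
    rw [sub_eq_add_neg, planeRotation_add, ih, zpow_add, zpow_neg_one, Equiv.Perm.mul_apply, h1]
    exact congrArg _ ((turn p q).symm_apply_apply _).symm

theorem rotationAbout_smul {u : ℂ} (hu : u * conj u = 1) {A A' : Metric.ball (0 : ℂ) 1}
    (hA : (A' : ℂ) = u * A) (ω : ℝ) {X X' : SL2Cover} (hX : (X'.2 : ℂ) = u * X.2) :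
    ((rotationAbout A' ω X').2 : ℂ) = u * (rotationAbout A ω X).2 := by
  have e : ∀ z w : ℂ, conj (u * z) * (u * w) = conj z * w := by
    intro z w
    rw [map_mul]
    linear_combination conj z * w * hu
  rw [rotationAbout_snd, rotationAbout_snd, hA, hX, ← mul_sub, mul_left_comm _ u, e, e, mul_assoc u,
    ← mul_add, mul_div_assoc]

/-- The point over the image of the trace point under a linear isometry. -/
noncomputable def liftIsometry (E : ℂ ≃ₗᵢ[ℝ] ℂ) (X : SL2Cover) : SL2Cover :=
  (X.1, ballIsometry E X.2)

theorem liftIsometry_snd (E : ℂ ≃ₗᵢ[ℝ] ℂ) (X : SL2Cover) :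
    ((liftIsometry E X).2 : ℂ) = E X.2 := rfl

theorem rotationAbout_vertex (S : RegularShape p) (ω : ℝ) (n k : ℤ) (X : SL2Cover) :
    ((rotationAbout ⟨S.vertex (n + k), S.vertex_mem (n + k)⟩ ω
      (liftIsometry (planeRotation p n) X)).2 : ℂ) =
      planeRotation p n (rotationAbout ⟨S.vertex k, S.vertex_mem k⟩ ω X).2 := by
  have hu : ∀ z, planeRotation p n z = (Circle.exp (-(2 * Real.pi * n / p)) : ℂ) * z := fun z =>
    rotation_apply _ _
  rw [hu]
  refine rotationAbout_smul ?_ ?_ ω ?_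
  · rw [Complex.mul_conj, Circle.normSq_coe, Complex.ofReal_one]
  · rw [← hu, planeRotation_vertex]
  · rw [← hu, liftIsometry_snd]

variable (p q) in
/-- The action on the wall coordinates of the rotation by `2π / q` about `A_{n+1}`. -/
noncomputable def vertexTurn (n : ℤ) : Equiv.Perm (Fin 3 → ℝ) :=
  turn p q ^ n * (refl (triangleCoeff p q) 1 * refl (triangleCoeff p q) 2) * (turn p q ^ n)⁻¹

theorem IsRotation.wallCoord_eq (h : IsHyperbolic p q) {k : ℤ} {g : SL2Cover ≃ₜ SL2Cover}
    (hg : IsRotation (h.shape.vertexPoint k) (2 * Real.pi / q) g) (X : SL2Cover) :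
    wallCoord p q (g X).2 = vertexTurn p q (k - 1) (wallCoord p q X.2) := by
  have h1 := rotationAbout_vertex h.shape (2 * Real.pi / q) (k - 1) 1
    (liftIsometry (planeRotation p (-(k - 1))) X)
  have e1 : liftIsometry (planeRotation p (k - 1)) (liftIsometry (planeRotation p (-(k - 1))) X) =
      X := by
    refine Prod.ext rfl (Subtype.ext ?_)
    rw [liftIsometry_snd, liftIsometry_snd, ← planeRotation_add, add_neg_cancel,
      planeRotation_zero]
  have e2 : (⟨h.shape.vertex k, h.shape.vertex_mem k⟩ : Metric.ball (0 : ℂ) 1) =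
      ⟨h.shape.vertex (k - 1 + 1), h.shape.vertex_mem (k - 1 + 1)⟩ := by
    simp only [sub_add_cancel]
  have hX := (liftIsometry (planeRotation p (-(k - 1))) X).normSq_lt_one
  rw [e1, rotationAbout_eq_reflections h] at h1
  rw [IsRotation.snd_eq hg, e2, h1, wallCoord_planeRotation h, wallCoord_vertexReflection h,
    wallCoord_sideInversion h hX, liftIsometry_snd, wallCoord_planeRotation h, zpow_neg]
  rfl

variable (p q) in
/-- The action of the rotation group on the wall coordinates. -/
noncomputable def turnGroup : Subgroup (Equiv.Perm (Fin 3 → ℝ)) :=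
  Subgroup.closure (Set.range (vertexTurn p q))

/-- Only trace points are seen here: group elements that differ by a fibre translation induce the
same permutation, and infinite prisms cannot tell them apart. -/
theorem exists_turn_of_mem (h : IsHyperbolic p q) {g : SL2Cover ≃ₜ SL2Cover}
    (hg : g ∈ h.shape.rotationGroup q) :
    ∃ w ∈ turnGroup p q, ∀ X, wallCoord p q (g X).2 = w (wallCoord p q X.2) := by
  induction hg using Subgroup.closure_induction with
  | mem g hg =>
    obtain ⟨k, hk⟩ := hg
    exact ⟨_, Subgroup.subset_closure ⟨k - 1, rfl⟩, hk.wallCoord_eq h⟩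
  | one => exact ⟨1, one_mem _, fun X => rfl⟩
  | mul g g' _ _ hg hg' =>
    obtain ⟨w, hw, e⟩ := hg
    obtain ⟨w', hw', e'⟩ := hg'
    exact ⟨w * w', mul_mem hw hw', fun X => (e (g' X)).trans (congrArg w (e' X))⟩
  | inv g _ hg =>
    obtain ⟨w, hw, e⟩ := hg
    refine ⟨w⁻¹, inv_mem hw, fun X => ?_⟩
    have h1 := e (g⁻¹ X)
    rw [show g (g⁻¹ X) = X from g.apply_symm_apply X] at h1
    rw [h1]
    exact (w.symm_apply_apply _).symm

theorem exists_mem_of_turn (h : IsHyperbolic p q) {w : Equiv.Perm (Fin 3 → ℝ)}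
    (hw : w ∈ turnGroup p q) :
    ∃ g ∈ h.shape.rotationGroup q, ∀ X, wallCoord p q (g X).2 = w (wallCoord p q X.2) := by
  induction hw using Subgroup.closure_induction with
  | mem w hw =>
    obtain ⟨n, rfl⟩ := hw
    have hr : IsRotation (h.shape.vertexPoint (n + 1)) (2 * Real.pi / q) _ :=
      isRotation_rotationAbout ⟨h.shape.vertex (n + 1), h.shape.vertex_mem (n + 1)⟩ _
    refine ⟨_, Subgroup.subset_closure ⟨n + 1, hr⟩, fun X => ?_⟩
    rw [hr.wallCoord_eq h, add_sub_cancel_right]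
  | one => exact ⟨1, one_mem _, fun X => rfl⟩
  | mul w w' _ _ hw hw' =>
    obtain ⟨g, hg, e⟩ := hw
    obtain ⟨g', hg', e'⟩ := hw'
    exact ⟨g * g', mul_mem hg hg', fun X => (e (g' X)).trans (congrArg w (e' X))⟩
  | inv w _ hw =>
    obtain ⟨g, hg, e⟩ := hw
    refine ⟨g⁻¹, inv_mem hg, fun X => ?_⟩
    have h1 := e (g⁻¹ X)
    rw [show g (g⁻¹ X) = X from g.apply_symm_apply X] at h1
    rw [h1]
    exact (w.symm_apply_apply _).symm

theorem turn_mem_gen : turn p q ∈ gen (triangleCoeff p q) {0, 1} :=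
  mul_mem (refl_mem_gen (by simp)) (refl_mem_gen (by simp))

theorem turnGroup_le : turnGroup p q ≤ gen (triangleCoeff p q) Set.univ := by
  refine (Subgroup.closure_le _).2 ?_
  rintro _ ⟨n, rfl⟩
  have h1 : turn p q ^ n ∈ gen (triangleCoeff p q) Set.univ :=
    zpow_mem (gen_mono (Set.subset_univ _) turn_mem_gen) n
  exact mul_mem (mul_mem h1 (mul_mem (refl_mem_gen trivial) (refl_mem_gen trivial))) (inv_mem h1)

theorem turn_conj_vertexTurn (n : ℤ) :
    turn p q * vertexTurn p q n * (turn p q)⁻¹ = vertexTurn p q (n + 1) := by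
  rw [vertexTurn, vertexTurn, add_comm, zpow_one_add]
  group

/-- The reflection exchanging `A₀` and `A₁` takes `A_{n+1}` to `A_{-n}` and reverses the sense of
rotation. -/
theorem refl_zero_conj_vertexTurn (n : ℤ) : refl (triangleCoeff p q) 0 * vertexTurn p q n *
    (refl (triangleCoeff p q) 0)⁻¹ = (vertexTurn p q (-n - 1))⁻¹ := by
  have ht : refl (triangleCoeff p q) 0 * turn p q * (refl (triangleCoeff p q) 0)⁻¹ =
      (turn p q)⁻¹ := by
    rw [turn, mul_inv_rev, refl_inv, refl_inv, mul_assoc, mul_assoc, refl_mul_self, mul_one]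
  have hn : refl (triangleCoeff p q) 0 * turn p q ^ n * (refl (triangleCoeff p q) 0)⁻¹ =
      turn p q ^ (-n) := by
    rw [← conj_zpow, ht, inv_zpow, zpow_neg]
  have hs : refl (triangleCoeff p q) 0 *
      (refl (triangleCoeff p q) 1 * refl (triangleCoeff p q) 2) *
      (refl (triangleCoeff p q) 0)⁻¹ = (turn p q)⁻¹ *
      (refl (triangleCoeff p q) 1 * refl (triangleCoeff p q) 2)⁻¹ * turn p q := by
    rw [turn, mul_inv_rev, mul_inv_rev, refl_inv, refl_inv, refl_inv]
    simp only [mul_assoc, refl_mul_cancel]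
  have e : refl (triangleCoeff p q) 0 * vertexTurn p q n * (refl (triangleCoeff p q) 0)⁻¹ =
      (refl (triangleCoeff p q) 0 * turn p q ^ n * (refl (triangleCoeff p q) 0)⁻¹) *
      (refl (triangleCoeff p q) 0 *
      (refl (triangleCoeff p q) 1 * refl (triangleCoeff p q) 2) *
      (refl (triangleCoeff p q) 0)⁻¹) *
      (refl (triangleCoeff p q) 0 * turn p q ^ n * (refl (triangleCoeff p q) 0)⁻¹)⁻¹ := by
    rw [vertexTurn]
    generalize refl (triangleCoeff p q) 1 * refl (triangleCoeff p q) 2 = x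
    group
  rw [e, hn, hs, vertexTurn]
  generalize refl (triangleCoeff p q) 1 * refl (triangleCoeff p q) 2 = x
  group

theorem conj_mem_turnGroup_of_generators {s : Equiv.Perm (Fin 3 → ℝ)}
    (hs : ∀ n, s * vertexTurn p q n * s⁻¹ ∈ turnGroup p q) {w : Equiv.Perm (Fin 3 → ℝ)}
    (hw : w ∈ turnGroup p q) : s * w * s⁻¹ ∈ turnGroup p q := by
  induction hw using Subgroup.closure_induction with
  | mem w hw =>
    obtain ⟨n, rfl⟩ := hw
    exact hs n
  | one => rw [mul_one, mul_inv_cancel]; exact one_mem _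
  | mul w w' _ _ hw hw' =>
    have e : s * (w * w') * s⁻¹ = (s * w * s⁻¹) * (s * w' * s⁻¹) := by group
    rw [e]; exact mul_mem hw hw'
  | inv w _ hw =>
    have e : s * w⁻¹ * s⁻¹ = (s * w * s⁻¹)⁻¹ := by group
    rw [e]; exact inv_mem hw

/-- The symmetries of the polygon permute its vertices, hence the generating vertex rotations up to
inversion. -/
theorem conj_mem_turnGroup {u w : Equiv.Perm (Fin 3 → ℝ)}
    (hu : u ∈ gen (triangleCoeff p q) {0, 1}) (hw : w ∈ turnGroup p q) :
    u * w * u⁻¹ ∈ turnGroup p q := by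
  have h0 : ∀ w ∈ turnGroup p q, refl (triangleCoeff p q) 0 * w *
      (refl (triangleCoeff p q) 0)⁻¹ ∈ turnGroup p q := fun w hw =>
    conj_mem_turnGroup_of_generators (fun n => by
      rw [refl_zero_conj_vertexTurn]
      exact inv_mem (Subgroup.subset_closure ⟨_, rfl⟩)) hw
  have ht : ∀ w ∈ turnGroup p q, turn p q * w * (turn p q)⁻¹ ∈ turnGroup p q := fun w hw =>
    conj_mem_turnGroup_of_generators (fun n => by
      rw [turn_conj_vertexTurn]
      exact Subgroup.subset_closure ⟨_, rfl⟩) hw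
  have h1 : refl (triangleCoeff p q) 1 = turn p q * refl (triangleCoeff p q) 0 := by
    rw [turn, mul_assoc, refl_mul_self, mul_one]
  obtain ⟨l, hl, rfl⟩ := exists_word hu
  clear hu
  induction l with
  | nil => simpa [word] using hw
  | cons i l ih =>
    have ih := ih fun j hj => hl j (by simp [hj])
    have e : word (triangleCoeff p q) (i :: l) * w * (word (triangleCoeff p q) (i :: l))⁻¹ =
        refl (triangleCoeff p q) i * (word (triangleCoeff p q) l * w *
          (word (triangleCoeff p q) l)⁻¹) * (refl (triangleCoeff p q) i)⁻¹ := by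
      rw [word_cons, mul_inv_rev]
      simp only [mul_assoc]
    rw [e]
    rcases hl i (by simp) with rfl | hi
    · exact h0 _ ih
    · rw [Set.mem_singleton_iff] at hi
      subst hi
      have := ht _ (h0 _ ih)
      rw [h1, mul_inv_rev]
      simpa only [mul_assoc] using this

/-- The third reflection is the second one times the rotation about `A₁`. That rotation is moved
past the dihedral factor by conjugation, which stays in `turnGroup`. -/
theorem exists_mul_of_mem_gen {w : Equiv.Perm (Fin 3 → ℝ)}
    (hw : w ∈ gen (triangleCoeff p q) Set.univ) :
    ∃ u ∈ gen (triangleCoeff p q) {0, 1}, ∃ v ∈ turnGroup p q, w = u * v := by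
  obtain ⟨l, -, rfl⟩ := exists_word hw
  clear hw
  induction l with
  | nil => exact ⟨1, one_mem _, 1, one_mem _, by simp [word]⟩
  | cons i l ih =>
    obtain ⟨u, hu, v, hv, e⟩ := ih
    rw [word_cons, e]
    fin_cases i
    · exact ⟨_, mul_mem (refl_mem_gen (by simp)) hu, v, hv, (mul_assoc _ _ _).symm⟩
    · exact ⟨_, mul_mem (refl_mem_gen (by simp)) hu, v, hv, (mul_assoc _ _ _).symm⟩
    · have h0 : vertexTurn p q 0 ∈ turnGroup p q := Subgroup.subset_closure ⟨0, rfl⟩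
      have h1 := conj_mem_turnGroup (inv_mem hu) h0
      refine ⟨refl (triangleCoeff p q) 1 * u, mul_mem (refl_mem_gen (by simp)) hu,
        _, mul_mem h1 hv, ?_⟩
      have e2 : vertexTurn p q 0 =
          refl (triangleCoeff p q) 1 * refl (triangleCoeff p q) 2 := by
        simp [vertexTurn]
      rw [e2, inv_inv]
      change refl (triangleCoeff p q) 2 * _ = _
      simp only [mul_assoc, mul_inv_cancel_left, refl_mul_cancel]

end SL2Cover

namespace SL2Cover

open ComplexConjugate ReflectionGroup

variable {p q : ℕ}

/-! ### The polygon in wall coordinates -/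

theorem normSq_ball_lt (z : Metric.ball (0 : ℂ) 1) : Complex.normSq (z : ℂ) < 1 :=
  normSq_lt_one ((0, z) : SL2Cover)

theorem continuous_wallCoord : Continuous fun z : Metric.ball (0 : ℂ) 1 => wallCoord p q z := by
  have hr : Continuous fun z : Metric.ball (0 : ℂ) 1 => radial p z :=
    continuous_radial.comp continuous_subtype_val
  have ht : Continuous fun z : Metric.ball (0 : ℂ) 1 => tangential p z :=
    continuous_tangential.comp continuous_subtype_val
  have hn : Continuous fun z : Metric.ball (0 : ℂ) 1 => Complex.normSq (z : ℂ) :=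
    Complex.continuous_normSq.comp continuous_subtype_val
  have h0 : ∀ z : Metric.ball (0 : ℂ) 1, 1 - Complex.normSq (z : ℂ) ≠ 0 := fun z =>
    (sub_pos.2 (normSq_ball_lt z)).ne'
  refine continuous_pi fun i => ?_
  fin_cases i
  · exact Continuous.div (by fun_prop) (by fun_prop) h0
  · exact Continuous.div (by fun_prop) (by fun_prop) h0
  · exact Continuous.div (by fun_prop) (by fun_prop) h0

theorem exists_isometry_of_mem_gen (h : IsHyperbolic p q) {u : Equiv.Perm (Fin 3 → ℝ)}
    (hu : u ∈ gen (triangleCoeff p q) {0, 1}) : ∃ E : ℂ ≃ₗᵢ[ℝ] ℂ,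
      (∀ z, wallCoord p q (E z) = u (wallCoord p q z)) ∧
      ∀ z, E z ∈ h.shape.baseFigure ↔ z ∈ h.shape.baseFigure := by
  obtain ⟨l, hl, rfl⟩ := exists_word hu
  clear hu
  induction l with
  | nil => exact ⟨LinearIsometryEquiv.refl ℝ ℂ, fun z => rfl, fun z => Iff.rfl⟩
  | cons i l ih =>
    obtain ⟨E, h1, h2⟩ := ih fun j hj => hl j (by simp [hj])
    rw [word_cons]
    rcases hl i (by simp) with rfl | hi
    · refine ⟨E.trans (planeReflection p), fun z => ?_, fun z => ?_⟩
      · exact (wallCoord_planeReflection _).trans (congrArg _ (h1 z))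
      · exact (h.shape.planeReflection_mem_baseFigure _).trans (h2 z)
    · rw [Set.mem_singleton_iff] at hi
      subst hi
      refine ⟨E.trans (vertexReflection p), fun z => ?_, fun z => ?_⟩
      · exact (wallCoord_vertexReflection h _).trans (congrArg _ (h1 z))
      · exact (h.shape.planeRotation_mem_baseFigure _ _).trans
          ((h.shape.planeReflection_mem_baseFigure _).trans (h2 z))

theorem mem_baseFigure_of_wallCoord_nonneg (h : IsHyperbolic p q) {z : ℂ}
    (hz : Complex.normSq z < 1) (ha : ∀ i, 0 ≤ wallCoord p q z i) : z ∈ h.shape.baseFigure := by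
  have hN : 0 < 1 - Complex.normSq z := sub_pos.2 hz
  have a0 : 0 ≤ 2 * tangential p z := by
    have := mul_nonneg (ha 0) hN.le
    rwa [show wallCoord p q z 0 = 2 * tangential p z / (1 - Complex.normSq z) from rfl,
      div_mul_cancel₀ _ hN.ne'] at this
  have a1 : 0 ≤ 2 * (radial p z * Real.sin (Real.pi / p) -
      tangential p z * Real.cos (Real.pi / p)) := by
    have := mul_nonneg (ha 1) hN.le
    rwa [show wallCoord p q z 1 = 2 * (radial p z * Real.sin (Real.pi / p) -
      tangential p z * Real.cos (Real.pi / p)) / (1 - Complex.normSq z) from rfl,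
      div_mul_cancel₀ _ hN.ne'] at this
  have a2 : 0 ≤ sideK p q * (1 + Complex.normSq z) - 2 * sideL p q * radial p z := by
    have := mul_nonneg (ha 2) hN.le
    rwa [show wallCoord p q z 2 = (sideK p q * (1 + Complex.normSq z) -
      2 * sideL p q * radial p z) / (1 - Complex.normSq z) from rfl,
      div_mul_cancel₀ _ hN.ne'] at this
  have hsec : |tangential p z| * Real.cos (Real.pi / p) ≤
      radial p z * Real.sin (Real.pi / p) := by
    rw [abs_of_nonneg (by linarith)]; linarith
  have hx := RegularShape.radial_nonneg_of_sector h.three_le hsec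
  have hc := cos_pi_div_pos h.three_le
  have hL := h.one_lt_sideL
  have hK := h.sideK_pos
  have hsc := Real.sin_sq_add_cos_sq (Real.pi / p)
  apply h.shape.mem_baseFigure_of_sector h.three_le _ hsec
  · have h1 := h.sideForm_zero z
    nlinarith
  -- In the sector the radial coordinate is at least `‖z‖ cos (π/p)`, so `‖z‖` satisfies the
  -- quadratic inequality with roots `ρ` and `1/ρ`; being below `1`, it is at most `ρ`.
  · have hr0 := norm_nonneg z
    have hr2 : ‖z‖ ^ 2 = Complex.normSq z := (Complex.normSq_eq_norm_sq z).symm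
    have hr1 : ‖z‖ < 1 := by nlinarith
    have hrc : ‖z‖ * Real.cos (Real.pi / p) ≤ radial p z := by
      apply abs_le_of_sq_le_sq' _ hx |>.2
      rw [mul_pow, hr2, normSq_eq_coords p]
      have h3 : (|tangential p z| * Real.cos (Real.pi / p)) ^ 2 ≤
          (radial p z * Real.sin (Real.pi / p)) ^ 2 := pow_le_pow_left₀ (by positivity) hsec 2
      rw [mul_pow, mul_pow, sq_abs] at h3
      linear_combination h3 + radial p z ^ 2 * hsc
    have hρ := h.shape.ρ_pos
    have hρ1 := h.shape.ρ_lt_one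
    have h4 := h.sideK_mul_one_add
    rw [← hr2] at a2
    by_contra hlt
    push Not at hlt
    have h5 : 0 < sideK p q * (‖z‖ - h.shape.ρ) * (1 - ‖z‖ * h.shape.ρ) := by
      have : 0 < 1 - ‖z‖ * h.shape.ρ := by nlinarith
      have : 0 < ‖z‖ - h.shape.ρ := sub_pos.2 hlt
      positivity
    have h6 : 0 ≤ h.shape.ρ * (sideK p q * (1 + ‖z‖ ^ 2) -
        2 * sideL p q * (‖z‖ * Real.cos (Real.pi / p))) := by
      apply mul_nonneg hρ.le
      nlinarith
    linarith [congrArg (fun t => ‖z‖ * t) h4]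

/-! ### The height function -/

variable (p q) in
/-- The parameter of the height function. -/
noncomputable def heightParam : ℝ := min (sideK p q ^ 2 / 2) (sideK p q / 6)

variable (p q) in
/-- A positive linear function on the cone over the characteristic triangle. -/
noncomputable def height (v : Fin 3 → ℝ) : ℝ :=
  ((sideL p q / Real.sin (Real.pi / p) - heightParam p q) * Real.cos (Real.pi / p) -
    heightParam p q * Real.sin (Real.pi / p) ^ 2 / 2) * v 0 +
  (sideL p q / Real.sin (Real.pi / p) - heightParam p q) * v 1 + v 2

variable (p q) in
/-- The slopes of the height function along the reflections. -/
noncomputable def heightSlope : Fin 3 → ℝ :=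
  ![heightParam p q * Real.sin (Real.pi / p) ^ 2,
    heightParam p q * Real.sin (Real.pi / p) ^ 2 * (2 - Real.cos (Real.pi / p)),
    2 * (sideK p q ^ 2 - heightParam p q * Real.cos (Real.pi / q))]

theorem IsHyperbolic.heightParam_pos (h : IsHyperbolic p q) : 0 < heightParam p q := by
  have := h.sideK_pos
  exact lt_min (by positivity) (by positivity)

/-- The product with the centre of the polygon has slope zero along the two walls through it. The
term with `heightParam` moves the reference point slightly into the triangle, which makes all three
slopes positive. -/
theorem heightSlope_pos (h : IsHyperbolic p q) (i : Fin 3) : 0 < heightSlope p q i := by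
  have h1 := h.heightParam_pos
  have h2 := sin_pi_div_pos h.three_le
  have h3 := Real.cos_le_one (Real.pi / p)
  fin_cases i
  · change 0 < heightParam p q * Real.sin (Real.pi / p) ^ 2
    positivity
  · change 0 < heightParam p q * Real.sin (Real.pi / p) ^ 2 * (2 - Real.cos (Real.pi / p))
    exact mul_pos (by positivity) (by linarith)
  · change 0 < 2 * (sideK p q ^ 2 - heightParam p q * Real.cos (Real.pi / q))
    have h4 := Real.cos_le_one (Real.pi / q)
    have h5 : heightParam p q ≤ sideK p q ^ 2 / 2 := min_le_left _ _
    have h6 : 0 < sideK p q ^ 2 := pow_pos h.sideK_pos 2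
    nlinarith

theorem height_refl (h : IsHyperbolic p q) (i : Fin 3) (v : Fin 3 → ℝ) :
    height p q (refl (triangleCoeff p q) i v) = height p q v + heightSlope p q i * v i := by
  have h2 := (sin_pi_div_pos h.three_le).ne'
  have hsc := Real.sin_sq_add_cos_sq (Real.pi / p)
  have hL := h.sideL_mul
  have hK := h.sideK_sq
  have hl : sideL p q / Real.sin (Real.pi / p) * Real.sin (Real.pi / p) = sideL p q :=
    div_mul_cancel₀ _ h2
  generalize hlam : sideL p q / Real.sin (Real.pi / p) = lam at *
  fin_cases i
  · change height p q (refl (triangleCoeff p q) 0 v) = _ + _ * v 0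
    rw [refl_triangle_zero]
    simp only [height, heightSlope, hlam, Matrix.cons_val]
    change _ = _ + heightParam p q * Real.sin (Real.pi / p) ^ 2 * v 0
    ring
  · change height p q (refl (triangleCoeff p q) 1 v) = _ + _ * v 1
    rw [refl_triangle_one]
    simp only [height, heightSlope, hlam, Matrix.cons_val]
    change _ = _ + heightParam p q * Real.sin (Real.pi / p) ^ 2 * (2 - Real.cos (Real.pi / p)) * v 1
    linear_combination (2 * lam - 2 * heightParam p q) * v 1 * hsc - 2 * v 1 * hL -
      2 * v 1 * Real.sin (Real.pi / p) * hl
  · change height p q (refl (triangleCoeff p q) 2 v) = _ + _ * v 2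
    rw [refl_triangle_two]
    simp only [height, heightSlope, hlam, Matrix.cons_val]
    change _ = _ + 2 * (sideK p q ^ 2 - heightParam p q * Real.cos (Real.pi / q)) * v 2
    linear_combination -2 * v 2 * hK + 2 * v 2 * sideL p q * hl - 2 * lam * v 2 * hL

/-- The perturbation costs at most `3 * heightParam ≤ sideK / 2` in the numerator, so the height
still tends to infinity at the boundary of the disc. -/
theorem height_wallCoord (h : IsHyperbolic p q) {z : ℂ} (hz : Complex.normSq z < 1) :
    sideK p q / 2 / (1 - Complex.normSq z) ≤ height p q (wallCoord p q z) := by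
  have h2 := sin_pi_div_pos h.three_le
  have hN : 0 < 1 - Complex.normSq z := sub_pos.2 hz
  have hl : sideL p q / Real.sin (Real.pi / p) * Real.sin (Real.pi / p) = sideL p q :=
    div_mul_cancel₀ _ h2.ne'
  have h3 := h.heightParam_pos
  have h4 : heightParam p q ≤ sideK p q / 6 := min_le_right _ _
  have h5 := Complex.normSq_nonneg z
  have h6 := h.sideK_pos
  have h7 := Real.sin_le_one (Real.pi / p)
  have hx : |radial p z| ≤ 1 := by
    apply abs_le_of_sq_le_sq _ one_pos.le
    have := normSq_eq_coords p z
    nlinarith [sq_nonneg (tangential p z)]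
  have hs : |tangential p z| ≤ 1 := by
    apply abs_le_of_sq_le_sq _ one_pos.le
    have := normSq_eq_coords p z
    nlinarith [sq_nonneg (radial p z)]
  have e : height p q (wallCoord p q z) = (sideK p q * (1 + Complex.normSq z) -
      heightParam p q * (2 * (Real.sin (Real.pi / p) * radial p z) +
        Real.sin (Real.pi / p) ^ 2 * tangential p z)) / (1 - Complex.normSq z) := by
    simp only [height, wallCoord, Matrix.cons_val]
    rw [mul_div_assoc', mul_div_assoc', ← add_div, ← add_div]
    congr 1
    linear_combination 2 * radial p z * hl
  rw [e]
  gcongr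
  have b1 : Real.sin (Real.pi / p) * radial p z ≤ 1 := by
    nlinarith [(abs_le.1 hx).2]
  have b2 : Real.sin (Real.pi / p) ^ 2 * tangential p z ≤ 1 := by
    have : Real.sin (Real.pi / p) ^ 2 ≤ 1 := by nlinarith
    nlinarith [(abs_le.1 hs).2, sq_nonneg (Real.sin (Real.pi / p))]
  have b3 : heightParam p q * (2 * (Real.sin (Real.pi / p) * radial p z) +
        Real.sin (Real.pi / p) ^ 2 * tangential p z) ≤ heightParam p q * 3 := by
    gcongr; linarith
  nlinarith

theorem continuous_height : Continuous (height p q) := by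
  unfold height; fun_prop

theorem isCompact_preimage_closedBall {r : ℝ} (hr : r < 1) :
    IsCompact {z : Metric.ball (0 : ℂ) 1 | ‖(z : ℂ)‖ ≤ r} := by
  rw [Topology.IsInducing.subtypeVal.isCompact_iff]
  have : (Subtype.val '' {z : Metric.ball (0 : ℂ) 1 | ‖(z : ℂ)‖ ≤ r}) =
      Metric.closedBall (0 : ℂ) r := by
    ext w
    rw [mem_closedBall_zero_iff]
    constructor
    · rintro ⟨z, hz, rfl⟩
      exact hz
    · intro hw
      exact ⟨⟨w, mem_ball_zero_iff.2 (hw.trans_lt hr)⟩, hw, rfl⟩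
  rw [this]
  exact isCompact_closedBall _ _

theorem isCompact_height_le (h : IsHyperbolic p q) (M : ℝ) :
    IsCompact {z : Metric.ball (0 : ℂ) 1 | height p q (wallCoord p q z) ≤ M} := by
  have hK := h.sideK_pos
  have hM : 0 < |M| + sideK p q := by positivity
  have hr : √(1 - sideK p q / 2 / (|M| + sideK p q)) < 1 := by
    rw [Real.sqrt_lt' one_pos]
    have : 0 < sideK p q / 2 / (|M| + sideK p q) := by positivity
    linarith
  refine (isCompact_preimage_closedBall hr).of_isClosed_subset
    (isClosed_le (continuous_height.comp continuous_wallCoord) continuous_const) fun z hz => ?_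
  have hN : 0 < 1 - Complex.normSq (z : ℂ) := sub_pos.2 (normSq_ball_lt z)
  have h1 := (height_wallCoord h (normSq_ball_lt z)).trans hz
  have h2 : sideK p q / 2 / (1 - Complex.normSq (z : ℂ)) ≤ |M| + sideK p q :=
    h1.trans (by linarith [le_abs_self M])
  rw [div_le_iff₀ hN] at h2
  apply Real.le_sqrt_of_sq_le
  rw [← Complex.normSq_eq_norm_sq]
  have h3 : sideK p q / 2 / (|M| + sideK p q) ≤ 1 - Complex.normSq (z : ℂ) := by
    rw [div_le_iff₀ hM]; linarith
  linarith

theorem exists_wallCoord_nonneg (h : IsHyperbolic p q) (z : Metric.ball (0 : ℂ) 1) :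
    ∃ w ∈ gen (triangleCoeff p q) Set.univ, ∀ i, 0 ≤ w (wallCoord p q z) i := by
  refine exists_nonneg h.isAngles (a := fun z : Metric.ball (0 : ℂ) 1 => wallCoord p q z)
    continuous_wallCoord (fun i z => ?_) continuous_height ?_ (heightSlope_pos h) (height_refl h)
    (fun z => ?_) (isCompact_height_le h) z
  · fin_cases i
    · exact ⟨ballIsometry (planeReflection p) z, wallCoord_planeReflection _⟩
    · exact ⟨ballIsometry (vertexReflection p) z, wallCoord_vertexReflection h _⟩
    · refine ⟨⟨sideInversion p q z, ?_⟩, wallCoord_sideInversion h (normSq_ball_lt z)⟩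
      rw [mem_ball_zero_iff, ← sq_lt_one_iff₀ (norm_nonneg _), ← Complex.normSq_eq_norm_sq]
      exact h.normSq_sideInversion_lt (normSq_ball_lt z)
  · simp [height]
  · have hK := h.sideK_pos
    have := sub_pos.2 (normSq_ball_lt z)
    exact lt_of_lt_of_le (by positivity) (height_wallCoord h (normSq_ball_lt z))

/-- The polygon is the union of the images of the characteristic triangle under the dihedral
group. -/
theorem mem_baseFigure_iff (h : IsHyperbolic p q) {z : ℂ} (hz : Complex.normSq z < 1) :
    z ∈ h.shape.baseFigure ↔
      ∃ u ∈ gen (triangleCoeff p q) {0, 1}, ∀ i, 0 ≤ u (wallCoord p q z) i := by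
  constructor
  · intro hB
    -- The finite dihedral group moves the point to the right side of the first two walls. The third
    -- inequality is the side form, since the group preserves the polygon.
    obtain ⟨u, hu, hn⟩ := exists_nonneg_of_finite
      (finite_gen_pair h.isAngles (show (0 : Fin 3) ≠ 1 by decide))
      (heightSlope_pos h) (height_refl h) (wallCoord p q z)
    obtain ⟨E, hE, hEB⟩ := exists_isometry_of_mem_gen h hu
    refine ⟨u, hu, fun i => ?_⟩
    fin_cases i
    · exact hn 0 (by simp)
    · exact hn 1 (by simp)
    · have h1 := ((hEB z).2 hB).2 0
      have h2 := h.sideForm_zero (E z)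
      have hL := h.one_lt_sideL
      change 0 ≤ u (wallCoord p q z) 2
      rw [← hE]
      have hN : Complex.normSq (E z) = Complex.normSq z := by
        rw [Complex.normSq_eq_norm_sq, E.norm_map, Complex.normSq_eq_norm_sq]
      refine div_nonneg ?_ ?_
      · rw [← h2]; nlinarith
      · rw [hN]; exact (sub_pos.2 hz).le
  · rintro ⟨u, hu, hn⟩
    obtain ⟨E, hE, hEB⟩ := exists_isometry_of_mem_gen h hu
    rw [← hEB]
    apply mem_baseFigure_of_wallCoord_nonneg h
    · rwa [Complex.normSq_eq_norm_sq, E.norm_map, ← Complex.normSq_eq_norm_sq]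
    · rwa [hE]

end SL2Cover

namespace SL2Cover

open ComplexConjugate ReflectionGroup

variable {p q : ℕ}

/-! ### The infinite tiling -/

theorem wallCoord_two_eq_zero_iff (h : IsHyperbolic p q) {z : ℂ} (hz : Complex.normSq z < 1) :
    wallCoord p q z 2 = 0 ↔ h.shape.sideForm 0 z = 0 := by
  have hN : 1 - Complex.normSq z ≠ 0 := (sub_pos.2 hz).ne'
  have hL := h.one_lt_sideL
  change (sideK p q * (1 + Complex.normSq z) - 2 * sideL p q * radial p z) /
    (1 - Complex.normSq z) = 0 ↔ _
  rw [← h.sideForm_zero, div_eq_zero_iff, or_iff_left hN, mul_eq_zero, or_iff_right (by linarith)]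

theorem sideInversion_eq_self (h : IsHyperbolic p q) {z : ℂ} (hz : Complex.normSq z < 1)
    (h0 : wallCoord p q z 2 = 0) : sideInversion p q z = z := by
  have hN : 1 - Complex.normSq z ≠ 0 := (sub_pos.2 hz).ne'
  have h1 : sideK p q * (1 + Complex.normSq z) - 2 * sideL p q * radial p z = 0 := by
    rcases div_eq_zero_iff.1 (show (sideK p q * (1 + Complex.normSq z) -
      2 * sideL p q * radial p z) / (1 - Complex.normSq z) = 0 from h0) with h2 | h2
    exacts [h2, absurd h2 hN]
  have hg := h.sideK_mul_div
  have hK2 := h.sideK_sq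
  have e : sideK p q ^ 2 * ((radial p z - sideL p q / sideK p q) ^ 2 + tangential p z ^ 2) = 1 := by
    rw [normSq_eq_coords p] at h1
    linear_combination sideK p q * h1 - hK2 +
      (sideL p q + sideK p q * (sideL p q / sideK p q) - 2 * sideK p q * radial p z) * hg
  rw [sideInversion, e, div_one, div_one, add_sub_cancel, ofCoords_radial_tangential]

theorem sideInversion_mem_sideCurve (h : IsHyperbolic p q) {z : ℂ} (hz : Complex.normSq z < 1) :
    sideInversion p q z ∈ h.shape.sideCurve 0 ↔ z ∈ h.shape.sideCurve 0 := by
  constructor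
  · intro hm
    have h1 := (wallCoord_two_eq_zero_iff h (h.normSq_sideInversion_lt hz)).2 hm.2
    rw [wallCoord_sideInversion h hz, refl_triangle_two] at h1
    rwa [sideInversion_eq_self h hz (neg_eq_zero.1 h1)] at hm
  · intro hm
    rwa [sideInversion_eq_self h hz ((wallCoord_two_eq_zero_iff h hz).2 hm.2)]

/-- After turning back by `k` steps, the rotation is the inversion, which fixes the side with index
`0` pointwise, followed by the reflection taking that side to the next one. -/
theorem rotationAbout_image_side (h : IsHyperbolic p q) (k : ℤ) :
    rotationAbout ⟨h.shape.vertex (k + 1), h.shape.vertex_mem (k + 1)⟩ (2 * Real.pi / q) ''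
      h.shape.infiniteSideFace k = h.shape.infiniteSideFace (k + 1) := by
  refine image_eq_of_mem_iff fun X => and_congr ?_ Iff.rfl
  have h1 := rotationAbout_vertex h.shape (2 * Real.pi / q) k 1
    (liftIsometry (planeRotation p (-k)) X)
  have e1 : liftIsometry (planeRotation p k) (liftIsometry (planeRotation p (-k)) X) = X := by
    refine Prod.ext rfl (Subtype.ext ?_)
    rw [liftIsometry_snd, liftIsometry_snd, ← planeRotation_add, add_neg_cancel,
      planeRotation_zero]
  have hX := (liftIsometry (planeRotation p (-k)) X).normSq_lt_one
  rw [e1, rotationAbout_eq_reflections h] at h1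
  rw [h1, RegularShape.planeRotation_mem_sideCurve, add_sub_cancel_left]
  refine (h.shape.planeRotation_mem_sideCurve 1 1 _).trans ?_
  rw [sub_self]
  refine (h.shape.planeReflection_mem_sideCurve_zero _).trans ?_
  rw [sideInversion_mem_sideCurve h hX, liftIsometry_snd, RegularShape.planeRotation_mem_sideCurve, sub_neg_eq_add, zero_add]

theorem exists_direction (h : IsHyperbolic p q) (i : Fin 3) {z : ℂ} (hz : Complex.normSq z < 1)
    (h0 : wallCoord p q z i = 0) : ∃ d : ℂ, ∀ t : ℝ, 0 < t → Complex.normSq (z + t * d) < 1 →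
      wallCoord p q (z + t * d) i ≠ 0 := by
  have hN : 1 - Complex.normSq z ≠ 0 := (sub_pos.2 hz).ne'
  have hr : ∀ (t : ℝ) (d : ℂ), radial p (z + t * d) = radial p z + t * radial p d := by
    intro t d; simp [radial]; ring
  have ht : ∀ (t : ℝ) (d : ℂ), tangential p (z + t * d) =
      tangential p z + t * tangential p d := by
    intro t d; simp [tangential]; ring
  fin_cases i
  · have h1 : 2 * tangential p z = 0 := (div_eq_zero_iff.1 h0).resolve_right hN
    refine ⟨ofCoords p 0 1, fun t htp hn => div_ne_zero ?_ (sub_pos.2 hn).ne'⟩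
    rw [ht, tangential_ofCoords]
    intro h2
    linarith
  · have h1 : 2 * (radial p z * Real.sin (Real.pi / p) - tangential p z * Real.cos (Real.pi / p)) =
      0 := (div_eq_zero_iff.1 h0).resolve_right hN
    refine ⟨ofCoords p 1 0, fun t htp hn => div_ne_zero ?_ (sub_pos.2 hn).ne'⟩
    rw [ht, hr, tangential_ofCoords, radial_ofCoords]
    intro h2
    have := mul_pos htp (sin_pi_div_pos h.three_le)
    linarith
  · have h1 : sideK p q * (1 + Complex.normSq z) - 2 * sideL p q * radial p z = 0 :=
      (div_eq_zero_iff.1 h0).resolve_right hN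
    -- A move parallel to the chord and away from its midpoint line increases `|w|` and keeps the
    -- radial coordinate, so the third coordinate cannot stay zero.
    obtain ⟨σ, hσ, hσs⟩ : ∃ σ : ℝ, σ ^ 2 = 1 ∧ 0 ≤ σ * tangential p z := by
      rcases le_total 0 (tangential p z) with h2 | h2
      · exact ⟨1, by norm_num, by linarith⟩
      · exact ⟨-1, by norm_num, by linarith⟩
    refine ⟨ofCoords p 0 σ, fun t htp hn => div_ne_zero ?_ (sub_pos.2 hn).ne'⟩
    rw [normSq_eq_coords p] at h1 ⊢
    rw [ht, hr, tangential_ofCoords, radial_ofCoords]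
    intro h2
    have h3 : sideK p q * (2 * t * (σ * tangential p z) + t ^ 2) = 0 := by
      linear_combination h2 - h1 - sideK p q * t ^ 2 * hσ
    have hK := h.sideK_pos
    have : 0 < sideK p q * (2 * t * (σ * tangential p z) + t ^ 2) := by positivity
    linarith

theorem dense_wallCoord_ne_zero (h : IsHyperbolic p q) (i : Fin 3) :
    Dense {z : Metric.ball (0 : ℂ) 1 | wallCoord p q z i ≠ 0} := by
  rw [dense_iff_inter_open]
  rintro U hU ⟨z, hz⟩
  by_cases h0 : wallCoord p q z i = 0
  · obtain ⟨d, hd⟩ := exists_direction h i (normSq_ball_lt z) h0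
    obtain ⟨V, hV, rfl⟩ := isOpen_induced_iff.1 hU
    have hc : Continuous fun t : ℝ => (z : ℂ) + t * d := by fun_prop
    have hev : ∀ᶠ t : ℝ in nhdsWithin (0 : ℝ) (Set.Ioi 0), (z : ℂ) + (t : ℂ) * d ∈ V ∩ Metric.ball 0 1 := by
      apply nhdsWithin_le_nhds
      apply hc.continuousAt.eventually ((hV.inter Metric.isOpen_ball).mem_nhds _)
      beta_reduce
      rw [Complex.ofReal_zero, zero_mul, add_zero]
      exact ⟨hz, z.2⟩
    obtain ⟨t, ⟨htV, htb⟩, ht⟩ := (hev.and self_mem_nhdsWithin).exists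
    exact ⟨⟨_, htb⟩, htV, hd t ht (normSq_ball_lt ⟨_, htb⟩)⟩
  · exact ⟨z, hz, h0⟩

theorem isOpen_wallCoord_ne_zero (i : Fin 3) :
    IsOpen {z : Metric.ball (0 : ℂ) 1 | wallCoord p q z i ≠ 0} :=
  isOpen_ne_fun ((continuous_apply i).comp continuous_wallCoord) continuous_const

/-- The dihedral group is finite, so finitely many open dense conditions have to be met. -/
theorem exists_generic (h : IsHyperbolic p q) {U : Set SL2Cover} (hU : IsOpen U)
    (hne : U.Nonempty) : ∃ X ∈ U, ∀ u ∈ gen (triangleCoeff p q) {0, 1}, ∀ i,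
      u (wallCoord p q X.2) i ≠ 0 := by
  have hfin := finite_gen_pair h.isAngles (show (0 : Fin 3) ≠ 1 by decide)
  have hopen : ∀ u ∈ gen (triangleCoeff p q) {0, 1}, ∀ i,
      IsOpen {X : SL2Cover | u (wallCoord p q X.2) i ≠ 0} ∧
      Dense {X : SL2Cover | u (wallCoord p q X.2) i ≠ 0} := by
    intro u hu i
    obtain ⟨E, hE, -⟩ := exists_isometry_of_mem_gen h hu
    have e : {X : SL2Cover | u (wallCoord p q X.2) i ≠ 0} =
        (fun X : SL2Cover => ballIsometry E X.2) ⁻¹'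
          {z : Metric.ball (0 : ℂ) 1 | wallCoord p q z i ≠ 0} := by
      ext X
      change u (wallCoord p q X.2) i ≠ 0 ↔ wallCoord p q (E X.2) i ≠ 0
      rw [hE]
    rw [e]
    have hcont : Continuous fun X : SL2Cover => ballIsometry E X.2 := by fun_prop
    exact ⟨(isOpen_wallCoord_ne_zero i).preimage hcont, (dense_wallCoord_ne_zero h i).preimage
      ((ballIsometry E).isOpenMap.comp isOpenMap_snd)⟩
  have key : ∀ s : Set (Equiv.Perm (Fin 3 → ℝ) × Fin 3), s.Finite →
      s ⊆ (gen (triangleCoeff p q) {0, 1} : Set (Equiv.Perm (Fin 3 → ℝ))) ×ˢ Set.univ →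
      ∃ V ⊆ U, IsOpen V ∧ V.Nonempty ∧ ∀ X ∈ V, ∀ a ∈ s, a.1 (wallCoord p q X.2) a.2 ≠ 0 := by
    intro s hs
    induction s, hs using Set.Finite.induction_on with
    | empty => exact fun _ => ⟨U, subset_rfl, hU, hne, by simp⟩
    | insert _ _ ih =>
      intro hsub
      obtain ⟨V, hVU, hV, hVne, hVs⟩ := ih ((Set.subset_insert _ _).trans hsub)
      obtain ⟨h1, h2⟩ := hopen _ (hsub (Set.mem_insert _ _)).1 _
      refine ⟨V ∩ _, Set.inter_subset_left.trans hVU, hV.inter h1,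
        h2.inter_open_nonempty V hV hVne, ?_⟩
      rintro X ⟨hXV, hX⟩ b hb
      rcases Set.mem_insert_iff.1 hb with rfl | hb
      · exact hX
      · exact hVs X hXV b hb
  obtain ⟨V, hVU, -, ⟨X, hX⟩, hV⟩ := key _ (hfin.prod Set.finite_univ) subset_rfl
  exact ⟨X, hVU hX, fun u hu i => hV X hX (u, i) ⟨hu, trivial⟩⟩

theorem mem_image_infinitePrism_iff (h : IsHyperbolic p q) {g : SL2Cover ≃ₜ SL2Cover}
    {w : Equiv.Perm (Fin 3 → ℝ)}
    (hw : ∀ X, wallCoord p q (g⁻¹ X).2 = w (wallCoord p q X.2)) (X : SL2Cover) :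
    X ∈ g '' h.shape.infinitePrism ↔
      ∃ u ∈ gen (triangleCoeff p q) {0, 1}, ∀ i, 0 ≤ u (w (wallCoord p q X.2)) i := by
  rw [← hw, ← mem_baseFigure_iff h (g⁻¹ X).normSq_lt_one]
  constructor
  · rintro ⟨Y, hY, rfl⟩
    rw [show g⁻¹ (g Y) = Y from g.symm_apply_apply Y]
    exact hY.1
  · intro hX
    exact ⟨g⁻¹ X, ⟨hX, trivial⟩, g.apply_symm_apply X⟩

theorem isClosed_infinitePrism (S : RegularShape p) : IsClosed S.infinitePrism := by
  have : S.infinitePrism = (fun X : SL2Cover => (X.2 : ℂ)) ⁻¹' S.baseFigure := by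
    ext X
    exact and_iff_left trivial
  rw [this]
  exact S.isClosed_baseFigure.preimage (by fun_prop)

theorem isTiling_infiniteTiles (h : IsHyperbolic p q) : IsTiling (h.shape.infiniteTiles q) := by
  refine ⟨?_, ?_, ?_⟩
  · rintro _ ⟨g, -, rfl⟩
    exact g.isClosedMap _ (isClosed_infinitePrism _)
  · refine Set.eq_univ_of_forall fun X => ?_
    obtain ⟨w, hw, hX⟩ := exists_wallCoord_nonneg h X.2
    -- The element moving the trace point into the triangle splits into a symmetry of the polygon
    -- and a product of vertex rotations; the inverse of the latter gives the tile.
    obtain ⟨u, hu, v, hv, rfl⟩ := exists_mul_of_mem_gen hw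
    obtain ⟨g, hg, hgv⟩ := exists_mem_of_turn h hv
    refine ⟨_, ⟨g⁻¹, inv_mem hg, rfl⟩, ?_⟩
    rw [mem_image_infinitePrism_iff h (w := v) (by rwa [inv_inv])]
    exact ⟨u, hu, hX⟩
  · rintro _ ⟨g, hg, rfl⟩ _ ⟨g', hg', rfl⟩ hne
    obtain ⟨w, hw, e⟩ := exists_turn_of_mem h (inv_mem hg)
    obtain ⟨w', hw', e'⟩ := exists_turn_of_mem h (inv_mem hg')
    by_contra hdis
    apply hne
    have hU : IsOpen (g ⁻¹' (interior (g '' h.shape.infinitePrism) ∩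
        interior (g' '' h.shape.infinitePrism))) :=
      (isOpen_interior.inter isOpen_interior).preimage g.continuous
    obtain ⟨X₀, hX₀⟩ := Set.not_disjoint_iff_nonempty_inter.1 hdis
    obtain ⟨Y, ⟨hY1, hY2⟩, hY⟩ := exists_generic h hU ⟨g⁻¹ X₀, by
      rw [Set.mem_preimage, show g (g⁻¹ X₀) = X₀ from g.apply_symm_apply X₀]; exact hX₀⟩
    obtain ⟨u, hu, hun⟩ := (mem_image_infinitePrism_iff h e _).1 (interior_subset hY1)
    obtain ⟨u', hu', hun'⟩ := (mem_image_infinitePrism_iff h e' _).1 (interior_subset hY2)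
    have eY : w (wallCoord p q (g Y).2) = wallCoord p q Y.2 := by
      rw [← e, show g⁻¹ (g Y) = Y from g.symm_apply_apply Y]
    have hpos : ∀ i, 0 < u (w (wallCoord p q (g Y).2)) i := fun i =>
      lt_of_le_of_ne (hun i) (by rw [eY]; exact (hY u hu i).symm)
    have hmono : gen (triangleCoeff p q) {0, 1} ≤ gen (triangleCoeff p q) Set.univ :=
      gen_mono (Set.subset_univ _)
    -- A generic common point lies strictly inside the chamber for `u * w`, and this element keeps
    -- it in the cone, so Tits' theorem applies. The two tiles then differ only by symmetries of the
    -- polygon.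
    have hone : u' * w' * (u * w)⁻¹ = 1 := by
      refine eq_one_of_nonneg h.isAngles hpos (mul_mem (mul_mem (hmono hu') (turnGroup_le hw'))
        (inv_mem (mul_mem (hmono hu) (turnGroup_le hw)))) fun i => ?_
      have : (u' * w' * (u * w)⁻¹) (u (w (wallCoord p q (g Y).2))) =
          u' (w' (wallCoord p q (g Y).2)) := by
        change (u' * w') ((u * w)⁻¹ ((u * w) _)) = _
        rw [show (u * w)⁻¹ ((u * w) (wallCoord p q (g Y).2)) = wallCoord p q (g Y).2 from
          (u * w).symm_apply_apply _]
        rfl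
      rw [this]
      exact hun' i
    have hww : u' * w' = u * w := mul_inv_eq_one.1 hone
    ext Z
    rw [mem_image_infinitePrism_iff h e, mem_image_infinitePrism_iff h e']
    constructor
    · rintro ⟨v, hv, hvn⟩
      refine ⟨v * u⁻¹ * u', mul_mem (mul_mem hv (inv_mem hu)) hu', fun i => ?_⟩
      have : (v * u⁻¹ * u') (w' (wallCoord p q Z.2)) = v (w (wallCoord p q Z.2)) := by
        change (v * u⁻¹ * u' * w') _ = (v * w) _
        rw [mul_assoc _ u', hww, mul_assoc, inv_mul_cancel_left]
      rw [this]
      exact hvn i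
    · rintro ⟨v, hv, hvn⟩
      refine ⟨v * u'⁻¹ * u, mul_mem (mul_mem hv (inv_mem hu')) hu, fun i => ?_⟩
      have : (v * u'⁻¹ * u) (w (wallCoord p q Z.2)) = v (w' (wallCoord p q Z.2)) := by
        change (v * u'⁻¹ * u * w) _ = (v * w') _
        rw [mul_assoc _ u, ← hww, mul_assoc, inv_mul_cancel_left]
      rw [this]
      exact hvn i

theorem isRegularInfiniteTiling (h : IsHyperbolic p q) : IsRegularInfiniteTiling h.shape q :=
  ⟨fun k => ⟨_, isRotation_rotationAbout ⟨h.shape.vertex (k + 1), h.shape.vertex_mem (k + 1)⟩ _,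
    rotationAbout_image_side h k⟩, isTiling_infiniteTiles h⟩

end SL2Cover

namespace SL2Cover

variable {p q : ℕ}

/-! ### Cutting the infinite tiling -/

theorem fibreTranslation_apply (s : ℝ) (X : SL2Cover) : fibreTranslation s X = (X.1 + s, X.2) := rfl

theorem fibreTranslation_zpow (t : ℝ) (n : ℤ) :
    fibreTranslation t ^ n = fibreTranslation (n * t) := by
  induction n using Int.induction_on with
  | zero =>
    ext1 X
    rw [zpow_zero, fibreTranslation_apply]
    simp
  | succ n ih =>
    rw [zpow_add_one, ih]
    ext1 X
    change fibreTranslation _ (fibreTranslation _ X) = _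
    simp only [fibreTranslation_apply]
    refine Prod.ext ?_ rfl
    push_cast
    ring
  | pred n ih =>
    rw [zpow_sub_one, ih, mul_inv_eq_iff_eq_mul]
    ext1 X
    change _ = fibreTranslation _ (fibreTranslation _ X)
    simp only [fibreTranslation_apply]
    refine Prod.ext ?_ rfl
    push_cast
    ring

theorem fibreTranslation_image_prism (S : RegularShape p) {t : ℝ} (ht : 0 < t) (n : ℤ) :
    (fibreTranslation t ^ n : SL2Cover ≃ₜ SL2Cover) '' S.prism t =
      overBase S.baseFigure (Set.Icc (n * t) ((n + 1) * t)) := by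
  rw [fibreTranslation_zpow]
  refine image_eq_of_mem_iff fun X => and_congr Iff.rfl ?_
  rw [fibreTranslation_apply, Set.uIcc_of_le ht.le, Set.mem_Icc, Set.mem_Icc]
  constructor <;> rintro ⟨h1, h2⟩ <;> constructor <;> linarith

theorem interior_overBase_subset (B : Set ℂ) (a b : ℝ) :
    interior (overBase B (Set.Icc a b)) ⊆ Prod.fst ⁻¹' Set.Ioo a b := by
  rw [← interior_Icc, isOpenMap_fst.preimage_interior_eq_interior_preimage continuous_fst]
  exact interior_mono fun X hX => hX.2

theorem rotationGroup_le (S : RegularShape p) : S.rotationGroup q ≤ isometryGroup := by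
  refine (Subgroup.closure_le _).2 ?_
  rintro g ⟨k, hk⟩
  exact hk.mem_isometryGroup

/-- The tiles into which the infinite tiles are cut, if `sel` moves the infinite prism onto
them. -/
def cutTiles (S : RegularShape p) (q : ℕ) (sel : Set SL2Cover → (SL2Cover ≃ₜ SL2Cover)) (t : ℝ) :
    Set (Set SL2Cover) :=
  {T | ∃ Q ∈ S.infiniteTiles q, ∃ n : ℤ,
    T = sel Q '' ((fibreTranslation t ^ n : SL2Cover ≃ₜ SL2Cover) '' S.prism t)}

theorem exists_sel (S : RegularShape p) (q : ℕ) : ∃ sel : Set SL2Cover → (SL2Cover ≃ₜ SL2Cover),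
    ∀ Q ∈ S.infiniteTiles q, sel Q ∈ S.rotationGroup q ∧ sel Q '' S.infinitePrism = Q := by
  have h : ∀ Q ∈ S.infiniteTiles q, ∃ g : SL2Cover ≃ₜ SL2Cover,
      g ∈ S.rotationGroup q ∧ g '' S.infinitePrism = Q := by
    rintro _ ⟨g, hg, rfl⟩
    exact ⟨g, hg, rfl⟩
  choose! sel hsel using h
  exact ⟨sel, hsel⟩

section Cutting

variable {S : RegularShape p} {sel : Set SL2Cover → (SL2Cover ≃ₜ SL2Cover)}

theorem exists_of_mem_cutTiles
    (hsel : ∀ Q ∈ S.infiniteTiles q, sel Q ∈ S.rotationGroup q ∧ sel Q '' S.infinitePrism = Q)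
    {t : ℝ} {T : Set SL2Cover} (hT : T ∈ cutTiles S q sel t) :
    ∃ g ∈ isometryGroup, T = g '' S.prism t := by
  obtain ⟨Q, hQ, n, rfl⟩ := hT
  exact ⟨sel Q * fibreTranslation t ^ n, mul_mem (rotationGroup_le S (hsel Q hQ).1)
    (zpow_mem (fibreTranslation_mem t) n), (mul_image _ _ _).symm⟩

theorem isTiling_cutTiles
    (hsel : ∀ Q ∈ S.infiniteTiles q, sel Q ∈ S.rotationGroup q ∧ sel Q '' S.infinitePrism = Q)
    (h : IsTiling (S.infiniteTiles q)) {t : ℝ} (ht : 0 < t) :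
    IsTiling (cutTiles S q sel t) := by
  obtain ⟨-, hcov, hdis⟩ := h
  refine ⟨fun T hT => ?_, Set.eq_univ_of_forall fun X => ?_, ?_⟩
  · obtain ⟨g, -, rfl⟩ := exists_of_mem_cutTiles hsel hT
    exact ((S.isCompact_prism t).image g.continuous).isClosed
  · obtain ⟨Q, hQ, hXQ⟩ : X ∈ ⋃₀ S.infiniteTiles q := hcov ▸ Set.mem_univ X
    rw [← (hsel Q hQ).2] at hXQ
    obtain ⟨Y, hY, rfl⟩ := hXQ
    -- Heights are cut in the coordinates of the infinite prism, that is, after undoing the element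
    -- chosen for the tile.
    refine ⟨_, ⟨Q, hQ, ⌊Y.1 / t⌋, rfl⟩, Y, ?_, rfl⟩
    rw [fibreTranslation_image_prism S ht]
    refine ⟨hY.1, ?_, ?_⟩
    · exact (le_div_iff₀ ht).1 (Int.floor_le _)
    · exact ((div_lt_iff₀ ht).1 (Int.lt_floor_add_one _)).le
  · rintro _ ⟨Q, hQ, n, rfl⟩ _ ⟨Q', hQ', n', rfl⟩ hne
    rw [fibreTranslation_image_prism S ht, fibreTranslation_image_prism S ht]
    by_cases hQQ : Q = Q'
    · subst hQQ
      have hn : n ≠ n' := by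
        rintro rfl
        exact hne rfl
      rw [← (sel Q).image_interior, ← (sel Q).image_interior, Set.disjoint_image_iff
        (sel Q).injective]
      refine Set.disjoint_left.2 fun X h1 h2 => hn ?_
      obtain ⟨a1, a2⟩ := interior_overBase_subset _ _ _ h1
      obtain ⟨b1, b2⟩ := interior_overBase_subset _ _ _ h2
      have c1 : (n : ℝ) < n' + 1 := lt_of_mul_lt_mul_right (a1.trans b2) ht.le
      have c2 : (n' : ℝ) < n + 1 := lt_of_mul_lt_mul_right (b1.trans a2) ht.le
      have d1 : n < n' + 1 := by exact_mod_cast c1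
      have d2 : n' < n + 1 := by exact_mod_cast c2
      omega
    · have hsub : ∀ Q ∈ S.infiniteTiles q, ∀ J : Set ℝ, sel Q '' overBase S.baseFigure J ⊆ Q := by
        intro Q hQ J
        conv_rhs => rw [← (hsel Q hQ).2]
        exact Set.image_mono fun X hX => ⟨hX.1, trivial⟩
      exact (hdis Q hQ Q' hQ' hQQ).mono (interior_mono (hsub Q hQ _))
        (interior_mono (hsub Q' hQ' _))

theorem isRegularPrismTiling_cutTiles
    (hsel : ∀ Q ∈ S.infiniteTiles q, sel Q ∈ S.rotationGroup q ∧ sel Q '' S.infinitePrism = Q)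
    (h : IsTiling (S.infiniteTiles q)) {t : ℝ} (ht : 0 < t) :
    IsRegularPrismTiling S t (cutTiles S q sel t) := by
  refine ⟨isTiling_cutTiles hsel h ht, fun T hT => ?_⟩
  obtain ⟨g, hg, rfl⟩ := exists_of_mem_cutTiles hsel hT
  exact ⟨g, isIsometry_of_mem hg, rfl⟩

/-- The fibre segment over the origin keeps its length `s` and has to fit into the height range `[0,
t]`. -/
theorem le_of_image_prism_subset (hp : 3 ≤ p) {ε : ℝ} (hε : ε * ε = 1) {e : SL2Cover ≃ₜ SL2Cover}
    (he : PreservesForm ε e) {s t : ℝ} (ht : 0 < t)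
    (hsub : e '' S.prism s ⊆ S.prism t) : s ≤ t := by
  obtain ⟨r, hr, hB⟩ := S.exists_ball_subset_baseFigure hp
  let o : Metric.ball (0 : ℂ) 1 := ⟨0, by simp⟩
  have h0 : (o : ℂ) ∈ S.baseFigure := hB 0 (by simpa using hr)
  have h1 := (hsub ⟨(0, o), ⟨h0, Set.left_mem_uIcc⟩, rfl⟩).2
  have h2 := (hsub ⟨(s, o), ⟨h0, Set.right_mem_uIcc⟩, rfl⟩).2
  rw [he.apply_mk, Set.uIcc_of_le ht.le] at h2
  rw [Set.uIcc_of_le ht.le] at h1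
  obtain ⟨a1, a2⟩ := h1
  obtain ⟨b1, b2⟩ := h2
  simp only at b1 b2
  rcases mul_self_eq_one_iff.1 hε with rfl | rfl <;> linarith

/-- A congruence would carry the prism of height `s` onto that of height `t`, and comparing fibre
lengths both ways gives `s = t`. -/
theorem not_areCongruent_cutTiles (hp : 3 ≤ p)
    (hsel : ∀ Q ∈ S.infiniteTiles q, sel Q ∈ S.rotationGroup q ∧ sel Q '' S.infinitePrism = Q)
    {s t : ℝ} (hs : 0 < s) (ht : 0 < t) (hst : s ≠ t) :
    ¬ AreCongruent (cutTiles S q sel s) (cutTiles S q sel t) := by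
  rintro ⟨g, hg, hgst⟩
  obtain ⟨T, hT⟩ : (cutTiles S q sel s).Nonempty :=
    ⟨_, _, ⟨1, one_mem _, rfl⟩, 0, rfl⟩
  have hgT : g '' T ∈ cutTiles S q sel t := hgst ▸ ⟨T, hT, rfl⟩
  obtain ⟨k, hk, rfl⟩ := exists_of_mem_cutTiles hsel hT
  obtain ⟨k', hk', e⟩ := exists_of_mem_cutTiles hsel hgT
  have hsq : ∀ ε : ℝ, ε = 1 ∨ ε = -1 → ε * ε = 1 := by
    rintro ε (rfl | rfl) <;> norm_num
  obtain ⟨a, ha, hga⟩ := exists_preservesForm hg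
  obtain ⟨b, hb, hkb⟩ := exists_preservesForm (isIsometry_of_mem hk)
  obtain ⟨c, hc, hkc⟩ := exists_preservesForm (isIsometry_of_mem hk')
  have hform := ((hkc.inv (hsq c hc)).mul hga).mul hkb
  have hε : c * a * b * (c * a * b) = 1 := by
    linear_combination (a * a * (b * b)) * hsq c hc + b * b * hsq a ha + hsq b hb
  have himg : (k'⁻¹ * g * k : SL2Cover ≃ₜ SL2Cover) '' S.prism s = S.prism t := by
    rw [mul_image, mul_image, e, inv_image_image]
  apply hst
  apply le_antisymm
  · exact le_of_image_prism_subset hp hε hform ht himg.subset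
  · refine le_of_image_prism_subset (S := S) hp hε (hform.inv hε) hs ?_
    rw [← himg, inv_image_image]

end Cutting

end SL2Cover

theorem theorem2p3 (p q : ℕ) (hp : 3 ≤ p) (hq : (2 * p : ℝ) / (p - 2) < q) :
    (∃ S : SL2Cover.RegularShape p, SL2Cover.IsRegularInfiniteTiling S q ∧
      ∃ 𝒯 : ℝ → Set (Set SL2Cover),
        (∀ t : ℝ, 0 < t → S.IsCutting q t (𝒯 t) ∧
          SL2Cover.IsRegularPrismTiling S t (𝒯 t) ∧ ¬ SL2Cover.IsFaceToFace S t (𝒯 t)) ∧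
        ∀ s t : ℝ, 0 < s → 0 < t → s ≠ t → ¬ SL2Cover.AreCongruent (𝒯 s) (𝒯 t)) ∧
    (∀ (S : SL2Cover.RegularShape p) (t : ℝ) (𝒯 : Set (Set SL2Cover)), t ≠ 0 →
      SL2Cover.IsRegularPrismTiling S t 𝒯 → ¬ SL2Cover.IsFaceToFace S t 𝒯) := by
  obtain ⟨hq2, hlt⟩ := SL2Cover.sin_lt_cos_of_lt hp hq
  have h : SL2Cover.IsHyperbolic p q := ⟨hp, hq2, hlt⟩
  obtain ⟨sel, hsel⟩ := SL2Cover.exists_sel h.shape q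
  have hT := SL2Cover.isRegularInfiniteTiling h
  refine ⟨⟨h.shape, hT, SL2Cover.cutTiles h.shape q sel, fun t ht => ?_, fun s t hs ht hst =>
    SL2Cover.not_areCongruent_cutTiles hp hsel hs ht hst⟩,
    fun S t 𝒯 ht hS => SL2Cover.not_isFaceToFace hp ht hS⟩
  have hP := SL2Cover.isRegularPrismTiling_cutTiles hsel hT.2 ht
  exact ⟨⟨sel, hsel, rfl⟩, hP, SL2Cover.not_isFaceToFace hp ht.ne' hP⟩
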